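/- Let $M$ be a real smooth or a complex (holomorphic) manifold of dimension $2n$ over $\Bbbk=\mathbb R$, respectively $\Bbbk=\mathbb C$; on a complex manifold, "smooth" means holomorphic, and functions, tensors and coordinates are over $\mathbb C$. Let $P,P':T^*M\to TM$ be compatible Poisson tensors, i.e. $P$, $P'$ and $P'-cP$ for every $c\in\Bbbk$ are smooth and antisymmetric and their brackets (for $P$: $\{f,g\}=\langle df,P\,dg\rangle$) satisfy the Jacobi identity. Assume that $P$ is invertible at every point, and let $N=P'P^{-1}:TM\to TM$ be the Nijenhuis tensor and $N^*:T^*M\to T^*M$ its dual, $N^*\alpha=\alpha\circ N$. For $k\ge 1$ put $$I_k=\frac1{2k}\operatorname{Tr}N^k ,$$ and let $U\subseteq M$ be the set of points where $dI_1\wedge\cdots\wedge dI_n\ne0$. Let $\mathbb K\in\{\mathbb R,\mathbb C\}$ be $\Bbbk$ or an extension of it (so that complex eigenvalues are allowed on a real manifold). By *eigenvalue functions of $N$ on an open set $V\subseteq M$* we mean smooth functions $\lambda_1,\dots,\lambda_n:V\to\mathbb K$ such that the characteristic polynomial of $N_m$ is $\prod_{i=1}^n(t-\lambda_i(m))^2$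 for all $m\in V$; they are not required to be distinct. Then: 1. $U$ is open. 2. If $N_m$ has $n$ different eigenvalues in $\mathbb K$ at a point $m\in M$, then there are $\mathbb K$-valued eigenvalue functions of $N$ on a neighbourhood of $m$. 3. If $\lambda_1,\dots,\lambda_n:V\to\mathbb K$ are eigenvalue functions of $N$, then at every point of $U\cap V$ the eigenvalues $\lambda_i$ are pairwise distinct, their differentials $d\lambda_1,\dots,d\lambda_n$ are linearly independent over $\mathbb K$ (functional independence), and $$N^*d\lambda_i=\lambda_i\,d\lambda_i,\qquad i=1,\dots,n .$$ 4. If the eigenvalue functions $\lambda_1,\dots,\lambda_n$ on $V$ are $\Bbbk$-valued, they are half of a set of Darboux--Nijenhuis coordinates near each point $m\in U\cap V$: on an open neighbourhood $W\subseteq V$ of $m$ there is a chart $(x_1,\dots,x_n,y_1,\dots,y_n)$ with $x_i=\lambda_i$, with $\{x_i,y_j\}=\delta_{ij}$, $\{x_i,x_j\}=\{y_i,y_j\}=0$, and with $$N=\sum_{i=1}^n\lambda_i\Big(\frac{\partial}{\partial y_i}\otimes dy_i+\frac{\partial}{\partial x_i}\otimes dx_i\Big).$$ -/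

import Mathlib

open scoped Manifold ContDiff Topology

noncomputable section

/-- The model space of manifolds of dimension `2n` over `𝕜` (which is `ℝ` or `ℂ`). -/
abbrev Model (𝕜 : Type*) [RCLike 𝕜] (n : ℕ) : Type _ := EuclideanSpace 𝕜 (Fin (2 * n))

/-- The model with corners of (boundaryless) manifolds of dimension `2n` over `𝕜`.
For `𝕜 = ℝ`, being `C^∞` with respect to it means smooth; for `𝕜 = ℂ` it means holomorphic. -/
abbrev Mdl (𝕜 : Type*) [RCLike 𝕜] (n : ℕ) : ModelWithCorners 𝕜 (Model 𝕜 n) (Model 𝕜 n) :=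
  modelWithCornersSelf 𝕜 (Model 𝕜 n)

/-- The tangent space at a point of a manifold of dimension `2n`. -/
abbrev Tan (𝕜 : Type*) [RCLike 𝕜] (n : ℕ) {M : Type*} [TopologicalSpace M]
    [ChartedSpace (Model 𝕜 n) M] (m : M) : Type _ :=
  TangentSpace (Mdl 𝕜 n) m

instance instFiniteTan (𝕜 : Type*) [RCLike 𝕜] (n : ℕ) {M : Type*} [TopologicalSpace M]
    [ChartedSpace (Model 𝕜 n) M] (m : M) : Module.Finite 𝕜 (Tan 𝕜 n m) :=
  inferInstanceAs (Module.Finite 𝕜 (Model 𝕜 n))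

/-- The differential at `m` of a function with values in an extension `𝕂` of `𝕜`, as a `𝕜`-linear
map on the tangent space. For `𝕂 = 𝕜` this is a covector; for `𝕜 = ℝ` and `𝕂 = ℂ` it is an
element of the complexified cotangent space. -/
def dAt (𝕜 : Type*) {𝕂 : Type*} [RCLike 𝕜] [RCLike 𝕂] [NormedAlgebra 𝕜 𝕂] (n : ℕ) {M : Type*}
    [TopologicalSpace M] [ChartedSpace (Model 𝕜 n) M] (f : M → 𝕂) (m : M) :
    Tan 𝕜 n m →ₗ[𝕜] 𝕂 :=
  (mfderiv (Mdl 𝕜 n) 𝓘(𝕜, 𝕂) f m : Tan 𝕜 n m →L[𝕜] 𝕂).toLinearMap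

/-- A field of fibrewise linear maps `T*M → TM`. -/
abbrev CotangentToTangent (𝕜 : Type*) [RCLike 𝕜] (n : ℕ) (M : Type*) [TopologicalSpace M]
    [ChartedSpace (Model 𝕜 n) M] : Type _ :=
  ∀ m : M, Module.Dual 𝕜 (Tan 𝕜 n m) →ₗ[𝕜] Tan 𝕜 n m

section
variable {𝕜 : Type*} [RCLike 𝕜] {n : ℕ} {M : Type*} [TopologicalSpace M]
  [ChartedSpace (Model 𝕜 n) M]

/-- The bracket `{f, g} = ⟨df, P dg⟩`. -/
def bracket (P : CotangentToTangent 𝕜 n M) (f g : M → 𝕜) (m : M) : 𝕜 :=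
  dAt 𝕜 n f m (P m (dAt 𝕜 n g m))

/-- `P` is a Poisson tensor: it is antisymmetric, it varies smoothly (the bracket of two smooth
functions is smooth) and its bracket satisfies the Jacobi identity. Functions are taken on
arbitrary open subsets, so that the definition is also the right one on complex manifolds, which
may have few global holomorphic functions. -/
structure IsPoissonTensor (P : CotangentToTangent 𝕜 n M) : Prop where
  antisymm : ∀ (m : M) (α β : Module.Dual 𝕜 (Tan 𝕜 n m)), α (P m β) = - β (P m α)
  smooth : ∀ (V : Set M), IsOpen V → ∀ f g : M → 𝕜,
    ContMDiffOn (Mdl 𝕜 n) 𝓘(𝕜, 𝕜) ∞ f V → ContMDiffOn (Mdl 𝕜 n) 𝓘(𝕜, 𝕜) ∞ g V →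
    ContMDiffOn (Mdl 𝕜 n) 𝓘(𝕜, 𝕜) ∞ (bracket P f g) V
  jacobi : ∀ (V : Set M), IsOpen V → ∀ f g h : M → 𝕜,
    ContMDiffOn (Mdl 𝕜 n) 𝓘(𝕜, 𝕜) ∞ f V → ContMDiffOn (Mdl 𝕜 n) 𝓘(𝕜, 𝕜) ∞ g V →
    ContMDiffOn (Mdl 𝕜 n) 𝓘(𝕜, 𝕜) ∞ h V → ∀ m ∈ V,
      bracket P f (bracket P g h) m + bracket P g (bracket P h f) m
        + bracket P h (bracket P f g) m = 0

/-- `(P, P')` is a bihamiltonian structure: two Poisson tensors such that every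
`P' - c P` is again a Poisson tensor. -/
structure IsBihamiltonian (P P' : CotangentToTangent 𝕜 n M) : Prop where
  left : IsPoissonTensor P
  right : IsPoissonTensor P'
  compatible : ∀ c : 𝕜, IsPoissonTensor (fun m => P' m - c • P m)

/-- The Nijenhuis (recursion) tensor `N = P' P⁻¹`, where `P` is invertible at every point. -/
def nijenhuis (P P' : CotangentToTangent 𝕜 n M) (hP : ∀ m, Function.Bijective (P m)) (m : M) :
    Tan 𝕜 n m →ₗ[𝕜] Tan 𝕜 n m :=
  P' m ∘ₗ (LinearEquiv.ofBijective (P m) (hP m)).symm.toLinearMap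

/-- The normalized trace `I_k = (1 / 2k) Tr N ^ k`. -/
def normTrace (N : ∀ m : M, Tan 𝕜 n m →ₗ[𝕜] Tan 𝕜 n m) (k : ℕ) (m : M) : 𝕜 :=
  1 / (2 * (k : 𝕜)) * LinearMap.trace 𝕜 (Tan 𝕜 n m) (N m ^ k)

/-- The set `U` of points at which `dI₁ ∧ ⋯ ∧ dIₙ ≠ 0`. -/
def independenceLocus (N : ∀ m : M, Tan 𝕜 n m →ₗ[𝕜] Tan 𝕜 n m) : Set M :=
  {m | exteriorPower.ιMulti 𝕜 n
    (fun i : Fin n => (dAt 𝕜 n (normTrace N (i + 1)) m : Module.Dual 𝕜 (Tan 𝕜 n m))) ≠ 0}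

/-- At `m` the tensor `N` has `n` (half of the dimension) different eigenvalues in the
extension `𝕂` of `𝕜`. -/
def IsRegularAt (𝕂 : Type*) [RCLike 𝕂] [NormedAlgebra 𝕜 𝕂]
    (N : ∀ m : M, Tan 𝕜 n m →ₗ[𝕜] Tan 𝕜 n m) (m : M) : Prop :=
  ((N m).charpoly.rootSet 𝕂).ncard = n

/-- The functions `lam 0, …, lam (n - 1)`, with values in the extension `𝕂` of `𝕜`, are smooth on
`V` and are the eigenvalues of `N` on `V`, each counted with half of its multiplicity. They are not
required to be different. -/
structure IsEigenvalueSystem {𝕂 : Type*} [RCLike 𝕂] [NormedAlgebra 𝕜 𝕂]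
    (N : ∀ m : M, Tan 𝕜 n m →ₗ[𝕜] Tan 𝕜 n m) (V : Set M) (lam : Fin n → M → 𝕂) : Prop where
  smooth : ∀ i, ContMDiffOn (Mdl 𝕜 n) 𝓘(𝕜, 𝕂) ∞ (lam i) V
  charpoly : ∀ m ∈ V, (N m).charpoly.map (algebraMap 𝕜 𝕂)
    = ∏ i, (Polynomial.X - Polynomial.C (lam i m)) ^ 2

/-- The index of the coordinate `x_i`. -/
def xIdx (i : Fin n) : Fin (2 * n) := ⟨i, by omega⟩

/-- The index of the coordinate `y_i`. -/
def yIdx (i : Fin n) : Fin (2 * n) := ⟨n + i, by omega⟩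

/-- The coordinate functions of a chart. -/
def coord (Φ : OpenPartialHomeomorph M (Model 𝕜 n)) (k : Fin (2 * n)) (m : M) : 𝕜 := Φ m k

/-- The coordinate vector fields of a chart: `∂_k` is mapped to the `k`-th standard vector by the
differential of the chart. -/
def coordVec (Φ : OpenPartialHomeomorph M (Model 𝕜 n)) (k : Fin (2 * n)) (m : M) : Tan 𝕜 n m :=
  (mfderiv (Mdl 𝕜 n) (Mdl 𝕜 n) Φ m).inverse (EuclideanSpace.single k (1 : 𝕜) : Model 𝕜 n)

/-- The chart `Φ`, with coordinates `x_i, y_i`, is a Darboux-Nijenhuis chart with eigenvalues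
`lam i`: the coordinates are canonical for the bracket of `P`, and
`N = ∑ i, lam i • (∂/∂y_i ⊗ dy_i + ∂/∂x_i ⊗ dx_i)`. -/
structure IsDarbouxNijenhuis (P : CotangentToTangent 𝕜 n M)
    (N : ∀ m : M, Tan 𝕜 n m →ₗ[𝕜] Tan 𝕜 n m) (lam : Fin n → M → 𝕜)
    (Φ : OpenPartialHomeomorph M (Model 𝕜 n)) : Prop where
  chart : Φ ∈ IsManifold.maximalAtlas (Mdl 𝕜 n) ∞ M
  bracket_xy : ∀ m ∈ Φ.source, ∀ i j : Fin n,
    bracket P (coord Φ (xIdx i)) (coord Φ (yIdx j)) m = if i = j then 1 else 0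
  bracket_xx : ∀ m ∈ Φ.source, ∀ i j : Fin n,
    bracket P (coord Φ (xIdx i)) (coord Φ (xIdx j)) m = 0
  bracket_yy : ∀ m ∈ Φ.source, ∀ i j : Fin n,
    bracket P (coord Φ (yIdx i)) (coord Φ (yIdx j)) m = 0
  diagonal : ∀ m ∈ Φ.source, ∀ v : Tan 𝕜 n m,
    N m v = ∑ i : Fin n, lam i m •
      (dAt 𝕜 n (coord Φ (yIdx i)) m v • coordVec Φ (yIdx i) m
        + dAt 𝕜 n (coord Φ (xIdx i)) m v • coordVec Φ (xIdx i) m)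

end

end

/-! Everything rests on the pencil `P' - cP`: each member is antisymmetric and Poisson, and
identities are compared as functions of the constant `c`.

Antisymmetry makes the eigenvalues double. In a chart `det (P' - cP) = det P · χ(c)` with `χ` the
characteristic polynomial of `N`. Determinants of alternating matrices are squares, so `χ` is the
square of a monic `q` of degree `n` (`Matrix.exists_charpoly_eq_sq`). The coefficients of `q` are
smooth, and simple roots move smoothly by the implicit function theorem (`exists_contDiffOn_roots`).

For eigenvalue functions `I_k = (1/k) ∑ λ_i ^ k`, hence `dI_k = ∑ λ_i ^ (k-1) dλ_i`. Independence of
the `dI_k` makes the Vandermonde matrix invertible and the `dλ_i` independent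
(`LinearIndependent.of_power_sums`).

For a Poisson tensor `Q` and a constant covector `α`, the derivative of `det Q` along `Q α` is `det
Q` times a divergence that is linear in the derivative of `Q` (`IsLocalPoisson.fderiv_det`). For the
pencil the determinant is `det P · ∏ (c - λ_i)²` and the divergence is affine in `c`. Once a factor
`∏ (c - λ_i)` is cancelled, evaluation at `c = λ_i` leaves `dλ_i (P' α) = λ_i dλ_i (P α)`
(`fderiv_eigenvalue`).

For the coordinates, a chart is chosen in which the `λ_i` are linear. The symplectic form splits
along the eigenspaces of `N` as `∑ Θ_i` with `Θ_i = dλ_i ∧ α_i`. The inverse `∑ (λ_i - c)⁻¹ Θ_i` of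
a pencil member is closed. Since `dλ_i ∧ Θ_i = 0` and simple fractions are independent, every `Θ_i`
is closed. A Poincaré lemma along the levels of `λ_i` then gives `y_i` with `dy_i = α_i` modulo
`dλ_i`. These are again eigencovectors, and eigencovectors with different eigenvalues are orthogonal
for `P` (`exists_conjugate_functions`). -/

noncomputable section

/-! ### Linear algebra -/

/-- The determinant of an alternating matrix over a field is a square. -/
theorem Matrix.isSquare_det_of_alternating {F : Type*} [Field F] :
    ∀ (n : ℕ) (A : Matrix (Fin n) (Fin n) F), A.transpose = -A → (∀ i, A i i = 0) →
      IsSquare A.det := by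
  intro n
  induction n using Nat.strong_induction_on with
  | _ n ih =>
  intro A hA hd
  match n, ih, A, hA, hd with
  | 0, _, A, _, _ => exact ⟨1, by simp⟩
  | 1, _, A, _, hd => exact ⟨0, by simp [hd]⟩
  | m + 2, ih, A, hA, hd =>
    by_cases h0 : ∀ j, A 0 j = 0
    · exact ⟨0, by rw [Matrix.det_eq_zero_of_row_eq_zero 0 h0]; simp⟩
    push Not at h0
    obtain ⟨j, hj⟩ := h0
    have hj0 : j ≠ 0 := by rintro rfl; exact hj (hd 0)
    -- Reindexing moves the indices `0, j` to the front, so that the pivot block is `[[0, a], [-a,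
    -- 0]]` with `a = A 0 j ≠ 0`.
    let σ : Equiv.Perm (Fin (m + 2)) := Equiv.swap 1 j
    let e : Fin 2 ⊕ Fin m ≃ Fin (m + 2) :=
      (finSumFinEquiv.trans (finCongr (Nat.add_comm 2 m))).trans σ
    have he0 : e (Sum.inl 0) = 0 := by
      have : (finSumFinEquiv.trans (finCongr (Nat.add_comm 2 m))) (Sum.inl 0) = 0 := by
        ext; simp
      simp only [e, Equiv.trans_apply] at this ⊢
      rw [this]
      exact Equiv.swap_apply_of_ne_of_ne (by simp) hj0.symm
    have he1 : e (Sum.inl 1) = j := by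
      have : (finSumFinEquiv.trans (finCongr (Nat.add_comm 2 m))) (Sum.inl 1) = 1 := by
        ext; simp
      simp only [e, Equiv.trans_apply] at this ⊢
      rw [this]
      exact Equiv.swap_apply_left _ _
    have hskew : ∀ i k, A k i = - A i k := fun i k => by
      have := congrFun (congrFun hA i) k
      simpa using this
    set S := A.submatrix e e with hS
    have hdet : A.det = S.det := by rw [hS, Matrix.det_submatrix_equiv_self]
    set J := S.toBlocks₁₁
    have hJ : J.det = A 0 j ^ 2 := by
      rw [Matrix.det_fin_two]
      simp only [J, S, Matrix.toBlocks₁₁, Matrix.submatrix_apply, Matrix.of_apply, he0, he1]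
      rw [hd, hskew 0 j]; ring
    have hJu : IsUnit J.det := by rw [hJ]; exact (pow_ne_zero 2 hj).isUnit
    let _ : Invertible J := Matrix.invertibleOfIsUnitDet J hJu
    have hSskew : ∀ i k, S k i = - S i k := fun i k => hskew _ _
    have hJt : J.transpose = -J := by
      ext a b; exact hSskew _ _
    have hJit : (⅟J).transpose = -⅟J := by
      rw [Matrix.invOf_eq_nonsing_inv, Matrix.transpose_nonsing_inv, hJt]
      refine Matrix.inv_eq_right_inv ?_
      rw [neg_mul_neg]; exact Matrix.mul_nonsing_inv _ hJu
    have hBt : S.toBlocks₁₂.transpose = -S.toBlocks₂₁ := by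
      ext a b; simpa [Matrix.toBlocks₁₂, Matrix.toBlocks₂₁] using hSskew (Sum.inr a) (Sum.inl b)
    have hCt : S.toBlocks₂₁.transpose = -S.toBlocks₁₂ := by
      ext a b; simpa [Matrix.toBlocks₁₂, Matrix.toBlocks₂₁] using hSskew (Sum.inl a) (Sum.inr b)
    have hDt : S.toBlocks₂₂.transpose = -S.toBlocks₂₂ := by
      ext a b; simpa [Matrix.toBlocks₂₂] using hSskew (Sum.inr a) (Sum.inr b)
    have hEt : (S.toBlocks₂₁ * ⅟J * S.toBlocks₁₂).transpose
        = -(S.toBlocks₂₁ * ⅟J * S.toBlocks₁₂) := by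
      rw [Matrix.transpose_mul, Matrix.transpose_mul, hBt, hCt, hJit]
      simp [Matrix.mul_assoc]
    -- In characteristic two skew-symmetry does not force a zero diagonal, so the diagonal is
    -- computed separately.
    have hEd : ∀ a, (S.toBlocks₂₁ * ⅟J * S.toBlocks₁₂) a a = 0 := by
      have hJ00 : (⅟J) 0 0 = 0 := by
        rw [Matrix.invOf_eq_nonsing_inv, Matrix.inv_def, Matrix.adjugate_fin_two]
        simp [J, S, Matrix.toBlocks₁₁, hd]
      have hJ11 : (⅟J) 1 1 = 0 := by
        rw [Matrix.invOf_eq_nonsing_inv, Matrix.inv_def, Matrix.adjugate_fin_two]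
        simp [J, S, Matrix.toBlocks₁₁, hd]
      have hJ10 : (⅟J) 1 0 = - (⅟J) 0 1 := by
        simpa using congrFun (congrFun hJit 0) 1
      intro a
      have hc : ∀ b, S.toBlocks₂₁ a b = - S.toBlocks₁₂ b a := fun b => hSskew _ _
      simp only [Matrix.mul_apply, Fin.sum_univ_two, hJ00, hJ11, hJ10, hc]
      ring
    -- The Schur complement of the pivot block is again alternating, of size `m`, and the pivot
    -- block contributes the square `A 0 j ^ 2`.
    have key := Matrix.det_fromBlocks₁₁ J S.toBlocks₁₂ S.toBlocks₂₁ S.toBlocks₂₂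
    rw [show Matrix.fromBlocks J S.toBlocks₁₂ S.toBlocks₂₁ S.toBlocks₂₂ = S from
      Matrix.fromBlocks_toBlocks S] at key
    rw [hdet, key, hJ]
    refine IsSquare.mul ⟨A 0 j, sq _⟩ (ih m (by omega) _ ?_ ?_)
    · rw [Matrix.transpose_sub, hDt, hEt]; abel
    · intro i
      rw [Matrix.sub_apply, hEd]
      simp [Matrix.toBlocks₂₂, S, hd]

/-- If `N B` and `B` are alternating and `B` is invertible, then the characteristic polynomial
of `N` is a square. -/
theorem Matrix.exists_charpoly_eq_sq {F : Type*} [Field F] [CharZero F] {n : ℕ}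
    {N A B : Matrix (Fin n) (Fin n) F} (hN : N * B = A) (hA : A.transpose = -A)
    (hB : B.transpose = -B) (hdet : B.det ≠ 0) :
    ∃ q : Polynomial F, q.Monic ∧ N.charpoly = q ^ 2 := by
  classical
  let R := Polynomial F
  let K := FractionRing R
  have hinj : Function.Injective (algebraMap R K) := IsFractionRing.injective R K
  let φ : F →+* K := (algebraMap R K).comp Polynomial.C
  -- `S` is the alternating matrix `X B - A = (X - N) B`, taken over the fraction field because the
  -- square criterion is for fields.
  let S : Matrix (Fin n) (Fin n) K := algebraMap R K Polynomial.X • B.map φ - A.map φ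
  have hAe : ∀ i j, A j i = - A i j := fun i j => by simpa using congrFun (congrFun hA i) j
  have hBe : ∀ i j, B j i = - B i j := fun i j => by simpa using congrFun (congrFun hB i) j
  have hS : S = (N.charmatrix.map (algebraMap R K)) * B.map φ := by
    ext i j
    simp only [S, Matrix.sub_apply, Matrix.smul_apply, Matrix.map_apply, Matrix.mul_apply, ← hN,
      Matrix.charmatrix, Matrix.scalar_apply, Matrix.diagonal_apply, map_sub, map_sum, map_mul,
      sub_mul, Finset.sum_sub_distrib, RingHom.mapMatrix_apply, smul_eq_mul]
    congr 1
    rw [Finset.sum_eq_single i]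
    · simp
    · intro b _ hb; simp [hb.symm]
    · simp
  have hSdet : S.det = algebraMap R K N.charpoly * φ B.det := by
    rw [hS, Matrix.det_mul, Matrix.charpoly]
    congr 1
    · exact (RingHom.map_det _ _).symm
    · exact (RingHom.map_det _ _).symm
  obtain ⟨r, hr⟩ := Matrix.isSquare_det_of_alternating n S
    (by ext i j; simp [S, hAe i j, hBe i j]; ring)
    (by
      intro i
      have h1 : A i i = 0 := by have := hAe i i; exact self_eq_neg.mp this
      have h2 : B i i = 0 := by have := hBe i i; exact self_eq_neg.mp this
      simp [S, h1, h2])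
  obtain ⟨b, hb⟩ := Matrix.isSquare_det_of_alternating n B hB
    (fun i => self_eq_neg.mp (hBe i i))
  have hb0 : b ≠ 0 := by rintro rfl; exact hdet (by simpa using hb)
  have hφb : φ b ≠ 0 := by simpa using hb0
  have h1 : algebraMap R K N.charpoly = (r / φ b) ^ 2 := by
    rw [hr, hb, map_mul] at hSdet
    rw [div_pow, eq_div_iff (pow_ne_zero 2 hφb), sq, ← hSdet, sq]
  -- A square root of a polynomial in the fraction field is integral, hence a polynomial.
  obtain ⟨q, hq⟩ := IsIntegrallyClosed.exists_algebraMap_eq_of_isIntegral_pow (R := R) (K := K)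
    (x := r / φ b) (n := 2) (by norm_num) (by rw [← h1]; exact isIntegral_algebraMap)
  have h2 : N.charpoly = q ^ 2 := by
    apply hinj; rw [h1, map_pow, hq]
  have hlc : q.leadingCoeff ^ 2 = 1 := by
    rw [← Polynomial.leadingCoeff_pow, ← h2]; exact N.charpoly_monic
  rcases (sq_eq_sq_iff_eq_or_eq_neg.mp (hlc.trans (one_pow 2).symm)) with h | h
  · exact ⟨q, h, h2⟩
  · exact ⟨-q, by rw [Polynomial.Monic, Polynomial.leadingCoeff_neg, h, neg_neg], by rw [h2]; ring⟩

/-- The trace of a power of an endomorphism is a power sum of eigenvalues. -/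
theorem Module.End.trace_pow_eq_sum_roots {K V : Type*} [Field K] [IsAlgClosed K]
    [AddCommGroup V] [Module K V] [Module.Finite K V] (f : Module.End K V) (k : ℕ) :
    LinearMap.trace K V (f ^ k) = (f.charpoly.roots.map (· ^ k)).sum := by
  classical
  have hmaps : ∀ (k : ℕ) μ, Set.MapsTo (f ^ k) (f.maxGenEigenspace μ) (f.maxGenEigenspace μ) :=
    fun k μ => f.mapsTo_maxGenEigenspace_of_comm (Commute.pow_right rfl k) μ
  have hmap1 := fun μ => f.mapsTo_maxGenEigenspace_of_comm (Commute.refl f) μ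
  have key : ∀ μ, LinearMap.trace K _ ((f ^ k).restrict (hmaps k μ))
      = μ ^ k * (Module.finrank K (f.maxGenEigenspace μ) : K) := by
    intro μ
    induction k with
    | zero =>
      have e : (f ^ 0).restrict (hmaps 0 μ) = 1 := rfl
      rw [e, LinearMap.trace_one, pow_zero, one_mul]
    | succ k ih =>
      have hc : Commute ((f ^ k).restrict (hmaps k μ)) (f.restrict (hmap1 μ)) :=
        LinearMap.restrict_commute ((Commute.refl f).pow_left k) _ _
      -- On a generalized eigenspace `f` is `μ` plus a nilpotent map, so each further factor `f`
      -- multiplies the trace by `μ`.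
      have := LinearMap.trace_comp_eq_mul_of_commute_of_isNilpotent μ hc
        (f.isNilpotent_restrict_maxGenEigenspace_sub_algebraMap μ)
      have e : (f ^ (k + 1)).restrict (hmaps (k + 1) μ)
          = (f ^ k).restrict (hmaps k μ) ∘ₗ f.restrict (hmap1 μ) := rfl
      rw [e, this, ih, pow_succ]
      ring
  have hds := DirectSum.isInternal_submodule_of_iSupIndep_of_iSup_eq_top
    f.independent_maxGenEigenspace (Module.End.iSup_maxGenEigenspace_eq_top f)
  have hfin : {μ | f.maxGenEigenspace μ ≠ ⊥}.Finite :=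
    WellFoundedGT.finite_ne_bot_of_iSupIndep f.independent_maxGenEigenspace
  rw [LinearMap.trace_eq_sum_trace_restrict' hds hfin (hmaps k), Finset.sum_multiset_map_count]
  simp only [key, LinearMap.finrank_maxGenEigenspace_eq, Polynomial.count_roots, nsmul_eq_mul]
  symm
  have hsub : f.charpoly.roots.toFinset ⊆ hfin.toFinset := by
    intro μ hμ
    simp only [Set.Finite.mem_toFinset, Set.mem_ofPred_eq]
    intro h0
    have h1 := LinearMap.finrank_maxGenEigenspace_eq f μ
    rw [h0, finrank_bot, ← Polynomial.count_roots] at h1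
    exact Multiset.count_ne_zero.mpr (Multiset.mem_toFinset.mp hμ) h1.symm
  rw [Finset.sum_subset hsub]
  · exact Finset.sum_congr rfl fun _ _ => mul_comm _ _
  · intro μ _ hμ
    rw [← Polynomial.count_roots, Multiset.count_eq_zero.mpr (by simpa using hμ)]
    simp

/-- Over an algebraic closure of `K` the trace is the power sum of all roots of the characteristic
polynomial; the exponent `2` counts each `lam i` twice. -/
theorem Matrix.algebraMap_trace_pow {F K : Type*} [Field F] [Field K] [Algebra F K] {d m : ℕ}
    (A : Matrix (Fin d) (Fin d) F) (lam : Fin m → K)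
    (h : A.charpoly.map (algebraMap F K) = ∏ i, (Polynomial.X - Polynomial.C (lam i)) ^ 2)
    (k : ℕ) : algebraMap F K (A ^ k).trace = 2 * ∑ i, lam i ^ k := by
  let L := AlgebraicClosure K
  apply (algebraMap K L).injective
  let ψ : F →+* L := (algebraMap K L).comp (algebraMap F K)
  have h1 : (A.map ψ).charpoly = ∏ i, (Polynomial.X - Polynomial.C (algebraMap K L (lam i))) ^ 2 := by
    rw [Matrix.charpoly_map, ← Polynomial.map_map, h]
    simp [Polynomial.map_prod]
  have h2 := Module.End.trace_pow_eq_sum_roots (A.map ψ).toLin' k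
  rw [← Matrix.toLin'_pow, Matrix.trace_toLin'_eq, Matrix.charpoly_toLin', h1,
    Polynomial.roots_prod _ _ (Finset.prod_ne_zero_iff.mpr fun i _ =>
      pow_ne_zero 2 (Polynomial.X_sub_C_ne_zero _))] at h2
  have h3 : algebraMap K L (algebraMap F K (A ^ k).trace) = ((A.map ψ) ^ k).trace := by
    have : (A.map ψ) ^ k = (A ^ k).map ψ := (map_pow ψ.mapMatrix A k).symm
    rw [this]
    simp [Matrix.trace, ψ]
  rw [h3, h2]
  simp only [Polynomial.roots_pow, Polynomial.roots_X_sub_C, Multiset.map_bind, Multiset.sum_bind,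
    Multiset.map_nsmul, Multiset.map_singleton, Multiset.sum_nsmul, Multiset.sum_singleton,
    map_mul, map_sum, map_pow, map_ofNat, Finset.mul_sum, nsmul_eq_mul, Nat.cast_ofNat]
  rfl

/-- A linearly independent family of linear forms admits dual vectors. -/
theorem LinearIndependent.exists_dual_vectors {K V ι : Type*} [Field K] [AddCommGroup V]
    [Module K V] [Module.Finite K V] [Finite ι] [DecidableEq ι] {l : ι → Module.Dual K V}
    (h : LinearIndependent K l) : ∃ v : ι → V, ∀ i j, l i (v j) = if i = j then 1 else 0 := by
  classical
  -- Extension of the family to a basis gives functionals on the dual space with prescribed values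
  -- on the `l i`; by reflexivity they are evaluations at vectors.
  obtain ⟨g, hg⟩ : ∃ g : (ι → K) → Module.Dual K (Module.Dual K V), ∀ c i, g c (l i) = c i := by
    refine ⟨fun c => (Module.Basis.extend h.linearIndepOn_id).constr K
      (fun x => if hx : ∃ i, l i = x then c hx.choose else 0), fun c i => ?_⟩
    have hmem : l i ∈ h.linearIndepOn_id.extend (Set.subset_univ _) :=
      h.linearIndepOn_id.subset_extend _ ⟨i, rfl⟩
    have e : l i = Module.Basis.extend h.linearIndepOn_id ⟨l i, hmem⟩ := by simp
    conv_lhs => rw [e]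
    rw [Module.Basis.constr_basis]
    have hx : ∃ i', l i' = l i := ⟨i, rfl⟩
    simp only [hx, dite_true]
    exact congrArg c (h.injective hx.choose_spec)
  refine ⟨fun j => (Module.evalEquiv K V).symm (g (Pi.single j 1)), fun i j => ?_⟩
  have := hg (Pi.single j 1) i
  rw [← Module.apply_evalEquiv_symm_apply] at this
  rw [this, Pi.single_apply]

/-- The determinant of the pairing with dual vectors is an alternating form with value `1` on an
independent family, so the wedge product cannot vanish. -/
theorem exteriorPower.ιMulti_ne_zero_iff {K V : Type*} [Field K] [AddCommGroup V] [Module K V]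
    [Module.Finite K V] {n : ℕ} (l : Fin n → Module.Dual K V) :
    exteriorPower.ιMulti K n l ≠ 0 ↔ LinearIndependent K l := by
  constructor
  · intro h
    by_contra h'
    exact h (AlternatingMap.map_linearDependent _ _ h')
  · intro h h0
    obtain ⟨v, hv⟩ := h.exists_dual_vectors
    let T : Module.Dual K V →ₗ[K] (Fin n → K) := LinearMap.pi fun j => Module.Dual.eval K V (v j)
    let D : (Module.Dual K V) [⋀^Fin n]→ₗ[K] K := Matrix.detRowAlternating.compLinearMap T
    have h1 : D l = 1 := by
      have : (fun i => T (l i)) = (1 : Matrix (Fin n) (Fin n) K) := by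
        ext i j
        simp [T, hv, Matrix.one_apply]
      change Matrix.det (fun i => T (l i)) = 1
      rw [this, Matrix.det_one]
    have h2 : exteriorPower.alternatingMapLinearEquiv D (exteriorPower.ιMulti K n l) = D l :=
      exteriorPower.alternatingMapLinearEquiv_apply_ιMulti _ _
    rw [h0, map_zero, h1] at h2
    exact zero_ne_one h2

/-- If linearly independent vectors are the power sums of vectors `w i` with coefficients `lam i`,
then the coefficients are distinct and the vectors `w i` are linearly independent. -/
theorem LinearIndependent.of_power_sums {K W : Type*} [Field K] [AddCommGroup W] [Module K W]
    {n : ℕ} {lam : Fin n → K} {w δ : Fin n → W} (hδ : LinearIndependent K δ)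
    (h : ∀ k : Fin n, δ k = ∑ i, lam i ^ (k : ℕ) • w i) :
    Function.Injective lam ∧ LinearIndependent K w := by
  constructor
  -- A kernel vector `c` of a singular Vandermonde matrix would be a linear relation among the `δ
  -- k`.
  · rw [← Matrix.det_vandermonde_ne_zero_iff]
    intro h0
    obtain ⟨c, hc, hc0⟩ := Matrix.exists_mulVec_eq_zero_iff.mpr h0
    refine hc (funext (Fintype.linearIndependent_iff.mp hδ c ?_))
    simp only [h, Finset.smul_sum, smul_smul]
    rw [Finset.sum_comm]
    refine Finset.sum_eq_zero fun i _ => ?_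
    rw [← Finset.sum_smul]
    have := congrFun hc0 i
    simp only [Matrix.mulVec, dotProduct, Matrix.vandermonde_apply, Pi.zero_apply] at this
    simp only [mul_comm (c _), this, zero_smul]
  -- The `n` independent vectors `δ k` lie in the span of the `n` vectors `w i`.
  · rw [linearIndependent_iff_card_le_finrank_span]
    have hsub : Submodule.span K (Set.range δ) ≤ Submodule.span K (Set.range w) := by
      rw [Submodule.span_le]
      rintro _ ⟨k, rfl⟩
      rw [h]
      exact Submodule.sum_mem _ fun i _ => Submodule.smul_mem _ _ (Submodule.subset_span ⟨i, rfl⟩)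
    have := linearIndependent_iff_card_le_finrank_span.mp hδ
    have hf : Module.Finite K (Submodule.span K (Set.range w)) :=
      Module.Finite.span_of_finite K (Set.finite_range w)
    exact this.trans (Submodule.finrank_mono hsub)

/-- An identity known for constants of the base field can thus be evaluated at eigenvalues in the
extension. -/
theorem Polynomial.eq_zero_of_eval_algebraMap {F K : Type*} [Field F] [Infinite F] [Field K]
    [Algebra F K] {p : Polynomial K} (s : Finset K)
    (h : ∀ c : F, algebraMap F K c ∉ s → p.eval (algebraMap F K c) = 0) : p = 0 := by
  refine Polynomial.eq_zero_of_infinite_isRoot p ?_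
  have h1 : (Set.range (algebraMap F K) \ (s : Set K)).Infinite :=
    (Set.infinite_range_of_injective (algebraMap F K).injective).sdiff s.finite_toSet
  refine h1.mono ?_
  rintro _ ⟨⟨c, rfl⟩, hc⟩
  exact h c hc

/-- Simple fractions with distinct poles are independent: with denominators cleared, the value of
the sum at `lam i` is `τ i` times a nonzero product. -/
theorem sum_mul_prod_erase_eq_zero {K : Type*} [Field K] [Infinite K] {n : ℕ} {lam τ : Fin n → K}
    (hlam : Function.Injective lam) 
    (h : ∀ c : K, (∀ i, lam i ≠ c) → ∑ i, (lam i - c)⁻¹ * τ i = 0) : τ = 0 := by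
  classical
  let p : Polynomial K := ∑ i, Polynomial.C (τ i) *
    ∏ j ∈ Finset.univ.erase i, (Polynomial.C (lam j) - Polynomial.X)
  have hp : p = 0 := by
    refine Polynomial.eq_zero_of_eval_algebraMap (F := K) (Finset.univ.image lam) fun c hc => ?_
    have hc' : ∀ i, lam i ≠ c := fun i hi => hc (by simp [← hi])
    have e : p.eval c = (∏ j, (lam j - c)) * ∑ i, (lam i - c)⁻¹ * τ i := by
      simp only [p, Polynomial.eval_finsetSum, Polynomial.eval_mul, Polynomial.eval_C,
        Polynomial.eval_prod, Polynomial.eval_sub, Polynomial.eval_X, Finset.mul_sum]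
      refine Finset.sum_congr rfl fun i _ => ?_
      rw [← Finset.mul_prod_erase _ _ (Finset.mem_univ i)]
      have := sub_ne_zero.mpr (hc' i)
      field_simp
    simpa [h c hc'] using e
  funext i
  have h1 : p.eval (lam i) = τ i * ∏ j ∈ Finset.univ.erase i, (lam j - lam i) := by
    simp only [p, Polynomial.eval_finsetSum, Polynomial.eval_mul, Polynomial.eval_C,
      Polynomial.eval_prod, Polynomial.eval_sub, Polynomial.eval_X]
    refine Finset.sum_eq_single i (fun k _ hk => ?_) (by simp)
    rw [Finset.prod_eq_zero (i := i) (by simp [hk.symm]) (by simp), mul_zero]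
  rw [hp, Polynomial.eval_zero] at h1
  refine (mul_eq_zero.mp h1.symm).resolve_right (Finset.prod_ne_zero_iff.mpr fun j hj => ?_)
  exact sub_ne_zero.mpr fun h => (Finset.mem_erase.mp hj).1 (hlam h)

/-! ### Calculus -/

/-! ### Differential of the determinant. -/

section Det
variable {𝕜 : Type*} [RCLike 𝕜] {E : Type*} [NormedAddCommGroup E] [NormedSpace 𝕜 E]

/-- Jacobi's formula. -/
theorem hasFDerivAt_det {d : ℕ} {a : Fin d → Fin d → E → 𝕜} {a' : Fin d → Fin d → E →L[𝕜] 𝕜}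
    {x : E} (ha : ∀ i j, HasFDerivAt (a i j) (a' i j) x) :
    HasFDerivAt (fun y => (Matrix.of fun i j => a i j y).det)
      (∑ i, ∑ j, (Matrix.of fun i j => a i j x).adjugate j i • a' i j) x := by
  let D : ContinuousMultilinearMap 𝕜 (fun _ : Fin d => Fin d → 𝕜) 𝕜 :=
    { (Matrix.detRowAlternating (R := 𝕜) (n := Fin d)).toMultilinearMap with
      cont := by
        change Continuous fun A : Matrix (Fin d) (Fin d) 𝕜 => A.det
        exact continuous_id.matrix_det }
  have h1 : HasFDerivAt (fun y => fun i j => a i j y)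
      (ContinuousLinearMap.pi fun i => ContinuousLinearMap.pi fun j => a' i j) x :=
    hasFDerivAt_pi.mpr fun i => hasFDerivAt_pi.mpr fun j => ha i j
  have h2 := (D.hasStrictFDerivAt (fun i j => a i j x)).hasFDerivAt.comp x h1
  refine h2.congr_fderiv ?_
  ext v
  simp only [ContinuousLinearMap.comp_apply, ContinuousMultilinearMap.linearDeriv_apply,
    sum_apply, smul_apply, ContinuousLinearMap.coe_pi',
    smul_eq_mul]
  refine Finset.sum_congr rfl fun i _ => ?_
  set A : Matrix (Fin d) (Fin d) 𝕜 := Matrix.of fun i j => a i j x with hA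
  -- Differentiation in row `i` replaces that row, and Cramer's rule expresses the new determinant
  -- by the adjugate.
  have h3 : D (Function.update (fun i j => a i j x) i (fun j => a' i j v))
      = (A.updateRow i (fun j => a' i j v)).det := rfl
  rw [h3, ← Matrix.cramer_transpose_apply, Matrix.cramer_eq_adjugate_mulVec,
    ← Matrix.adjugate_transpose]
  simp [Matrix.mulVec, dotProduct]

end Det

/-! ### Integrals depending on a parameter and the parametric Poincaré lemma. -/

section Integral
variable {𝕜 : Type*} [RCLike 𝕜] {E : Type*} [NormedAddCommGroup E] [NormedSpace 𝕜 E]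

/-- Compactness of `[0, 1]` gives a uniform bound on the derivative near `x₀`, which permits
differentiation under the integral sign. The variable `t` stays real for `𝕜 = ℂ`; only the parameter
`x` is complex. -/
theorem hasFDerivAt_integral_unitInterval {h : E × 𝕜 → 𝕜} {O : Set (E × 𝕜)} (hO : IsOpen O)
    (hh : ContDiffOn 𝕜 ∞ h O) {x₀ : E} (hx₀ : ∀ t ∈ Set.Icc (0 : ℝ) 1, (x₀, (t : 𝕜)) ∈ O) :
    HasFDerivAt (fun x => ∫ t in (0 : ℝ)..1, h (x, (t : 𝕜)))
      (∫ t in (0 : ℝ)..1, (fderiv 𝕜 h (x₀, (t : 𝕜))).comp (ContinuousLinearMap.inl 𝕜 E 𝕜)) x₀ := by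
  have hcast : Continuous fun t : ℝ => (t : 𝕜) := RCLike.continuous_ofReal
  have hfd : ContinuousOn (fderiv 𝕜 h) O := hh.continuousOn_fderiv_of_isOpen hO (by simp)
  have hcont : ∀ x, (∀ t ∈ Set.Icc (0 : ℝ) 1, (x, (t : 𝕜)) ∈ O) →
      ContinuousOn (fun t : ℝ => h (x, (t : 𝕜))) (Set.Icc 0 1) := fun x hx =>
    hh.continuousOn.comp (by fun_prop) hx
  have hcont' : ∀ x, (∀ t ∈ Set.Icc (0 : ℝ) 1, (x, (t : 𝕜)) ∈ O) →
      ContinuousOn (fun t : ℝ => (fderiv 𝕜 h (x, (t : 𝕜))).comp (ContinuousLinearMap.inl 𝕜 E 𝕜))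
        (Set.Icc 0 1) := fun x hx =>
    ContinuousOn.clm_comp (hfd.comp (by fun_prop) hx) continuousOn_const
  obtain ⟨C, hC⟩ := (isCompact_Icc (a := (0 : ℝ)) (b := 1)).bddAbove_image (hcont' x₀ hx₀).norm
  have hev : ∀ᶠ x in 𝓝 x₀, ∀ t ∈ Set.Icc (0 : ℝ) 1, (x, (t : 𝕜)) ∈ O ∧
      ‖(fderiv 𝕜 h (x, (t : 𝕜))).comp (ContinuousLinearMap.inl 𝕜 E 𝕜)‖ < C + 1 := by
    refine isCompact_Icc.eventually_forall_of_forall_eventually fun t ht => ?_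
    have hc : Filter.Tendsto (fun z : E × ℝ => (z.1, (z.2 : 𝕜))) (𝓝 (x₀, t)) (𝓝 (x₀, (t : 𝕜))) := by
      have : Continuous fun z : E × ℝ => (z.1, (z.2 : 𝕜)) := by fun_prop
      exact this.tendsto (x₀, t)
    have h1 := hc.eventually (hO.mem_nhds (hx₀ t ht))
    have h2 : ContinuousAt (fun z : E × 𝕜 =>
        ‖(fderiv 𝕜 h z).comp (ContinuousLinearMap.inl 𝕜 E 𝕜)‖) (x₀, (t : 𝕜)) :=
      ((hfd.continuousAt (hO.mem_nhds (hx₀ t ht))).clm_comp continuousAt_const).norm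
    have h3 : ‖(fderiv 𝕜 h (x₀, (t : 𝕜))).comp (ContinuousLinearMap.inl 𝕜 E 𝕜)‖ < C + 1 :=
      lt_of_le_of_lt (hC ⟨t, ht, rfl⟩) (lt_add_one C)
    exact h1.and (hc.eventually (h2.eventually (gt_mem_nhds h3)))
  have hIoc : Set.uIoc (0 : ℝ) 1 ⊆ Set.Icc 0 1 := by
    rw [Set.uIoc_of_le zero_le_one]; exact Set.Ioc_subset_Icc_self
  have hu : Set.uIcc (0 : ℝ) 1 = Set.Icc 0 1 := Set.uIcc_of_le zero_le_one
  refine intervalIntegral.hasFDerivAt_integral_of_dominated_of_fderiv_le (𝕜 := 𝕜)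
    (F' := fun x t => (fderiv 𝕜 h (x, (t : 𝕜))).comp (ContinuousLinearMap.inl 𝕜 E 𝕜))
    (bound := fun _ => C + 1) hev ?_ ?_ ?_ ?_ ?_ ?_
  · filter_upwards [hev] with x hx
    exact ((hcont x fun t ht => (hx t ht).1).mono hIoc).aestronglyMeasurable measurableSet_uIoc
  · exact (hu ▸ hcont x₀ hx₀).intervalIntegrable
  · exact ((hcont' x₀ hx₀).mono hIoc).aestronglyMeasurable measurableSet_uIoc
  · exact Filter.Eventually.of_forall fun t ht x hx => (hx t (hIoc ht)).2.le
  · exact intervalIntegrable_const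
  · refine Filter.Eventually.of_forall fun t ht x hx => ?_
    have h1 : HasFDerivAt h (fderiv 𝕜 h (x, (t : 𝕜))) (x, (t : 𝕜)) :=
      ((hh.contDiffAt (hO.mem_nhds (hx t (hIoc ht)).1)).differentiableAt (by simp)).hasFDerivAt
    exact h1.comp x (hasFDerivAt_prodMk_left x (t : 𝕜))

theorem fderiv_integral_unitInterval {h : E × 𝕜 → 𝕜} {O : Set (E × 𝕜)} (hO : IsOpen O)
    (hh : ContDiffOn 𝕜 ∞ h O) {x₀ : E} (hx₀ : ∀ t ∈ Set.Icc (0 : ℝ) 1, (x₀, (t : 𝕜)) ∈ O) (v : E) :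
    fderiv 𝕜 (fun x => ∫ t in (0 : ℝ)..1, h (x, (t : 𝕜))) x₀ v
      = ∫ t in (0 : ℝ)..1, fderiv 𝕜 h (x₀, (t : 𝕜)) (v, 0) := by
  rw [(hasFDerivAt_integral_unitInterval hO hh hx₀).fderiv, ContinuousLinearMap.intervalIntegral_apply]
  · simp
  · have hcast : Continuous fun t : ℝ => (t : 𝕜) := RCLike.continuous_ofReal
    have hfd : ContinuousOn (fderiv 𝕜 h) O := hh.continuousOn_fderiv_of_isOpen hO (by simp)
    apply ContinuousOn.intervalIntegrable
    rw [Set.uIcc_of_le zero_le_one]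
    exact ContinuousOn.clm_comp (hfd.comp (by fun_prop) hx₀) continuousOn_const

/-- A derivative in a fixed direction is again an integral of this kind, so the order of smoothness
rises by induction with the integrand left arbitrary. -/
theorem contDiffOn_integral_unitInterval [FiniteDimensional 𝕜 E] {U : Set E} (hU : IsOpen U)
    {O : Set (E × 𝕜)} (hO : IsOpen O)
    (hUO : ∀ x ∈ U, ∀ t ∈ Set.Icc (0 : ℝ) 1, (x, (t : 𝕜)) ∈ O) (n : ℕ) :
    ∀ h : E × 𝕜 → 𝕜, ContDiffOn 𝕜 ∞ h O →
      ContDiffOn 𝕜 n (fun x => ∫ t in (0 : ℝ)..1, h (x, (t : 𝕜))) U := by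
  induction n with
  | zero =>
    intro h hh
    simp only [Nat.cast_zero, contDiffOn_zero]
    exact fun x hx =>
      (hasFDerivAt_integral_unitInterval hO hh (hUO x hx)).continuousAt.continuousWithinAt
  | succ n ih =>
    intro h hh
    have e : ((n + 1 : ℕ) : WithTop ℕ∞) = (n : WithTop ℕ∞) + 1 := by push_cast; rfl
    rw [e, contDiffOn_succ_iff_fderiv_of_isOpen hU]
    refine ⟨fun x hx => (hasFDerivAt_integral_unitInterval hO hh
      (hUO x hx)).differentiableAt.differentiableWithinAt, by simp, ?_⟩
    rw [contDiffOn_clm_apply]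
    intro v
    have h1 : ContDiffOn 𝕜 ∞ (fun z => fderiv 𝕜 h z (v, 0)) O :=
      ((hh.fderiv_of_isOpen hO (m := ∞) (by simp)).clm_apply contDiffOn_const)
    exact (ih _ h1).congr fun x hx => fderiv_integral_unitInterval hO hh (hUO x hx) v

theorem fderiv_homotopy_integrand {η : E → E →L[𝕜] 𝕜} {η' : E →L[𝕜] E →L[𝕜] 𝕜} {p q : E → E}
    {p' q' : E →L[𝕜] E} {x : E} {t : 𝕜} (hη : HasFDerivAt η η' (p x + t • q x))
    (hp : HasFDerivAt p p' x) (hq : HasFDerivAt q q' x)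
    (hd : DifferentiableAt 𝕜 (fun w : E × 𝕜 => η (p w.1 + w.2 • q w.1) (q w.1)) (x, t)) (v : E) :
    fderiv 𝕜 (fun w : E × 𝕜 => η (p w.1 + w.2 • q w.1) (q w.1)) (x, t) (v, 0)
      = η' (p' v + t • q' v) (q x) + η (p x + t • q x) (q' v) := by
  have h1 := HasFDerivAt.comp (f := fun y : E => (y, t)) x hd.hasFDerivAt
    (hasFDerivAt_prodMk_left x t)
  have h2 := (hη.comp x (hp.add (hq.const_smul t))).clm_apply hq
  have h3 := congrArg (fun L : E →L[𝕜] 𝕜 => L v) (h1.unique h2)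
  simp only [ContinuousLinearMap.comp_apply, ContinuousLinearMap.inl_apply] at h3
  rw [h3]
  simp [add_comm]

/-- Parametric Poincaré lemma: a one-form which is closed along the hyperplanes `ξ = const` is
exact along these hyperplanes. -/
theorem exists_primitive_along_ker [FiniteDimensional 𝕜 E] {O : Set E} (hO : IsOpen O) {x₀ : E}
    (hx₀ : x₀ ∈ O) {η : E → E →L[𝕜] 𝕜} (hη : ContDiffOn 𝕜 ∞ η O) (ξ : E →L[𝕜] 𝕜) {e : E}
    (he : ξ e = 1)
    (hclosed : ∀ x ∈ O, ∀ u v, ξ u = 0 → ξ v = 0 → fderiv 𝕜 η x u v = fderiv 𝕜 η x v u) :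
    ∃ (U : Set E) (y : E → 𝕜), IsOpen U ∧ x₀ ∈ U ∧ U ⊆ O ∧ ContDiffOn 𝕜 ∞ y U ∧
      ∀ x ∈ U, ∀ v, ξ v = 0 → fderiv 𝕜 y x v = η x v := by
  obtain ⟨r, hr, hball⟩ := Metric.isOpen_iff.mp hO x₀ hx₀
  -- `p x` is the point of the line `x₀ + 𝕜 e` in the hyperplane `ξ = const` through `x`, and `q x =
  -- x - p x`. The primitive integrates `η` along the segment from `p x` to `x`, inside this
  -- hyperplane.
  let p : E → E := fun x => x₀ + ξ (x - x₀) • e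
  let q : E → E := fun x => x - x₀ - ξ (x - x₀) • e
  have hp : ContDiff 𝕜 ∞ p := by fun_prop
  have hq : ContDiff 𝕜 ∞ q := by fun_prop
  have hpq : ∀ x, p x + q x = x := fun x => by simp [p, q]
  have hξq : ∀ x, ξ (q x) = 0 := fun x => by simp [q, he]
  let z : E × 𝕜 → E := fun w => p w.1 + w.2 • q w.1
  have hz : ContDiff 𝕜 ∞ z := by fun_prop
  let h : E × 𝕜 → 𝕜 := fun w => η (z w) (q w.1)
  let O' : Set (E × 𝕜) := z ⁻¹' O
  have hO' : IsOpen O' := hO.preimage hz.continuous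
  have hh : ContDiffOn 𝕜 ∞ h O' :=
    (hη.comp hz.contDiffOn fun w hw => hw).clm_apply (hq.comp contDiff_fst).contDiffOn
  -- Both ends of the segment lie in the ball, so by convexity the whole segment does.
  let U : Set E := Metric.ball x₀ r ∩ p ⁻¹' Metric.ball x₀ r
  have hU : IsOpen U := Metric.isOpen_ball.inter (Metric.isOpen_ball.preimage hp.continuous)
  have hUO : ∀ x ∈ U, ∀ t ∈ Set.Icc (0 : ℝ) 1, (x, (t : 𝕜)) ∈ O' := by
    rintro x ⟨hx, hpx⟩ t ⟨ht0, ht1⟩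
    apply hball
    rw [Set.mem_preimage, mem_ball_iff_norm] at hpx
    rw [mem_ball_iff_norm] at hx ⊢
    have e1 : z (x, (t : 𝕜)) - x₀ = ((1 - t : ℝ) : 𝕜) • (p x - x₀) + (t : 𝕜) • (x - x₀) := by
      have : q x = x - p x := by rw [eq_sub_iff_add_eq, add_comm, hpq]
      simp only [z, this]
      push_cast
      module
    rw [e1]
    calc _ ≤ ‖((1 - t : ℝ) : 𝕜) • (p x - x₀)‖ + ‖(t : 𝕜) • (x - x₀)‖ := norm_add_le _ _
      _ = (1 - t) * ‖p x - x₀‖ + t * ‖x - x₀‖ := by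
        rw [norm_smul, norm_smul, RCLike.norm_ofReal, RCLike.norm_ofReal, abs_of_nonneg ht0,
          abs_of_nonneg (by linarith)]
      _ ≤ (1 - t) * max ‖p x - x₀‖ ‖x - x₀‖ + t * max ‖p x - x₀‖ ‖x - x₀‖ :=
        add_le_add (mul_le_mul_of_nonneg_left (le_max_left _ _) (by linarith))
          (mul_le_mul_of_nonneg_left (le_max_right _ _) ht0)
      _ = max ‖p x - x₀‖ ‖x - x₀‖ := by ring
      _ < r := max_lt hpx hx
  refine ⟨U, fun x => ∫ t in (0 : ℝ)..1, h (x, (t : 𝕜)), hU, ?_, fun x hx => hball hx.1, ?_, ?_⟩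
  · simp [U, p, hr]
  · rw [contDiffOn_infty]
    exact fun n => contDiffOn_integral_unitInterval hU hO' hUO n h hh
  · intro x hx v hv
    rw [fderiv_integral_unitInterval hO' hh (hUO x hx)]
    have hηd : ∀ t ∈ Set.Icc (0 : ℝ) 1,
        HasFDerivAt η (fderiv 𝕜 η (z (x, (t : 𝕜)))) (z (x, (t : 𝕜))) := fun t ht =>
      ((hη.contDiffAt (hO.mem_nhds (hUO x hx t ht))).differentiableAt (by simp)).hasFDerivAt
    -- For `v` in `ker ξ` closedness turns the differentiated integrand into the `t`-derivative of
    -- `t * η (p x + t • q x) v`, with boundary values `0` and `η x v`.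
    have hderiv : ∀ t ∈ Set.Icc (0 : ℝ) 1, HasDerivAt (fun s : ℝ => (s : 𝕜) * η (z (x, (s : 𝕜))) v)
        (fderiv 𝕜 h (x, (t : 𝕜)) (v, 0)) t := by
      intro t ht
      have hcast : HasDerivAt (fun s : ℝ => (s : 𝕜)) 1 t := by
        have := (RCLike.ofRealCLM (K := 𝕜)).hasDerivAt (x := t)
        simpa using this
      have hF : HasDerivAt (fun s : 𝕜 => s * η (z (x, s)) v)
          (1 * η (z (x, (t : 𝕜))) v + (t : 𝕜) * fderiv 𝕜 η (z (x, (t : 𝕜))) (q x) v) (t : 𝕜) := by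
        have h1 : HasDerivAt (fun s : 𝕜 => z (x, s)) (q x) (t : 𝕜) := by
          have := ((hasDerivAt_id (t : 𝕜)).smul_const (q x)).const_add (p x)
          simpa [z] using this
        have h2 := (hηd t ht).comp_hasDerivAt (t : 𝕜) h1
        have h3 := h2.clm_apply (hasDerivAt_const (t : 𝕜) v)
        have h4 := (hasDerivAt_id (t : 𝕜)).fun_mul h3
        simpa using h4
      have hfd : fderiv 𝕜 h (x, (t : 𝕜)) (v, 0)
          = fderiv 𝕜 η (z (x, (t : 𝕜))) ((t : 𝕜) • v) (q x) + η (z (x, (t : 𝕜))) v := by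
        have hp' : HasFDerivAt p (ξ.smulRight e) x :=
          (((ξ.hasFDerivAt.comp x ((hasFDerivAt_id x).sub_const x₀))).smul_const e).const_add x₀
        have hq' : HasFDerivAt q (ContinuousLinearMap.id 𝕜 E - ξ.smulRight e) x :=
          ((hasFDerivAt_id x).sub_const x₀).sub
            ((ξ.hasFDerivAt.comp x ((hasFDerivAt_id x).sub_const x₀)).smul_const e)
        rw [fderiv_homotopy_integrand (hηd t ht) hp' hq' ((hh.contDiffAt
            (hO'.mem_nhds (hUO x hx t ht))).differentiableAt (by simp))]
        simp [hv, z]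
      have hcl := hclosed _ (hUO x hx t ht) v (q x) hv (hξq x)
      have := HasDerivAt.scomp t hF hcast
      rw [hfd, map_smul, smul_apply, hcl, smul_eq_mul]
      exact this.congr_deriv (by rw [one_smul]; ring)
    have hint : IntervalIntegrable (fun t : ℝ => fderiv 𝕜 h (x, (t : 𝕜)) (v, 0))
        MeasureTheory.volume 0 1 := by
      have hcast : Continuous fun t : ℝ => (t : 𝕜) := RCLike.continuous_ofReal
      have hfd : ContinuousOn (fderiv 𝕜 h) O' := hh.continuousOn_fderiv_of_isOpen hO' (by simp)
      apply ContinuousOn.intervalIntegrable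
      rw [Set.uIcc_of_le zero_le_one]
      exact ContinuousOn.clm_apply (hfd.comp (by fun_prop) (hUO x hx)) continuousOn_const
    rw [intervalIntegral.integral_eq_sub_of_hasDerivAt (fun t ht => hderiv t
      (by rwa [Set.uIcc_of_le zero_le_one] at ht)) hint]
    simp [z, hpq]

end Integral

/-! ### Smooth dependence of roots on a polynomial. -/

section Roots
variable {𝕜 : Type*} [RCLike 𝕜] {E : Type*} [NormedAddCommGroup E] [NormedSpace 𝕜 E]

theorem ContDiffOn.mvPolynomial_aeval {σ : Type*} {s : Set E} {a : σ → E → 𝕜}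
    (ha : ∀ i, ContDiffOn 𝕜 ∞ (a i) s) (p : MvPolynomial σ 𝕜) :
    ContDiffOn 𝕜 ∞ (fun x => MvPolynomial.aeval (fun i => a i x) p) s := by
  induction p using MvPolynomial.induction_on with
  | C c => simpa using contDiffOn_const
  | add p q hp hq => simpa using hp.add hq
  | mul_X p i hp => simpa using hp.mul (ha i)

theorem ContDiffOn.charpoly_coeff {d : ℕ} {s : Set E} {a : Fin d → Fin d → E → 𝕜}
    (ha : ∀ i j, ContDiffOn 𝕜 ∞ (a i j) s) (k : ℕ) :
    ContDiffOn 𝕜 ∞ (fun x => (Matrix.of fun i j => a i j x).charpoly.coeff k) s := by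
  have h := ContDiffOn.mvPolynomial_aeval (σ := Fin d × Fin d) (a := fun ij => a ij.1 ij.2)
    (fun ij => ha ij.1 ij.2) ((Matrix.charpoly.univ 𝕜 (Fin d)).coeff k)
  refine h.congr fun x _ => ?_
  have := Matrix.charpoly.univ_coeff_eval₂Hom (Fin d) (RingHom.id 𝕜) (fun ij => a ij.1 ij.2 x) k
  exact this.symm

/-- The coefficients of a monic square root of a polynomial depend smoothly on the polynomial. -/
theorem ContDiffOn.coeff_of_coeff_sq {n : ℕ} {s : Set E} {q : E → Polynomial 𝕜}
    (hq : ∀ x ∈ s, (q x).Monic) (hdeg : ∀ x ∈ s, (q x).natDegree = n)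
    (h : ∀ k, ContDiffOn 𝕜 ∞ (fun x => (q x ^ 2).coeff k) s) (k : ℕ) :
    ContDiffOn 𝕜 ∞ (fun x => (q x).coeff k) s := by
  have hbig : ∀ k, n < k → ContDiffOn 𝕜 ∞ (fun x => (q x).coeff k) s := fun k hk =>
    (contDiffOn_const (c := (0 : 𝕜))).congr fun x hx =>
      Polynomial.coeff_eq_zero_of_natDegree_lt (by rw [hdeg x hx]; exact hk)
  have hsmall : ∀ j, j ≤ n → ContDiffOn 𝕜 ∞ (fun x => (q x).coeff (n - j)) s := by
    intro j
    induction j using Nat.strong_induction_on with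
    | _ j ih =>
    intro hj
    rcases Nat.eq_zero_or_pos j with rfl | hj0
    · refine (contDiffOn_const (c := (1 : 𝕜))).congr fun x hx => ?_
      rw [Nat.sub_zero, ← hdeg x hx]
      exact hq x hx
    -- As `j > 0`, the coefficient of `q ^ 2` in degree `n + (n - j)` contains `q_n q_{n-j} =
    -- q_{n-j}` exactly twice; the other nonzero products involve only coefficients of degree above
    -- `n - j`.
    have hmem1 : ((n, n - j) : ℕ × ℕ) ∈ Finset.HasAntidiagonal.antidiagonal (n + (n - j)) := by simp
    have hmem2 : ((n - j, n) : ℕ × ℕ) ∈ (Finset.HasAntidiagonal.antidiagonal (n + (n - j))).erase (n, n - j) := by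
      simp only [Finset.mem_erase, Finset.HasAntidiagonal.mem_antidiagonal, ne_eq, Prod.mk.injEq]
      omega
    have e : ∀ x ∈ s, (q x).coeff (n - j) = 2⁻¹ * ((q x ^ 2).coeff (n + (n - j)) -
        ∑ ab ∈ ((Finset.HasAntidiagonal.antidiagonal (n + (n - j))).erase (n, n - j)).erase (n - j, n),
          (q x).coeff ab.1 * (q x).coeff ab.2) := by
      intro x hx
      have hn : (q x).coeff n = 1 := by rw [← hdeg x hx]; exact hq x hx
      rw [sq, Polynomial.coeff_mul, ← Finset.add_sum_erase _ _ hmem1,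
        ← Finset.add_sum_erase _ _ hmem2]
      simp only [hn]
      ring
    refine ContDiffOn.congr ?_ e
    refine contDiffOn_const.mul ((h _).sub (ContDiffOn.sum fun ab hab => ?_))
    obtain ⟨a, b⟩ := ab
    simp only [Finset.mem_erase, Finset.HasAntidiagonal.mem_antidiagonal, ne_eq, Prod.mk.injEq] at hab
    have hs : ∀ a b, a + b = n + (n - j) → ¬(a = n - j ∧ b = n) → ¬ (a = n ∧ b = n - j) →
        ContDiffOn 𝕜 ∞ (fun x => (q x).coeff a * (q x).coeff b) s := by
      intro a b h1 h2 h3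
      rcases lt_or_ge n a with ha | ha
      · exact (contDiffOn_const (c := (0 : 𝕜))).congr fun x hx => by
          rw [Polynomial.coeff_eq_zero_of_natDegree_lt (by rw [hdeg x hx]; exact ha), zero_mul]
      rcases lt_or_ge n b with hb | hb
      · exact (contDiffOn_const (c := (0 : 𝕜))).congr fun x hx => by
          rw [Polynomial.coeff_eq_zero_of_natDegree_lt (p := q x) (n := b)
            (by rw [hdeg x hx]; exact hb), mul_zero]
      have ea : a = n - (n - a) := by omega
      have eb : b = n - (n - b) := by omega
      have h1 := ih (n - a) (by omega) (by omega)
      have h2 := ih (n - b) (by omega) (by omega)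
      rw [← ea] at h1
      rw [← eb] at h2
      exact h1.mul h2
    exact hs a b hab.2.2 hab.1 hab.2.1
  rcases lt_or_ge n k with hk | hk
  · exact hbig k hk
  · have := hsmall (n - k) (by omega)
    rwa [Nat.sub_sub_self hk] at this

variable {𝕂 : Type*} [RCLike 𝕂] [NormedAlgebra 𝕜 𝕂]

/-- Near a simple root of a member of a smooth family of polynomials there is a smooth family of
roots. -/
theorem exists_contDiffOn_root [CompleteSpace E] {n : ℕ} {O : Set E} (hO : IsOpen O)
    {q : E → Polynomial 𝕜} (hdeg : ∀ x ∈ O, (q x).natDegree = n)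
    (hq : ∀ k, ContDiffOn 𝕜 ∞ (fun x => (q x).coeff k) O) {x₀ : E} (hx₀ : x₀ ∈ O) {μ : 𝕂}
    (hμ : ((q x₀).map (algebraMap 𝕜 𝕂)).eval μ = 0)
    (hμ' : ((q x₀).map (algebraMap 𝕜 𝕂)).derivative.eval μ ≠ 0) :
    ∃ (U : Set E) (lam : E → 𝕂), IsOpen U ∧ x₀ ∈ U ∧ U ⊆ O ∧ ContDiffOn 𝕜 ∞ lam U ∧ lam x₀ = μ ∧
      ∀ x ∈ U, ((q x).map (algebraMap 𝕜 𝕂)).eval (lam x) = 0 := by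
  let h : E × 𝕂 → 𝕂 := fun w => ∑ k ∈ Finset.range (n + 1), (q w.1).coeff k • w.2 ^ k
  have heval : ∀ x ∈ O, ∀ t, h (x, t) = ((q x).map (algebraMap 𝕜 𝕂)).eval t := by
    intro x hx t
    rw [Polynomial.eval_map, Polynomial.eval₂_eq_sum_range' _ (n := n + 1) (by rw [hdeg x hx]; omega)]
    simp [h, Algebra.smul_def]
  let O' : Set (E × 𝕂) := Prod.fst ⁻¹' O
  have hO' : IsOpen O' := hO.preimage continuous_fst
  have hcoef : ∀ k, ContDiffOn 𝕜 ∞ (fun w : E × 𝕂 => (q w.1).coeff k) O' := fun k =>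
    (hq k).comp contDiff_fst.contDiffOn fun w hw => hw
  have hh : ContDiffOn 𝕜 ∞ h O' := ContDiffOn.sum fun k _ =>
    (hcoef k).smul (contDiff_snd.pow k).contDiffOn
  let h' : E × 𝕂 → 𝕂 := fun w => fderiv 𝕜 h w (0, 1)
  have hh' : ContinuousOn h' O' :=
    (hh.continuousOn_fderiv_of_isOpen hO' (by simp)).clm_apply continuousOn_const
  -- The partial derivative in the root variable is multiplication by a number of `𝕂`, so it is
  -- invertible as soon as it is nonzero.
  have hpart : ∀ w ∈ O', ∀ s, fderiv 𝕜 h w (0, s)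
      = ((q w.1).map (algebraMap 𝕜 𝕂)).derivative.eval w.2 * s := by
    rintro ⟨x, t⟩ hw s
    have h1 : HasFDerivAt h (fderiv 𝕜 h (x, t)) (x, t) :=
      ((hh.contDiffAt (hO'.mem_nhds hw)).differentiableAt (by simp)).hasFDerivAt
    have h3 := HasFDerivAt.comp (f := fun s : 𝕂 => (x, s)) t h1 (hasFDerivAt_prodMk_right x t)
    have h4 : HasDerivAt (fun s : 𝕂 => h (x, s))
        (((q x).map (algebraMap 𝕜 𝕂)).derivative.eval t) t := by
      simp only [heval x hw]
      exact Polynomial.hasDerivAt _ _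
    have h5 := h3.unique (h4.hasFDerivAt.restrictScalars 𝕜)
    have h6 := congrArg (fun L : 𝕂 →L[𝕜] 𝕂 => L s) h5
    simpa [mul_comm] using h6
  -- `(x, t) ↦ (x, q_x(t))` is locally invertible at a simple root, and the root function is the
  -- second component of the inverse at `(x, 0)`.
  let G : E × 𝕂 → E × 𝕂 := fun w => (w.1, h w)
  have hG : ContDiffOn 𝕜 ∞ G O' := contDiff_fst.contDiffOn.prodMk hh
  have hGd : ∀ w ∈ O', h' w ≠ 0 →
      ∃ L : (E × 𝕂) ≃L[𝕜] (E × 𝕂), HasFDerivAt G (L : (E × 𝕂) →L[𝕜] (E × 𝕂)) w := by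
    intro w hw hne
    have h1 : HasFDerivAt h (fderiv 𝕜 h w) w :=
      ((hh.contDiffAt (hO'.mem_nhds hw)).differentiableAt (by simp)).hasFDerivAt
    let l : E →L[𝕜] 𝕂 := (fderiv 𝕜 h w).comp (ContinuousLinearMap.inl 𝕜 E 𝕂)
    have h7 : ∀ v s, fderiv 𝕜 h w (v, s) = l v + h' w * s := by
      intro v s
      have e1 : ((v, s) : E × 𝕂) = (v, 0) + (0, s) := by simp
      rw [e1, map_add, hpart w hw]
      simp only [h', hpart w hw, mul_one]
      rfl
    refine ⟨ContinuousLinearEquiv.equivOfInverse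
      ((ContinuousLinearMap.fst 𝕜 E 𝕂).prod (fderiv 𝕜 h w))
      ((ContinuousLinearMap.fst 𝕜 E 𝕂).prod ((h' w)⁻¹ •
        (ContinuousLinearMap.snd 𝕜 E 𝕂 - l.comp (ContinuousLinearMap.fst 𝕜 E 𝕂)))) ?_ ?_, ?_⟩
    · rintro ⟨v, s⟩
      simp [h7, hne]
    · rintro ⟨v, s⟩
      simp [h7, hne]
    · exact hasFDerivAt_fst.prodMk h1
  have hw₀ : (x₀, μ) ∈ O' := hx₀
  have hne₀ : h' (x₀, μ) ≠ 0 := by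
    simp only [h', hpart _ hw₀, mul_one]; exact hμ'
  obtain ⟨L, hL⟩ := hGd _ hw₀ hne₀
  have hG₀ : ContDiffAt 𝕜 ∞ G (x₀, μ) := hG.contDiffAt (hO'.mem_nhds hw₀)
  let Φ := hG₀.toOpenPartialHomeomorph G hL (by simp)
  have hΦ : ∀ w, Φ w = G w := fun w => rfl
  have hGμ : G (x₀, μ) = (x₀, 0) := by
    simp only [G, heval x₀ hx₀, hμ]
  have hsrc : (x₀, μ) ∈ Φ.source := hG₀.mem_toOpenPartialHomeomorph_source hL (by simp)
  have htgt : (x₀, (0 : 𝕂)) ∈ Φ.target := by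
    rw [← hGμ, ← hΦ]; exact Φ.map_source hsrc
  have hsymm₀ : Φ.symm (x₀, 0) = (x₀, μ) := by
    rw [← hGμ, ← hΦ]; exact Φ.left_inv hsrc
  -- On `T` the derivative of `G` is invertible at every point, so the inverse is smooth on a whole
  -- neighbourhood and not only at the centre.
  obtain ⟨T, hT, hTO⟩ : ∃ T : Set (E × 𝕂), IsOpen T ∧ O' ∩ h' ⁻¹' {0}ᶜ = T :=
    ⟨_, hh'.isOpen_inter_preimage hO' isOpen_compl_singleton, rfl⟩
  have hT₀ : (x₀, μ) ∈ T := hTO ▸ ⟨hw₀, hne₀⟩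
  have hTT : ∀ w ∈ T, w ∈ O' ∧ h' w ≠ 0 := fun w hw => by
    rw [← hTO] at hw; exact hw
  let S : Set (E × 𝕂) := Φ.target ∩ Φ.symm ⁻¹' T
  have hS : IsOpen S := Φ.isOpen_inter_preimage_symm hT
  let ι : E → E × 𝕂 := fun x => (x, 0)
  have hι : ContDiff 𝕜 ∞ ι := contDiff_id.prodMk contDiff_const
  have hfst : ∀ x, ι x ∈ S → Φ.symm (ι x) = (x, (Φ.symm (ι x)).2) ∧
      h (Φ.symm (ι x)) = 0 := by
    intro x hx
    have h1 := Φ.right_inv hx.1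
    rw [hΦ] at h1
    have h2 : (Φ.symm (ι x)).1 = x := congrArg Prod.fst h1
    exact ⟨Prod.ext h2 rfl, congrArg Prod.snd h1⟩
  refine ⟨ι ⁻¹' S, fun x => (Φ.symm (ι x)).2, hS.preimage hι.continuous, ⟨htgt, ?_⟩, ?_, ?_, ?_, ?_⟩
  · rw [Set.mem_preimage, hsymm₀]; exact hT₀
  · intro x hx
    have h1 := (hTT _ hx.2).1
    rw [(hfst x hx).1] at h1
    exact h1
  · intro x hx
    obtain ⟨L', hL'⟩ := hGd _ (hTT _ hx.2).1 (hTT _ hx.2).2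
    have h1 : ContDiffAt 𝕜 ∞ Φ.symm (ι x) := Φ.contDiffAt_symm hx.1 hL'
      (hG.contDiffAt (hO'.mem_nhds (hTT _ hx.2).1))
    exact ((h1.comp x hι.contDiffAt).snd).contDiffWithinAt
  · change (Φ.symm (x₀, 0)).2 = μ
    rw [hsymm₀]
  · intro x hx
    obtain ⟨h1, h2⟩ := hfst x hx
    have h3 : x ∈ O := by
      have h1' := (hTT _ hx.2).1
      rw [h1] at h1'
      exact h1'
    rw [← heval x h3, ← h1, h2]

/-- If a member of a smooth family of monic polynomials of degree `n` has `n` different roots, then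
the members near it split, with roots depending smoothly on the polynomial. -/
theorem exists_contDiffOn_roots [CompleteSpace E] {n : ℕ} {O : Set E} (hO : IsOpen O)
    {q : E → Polynomial 𝕜} (hmon : ∀ x ∈ O, (q x).Monic) (hdeg : ∀ x ∈ O, (q x).natDegree = n)
    (hq : ∀ k, ContDiffOn 𝕜 ∞ (fun x => (q x).coeff k) O) {x₀ : E} (hx₀ : x₀ ∈ O) {μ : Fin n → 𝕂}
    (hinj : Function.Injective μ) (hμ : ∀ i, ((q x₀).map (algebraMap 𝕜 𝕂)).eval (μ i) = 0) :
    ∃ (U : Set E) (lam : Fin n → E → 𝕂), IsOpen U ∧ x₀ ∈ U ∧ U ⊆ O ∧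
      (∀ i, ContDiffOn 𝕜 ∞ (lam i) U) ∧
      ∀ x ∈ U, (q x).map (algebraMap 𝕜 𝕂) = ∏ i, (Polynomial.X - Polynomial.C (lam i x)) := by
  classical
  have hsplit : ∀ x ∈ O, ∀ ν : Fin n → 𝕂, Function.Injective ν →
      (∀ i, ((q x).map (algebraMap 𝕜 𝕂)).eval (ν i) = 0) →
      (q x).map (algebraMap 𝕜 𝕂) = ∏ i, (Polynomial.X - Polynomial.C (ν i)) := by
    intro x hx ν hν h0
    have hm : ((q x).map (algebraMap 𝕜 𝕂)).Monic := (hmon x hx).map _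
    refine Polynomial.eq_of_monic_of_dvd_of_natDegree_le
      (Polynomial.monic_prod_of_monic _ _ fun i _ => Polynomial.monic_X_sub_C _) hm ?_ ?_
    · refine Finset.prod_dvd_of_coprime ?_ fun i _ => Polynomial.dvd_iff_isRoot.mpr (h0 i)
      intro i _ j _ hij
      exact Polynomial.isCoprime_X_sub_C_of_isUnit_sub (sub_ne_zero.mpr (hν.ne hij)).isUnit
    · rw [Polynomial.natDegree_map, hdeg x hx, Polynomial.natDegree_prod_of_monic _ _
        fun i _ => Polynomial.monic_X_sub_C _]
      simp
  have hμ' : ∀ i, ((q x₀).map (algebraMap 𝕜 𝕂)).derivative.eval (μ i) ≠ 0 := by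
    intro i
    rw [hsplit x₀ hx₀ μ hinj hμ, ← Finset.mul_prod_erase _ _ (Finset.mem_univ i)]
    simp only [Polynomial.derivative_mul, Polynomial.derivative_sub, Polynomial.derivative_X,
      Polynomial.derivative_C, sub_zero, one_mul, Polynomial.eval_add, Polynomial.eval_mul,
      Polynomial.eval_sub, Polynomial.eval_X, Polynomial.eval_C, sub_self, zero_mul, add_zero,
      Polynomial.eval_prod]
    exact Finset.prod_ne_zero_iff.mpr fun j hj =>
      sub_ne_zero.mpr (hinj.ne (Finset.ne_of_mem_erase hj).symm)
  choose U lam hU hxU hUO hlam hlam₀ hroot using fun i =>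
    exists_contDiffOn_root hO hdeg hq hx₀ (hμ i) (hμ' i)
  let W : Set E := ⋂ i, U i
  have hW : IsOpen W := isOpen_iInter_of_finite hU
  have hev : ∀ᶠ x in 𝓝 x₀, ∀ i j, i ≠ j → lam i x ≠ lam j x := by
    rw [Filter.eventually_all]
    intro i
    rw [Filter.eventually_all]
    intro j
    by_cases hij : i = j
    · simp [hij]
    · have hc : ∀ i, ContinuousAt (lam i) x₀ := fun i =>
        (hlam i).continuousOn.continuousAt ((hU i).mem_nhds (hxU i))
      have hne : lam i x₀ - lam j x₀ ≠ 0 := by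
        rw [hlam₀, hlam₀]; exact sub_ne_zero.mpr (hinj.ne hij)
      filter_upwards [((hc i).sub (hc j)).eventually_ne hne] with x hx _ using sub_ne_zero.mp hx
  obtain ⟨T, hTsub, hT, hxT⟩ := eventually_nhds_iff.mp hev
  -- For `n = 0` the empty intersection of the `U i` is the whole space and need not lie in `O`.
  by_cases hn : Nonempty (Fin n)
  · obtain ⟨i₀⟩ := hn
    refine ⟨W ∩ T, lam, hW.inter hT, ⟨Set.mem_iInter.mpr hxU, hxT⟩,
      fun x hx => hUO i₀ (Set.mem_iInter.mp hx.1 i₀),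
      fun i => (hlam i).mono fun x hx => Set.mem_iInter.mp hx.1 i, fun x hx => ?_⟩
    refine hsplit x (hUO i₀ (Set.mem_iInter.mp hx.1 i₀)) _ (fun i j hij => ?_)
      fun i => hroot i x (Set.mem_iInter.mp hx.1 i)
    by_contra hne
    exact hTsub x hx.2 i j hne hij
  · have hemp : IsEmpty (Fin n) := not_nonempty_iff.mp hn
    exact ⟨O, fun _ _ => 0, hO, hx₀, subset_rfl, fun i => isEmptyElim i, fun x hx =>
      hsplit x hx _ (fun i => isEmptyElim i) fun i => isEmptyElim i⟩

end Roots

/-! ### Poisson tensors on a vector space -/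

section Local
set_option maxSynthPendingDepth 3
variable {𝕜 : Type*} [RCLike 𝕜] {E : Type*} [NormedAddCommGroup E] [NormedSpace 𝕜 E]

/-- A Poisson tensor on an open subset of a vector space. -/
structure IsLocalPoisson (Ω : Set E) (Q : E → (E →L[𝕜] 𝕜) →L[𝕜] E) : Prop where
  smooth : ContDiffOn 𝕜 ∞ Q Ω
  antisymm : ∀ x ∈ Ω, ∀ α β : E →L[𝕜] 𝕜, α (Q x β) = -β (Q x α)
  jacobi : ∀ x ∈ Ω, ∀ α β γ : E →L[𝕜] 𝕜, β (fderiv 𝕜 Q x (Q x α) γ)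
    + γ (fderiv 𝕜 Q x (Q x β) α) + α (fderiv 𝕜 Q x (Q x γ) β) = 0

theorem IsLocalPoisson.differentiableAt {Ω : Set E} {Q : E → (E →L[𝕜] 𝕜) →L[𝕜] E}
    (hQ : IsLocalPoisson Ω Q) (hΩ : IsOpen Ω) {x : E} (hx : x ∈ Ω) : DifferentiableAt 𝕜 Q x :=
  (hQ.smooth.contDiffAt (hΩ.mem_nhds hx)).differentiableAt (by simp)

/-- The inverse of a Poisson tensor is a closed two-form. -/
theorem IsLocalPoisson.closed_of_rightInverse {Ω : Set E} {Q : E → (E →L[𝕜] 𝕜) →L[𝕜] E}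
    (hQ : IsLocalPoisson Ω Q) (hΩ : IsOpen Ω) {x : E} (hx : x ∈ Ω) {W : E → E →L[𝕜] E →L[𝕜] 𝕜}
    (hW : DifferentiableAt 𝕜 W x) (hQW : ∀ᶠ y in 𝓝 x, ∀ v, Q y (W y v) = v) (u v w : E) :
    fderiv 𝕜 W x u v w + fderiv 𝕜 W x v w u + fderiv 𝕜 W x w u v = 0 := by
  -- Differentiation of `Q W = 1` expresses `dW` by `dQ`; the cyclic sum becomes the Jacobi identity
  -- for the covectors `W u`, `W w`, `W v`.
  have key : ∀ u v w, fderiv 𝕜 W x u v w = W x w (fderiv 𝕜 Q x u (W x v)) := by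
    intro u v w
    have h1 : HasFDerivAt (fun y => Q y (W y v)) (0 : E →L[𝕜] E) x := by
      refine (hasFDerivAt_const v x).congr_of_eventuallyEq ?_
      filter_upwards [hQW] with y hy using hy v
    have h2 := (hQ.differentiableAt hΩ hx).hasFDerivAt.clm_apply
      (hW.hasFDerivAt.clm_apply (hasFDerivAt_const v x))
    have h3 := congrArg (fun L : E →L[𝕜] E => L u) (h2.unique h1)
    simp only [add_apply, ContinuousLinearMap.comp_apply,
      ContinuousLinearMap.flip_apply, ContinuousLinearMap.comp_zero, zero_add,
      zero_apply] at h3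
    have h4 := congrArg (W x w) h3
    rw [map_add, map_zero, hQ.antisymm x hx, hQW.self_of_nhds w] at h4
    linear_combination -h4
  have hj := hQ.jacobi x hx (W x u) (W x w) (W x v)
  rw [hQW.self_of_nhds, hQW.self_of_nhds, hQW.self_of_nhds] at hj
  rw [key, key, key]
  linear_combination hj

variable [FiniteDimensional 𝕜 E]

/-- The coordinate functionals of a basis. -/
def covec {d : ℕ} (b : Module.Basis (Fin d) 𝕜 E) (i : Fin d) : E →L[𝕜] 𝕜 :=
  LinearMap.toContinuousLinearMap (b.coord i)

/-- The matrix of a bivector in a basis. -/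
def bivecMatrix {d : ℕ} (b : Module.Basis (Fin d) 𝕜 E) (Q : (E →L[𝕜] 𝕜) →L[𝕜] E) :
    Matrix (Fin d) (Fin d) 𝕜 :=
  Matrix.of fun i j => covec b i (Q (covec b j))

theorem sum_covec_smul {d : ℕ} (b : Module.Basis (Fin d) 𝕜 E) (v : E) :
    ∑ i, covec b i v • b i = v := b.sum_repr v

/-- The divergence of a field of bivectors with derivative `L`, paired with a covector. -/
def divergence {d : ℕ} (b : Module.Basis (Fin d) 𝕜 E) (L : E →L[𝕜] (E →L[𝕜] 𝕜) →L[𝕜] E)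
    (α : E →L[𝕜] 𝕜) : 𝕜 :=
  ∑ k, (covec b k (L (b k) α) - α (L (b k) (covec b k)))

theorem hasFDerivAt_det_bivecMatrix {d : ℕ} (b : Module.Basis (Fin d) 𝕜 E)
    {Q : E → (E →L[𝕜] 𝕜) →L[𝕜] E} {x : E} (hQ : DifferentiableAt 𝕜 Q x) :
    HasFDerivAt (fun y => (bivecMatrix b (Q y)).det) (∑ i, ∑ j, (bivecMatrix b (Q x)).adjugate j i •
      (covec b i).comp ((fderiv 𝕜 Q x).flip (covec b j))) x := by
  refine hasFDerivAt_det (a := fun i j y => covec b i (Q y (covec b j))) fun i j => ?_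
  refine (((covec b i).hasFDerivAt).comp x
    (hQ.hasFDerivAt.clm_apply (hasFDerivAt_const (covec b j) x))).congr_fderiv ?_
  ext v
  simp

/-- Jacobi's formula pairs the adjugate with the derivative of `Q` along `Q α`. The Jacobi identity
moves `Q` from `α` to the basis covectors, where it contracts with the adjugate to `det Q`.
Invertibility plays no role, so singular members of a pencil are covered. -/
theorem IsLocalPoisson.fderiv_det {d : ℕ} (b : Module.Basis (Fin d) 𝕜 E) {Ω : Set E}
    {Q : E → (E →L[𝕜] 𝕜) →L[𝕜] E} (hQ : IsLocalPoisson Ω Q) (hΩ : IsOpen Ω) {x : E} (hx : x ∈ Ω)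
    (α : E →L[𝕜] 𝕜) : fderiv 𝕜 (fun y => (bivecMatrix b (Q y)).det) x (Q x α)
      = (bivecMatrix b (Q x)).det * divergence b (fderiv 𝕜 Q x) α := by
  rw [(hasFDerivAt_det_bivecMatrix b (hQ.differentiableAt hΩ hx)).fderiv]
  set L := fderiv 𝕜 Q x with hL
  set A := bivecMatrix b (Q x) with hA
  have hQe : ∀ j, Q x (covec b j) = ∑ l, A l j • b l := fun j => (sum_covec_smul b _).symm
  have hskew : ∀ i j, A i j = - A j i := fun i j =>
    hQ.antisymm x hx (covec b i) (covec b j)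
  have hAB : ∀ l j, ∑ k, A l k * A.adjugate k j = if l = j then A.det else 0 := fun l j => by
    have := congrFun (congrFun A.mul_adjugate l) j
    simpa [Matrix.mul_apply, Matrix.one_apply] using this
  have hBA : ∀ k l, ∑ j, A.adjugate k j * A j l = if k = l then A.det else 0 := fun k l => by
    have := congrFun (congrFun A.adjugate_mul k) l
    simpa [Matrix.mul_apply, Matrix.one_apply] using this
  have hj : ∀ j k, covec b j (L (Q x α) (covec b k)) = - covec b k (L (Q x (covec b j)) α)
      - α (L (Q x (covec b k)) (covec b j)) := fun j k => by
    linear_combination hQ.jacobi x hx α (covec b j) (covec b k)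
  have h1 : ∑ j, ∑ k, A.adjugate k j * covec b k (L (Q x (covec b j)) α)
      = - (A.det * ∑ k, covec b k (L (b k) α)) := by
    simp only [hQe, map_sum, map_smul, sum_apply, smul_apply, smul_eq_mul, Finset.mul_sum]
    calc _ = ∑ k, ∑ l, (∑ j, A.adjugate k j * A l j) * covec b k (L (b l) α) := by
          rw [Finset.sum_comm]
          refine Finset.sum_congr rfl fun k _ => ?_
          rw [Finset.sum_comm]
          refine Finset.sum_congr rfl fun l _ => ?_
          rw [Finset.sum_mul]
          exact Finset.sum_congr rfl fun j _ => by ring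
      _ = ∑ k, ∑ l, - ((if k = l then A.det else 0) * covec b k (L (b l) α)) := by
          refine Finset.sum_congr rfl fun k _ => Finset.sum_congr rfl fun l _ => ?_
          rw [← hBA k l, ← neg_mul, ← Finset.sum_neg_distrib]
          congr 1
          exact Finset.sum_congr rfl fun j _ => by rw [hskew l j]; ring
      _ = _ := by simp
  have h2 : ∑ j, ∑ k, A.adjugate k j * α (L (Q x (covec b k)) (covec b j))
      = A.det * ∑ k, α (L (b k) (covec b k)) := by
    simp only [hQe, map_sum, map_smul, sum_apply, smul_apply, smul_eq_mul, Finset.mul_sum]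
    calc _ = ∑ j, ∑ l, (∑ k, A l k * A.adjugate k j) * α (L (b l) (covec b j)) := by
          refine Finset.sum_congr rfl fun j _ => ?_
          rw [Finset.sum_comm]
          refine Finset.sum_congr rfl fun l _ => ?_
          rw [Finset.sum_mul]
          exact Finset.sum_congr rfl fun k _ => by ring
      _ = _ := by simp [hAB]
  simp only [sum_apply, smul_apply, ContinuousLinearMap.comp_apply,
    ContinuousLinearMap.flip_apply, smul_eq_mul, hj, divergence, Finset.sum_sub_distrib, mul_sub,
    mul_neg, Finset.sum_neg_distrib, h1, h2]
  ring

variable {𝕂 : Type*} [RCLike 𝕂] [NormedAlgebra 𝕜 𝕂]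

/-- The differentials of the eigenvalues of the recursion tensor of a Poisson pencil are
eigencovectors at points at which the eigenvalues are distinct. -/
theorem fderiv_eigenvalue {d n : ℕ} (b : Module.Basis (Fin d) 𝕜 E) {Ω : Set E} (hΩ : IsOpen Ω)
    {Q Q' : E → (E →L[𝕜] 𝕜) →L[𝕜] E} (hQ : IsLocalPoisson Ω Q) (hQ' : IsLocalPoisson Ω Q')
    (hc : ∀ c : 𝕜, IsLocalPoisson Ω fun y => Q' y - c • Q y) {lam : Fin n → E → 𝕂} {x : E}
    (hx : x ∈ Ω) (hlam : ∀ i, DifferentiableAt 𝕜 (lam i) x)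
    (hinj : Function.Injective fun i => lam i x)
    (hdet : (bivecMatrix b (Q x)).det ≠ 0)
    (hchar : ∀ y ∈ Ω, ∀ c : 𝕜, algebraMap 𝕜 𝕂 (bivecMatrix b (Q' y - c • Q y)).det
      = algebraMap 𝕜 𝕂 (bivecMatrix b (Q y)).det * (∏ i, (algebraMap 𝕜 𝕂 c - lam i y)) ^ 2)
    (i : Fin n) (α : E →L[𝕜] 𝕜) :
    fderiv 𝕜 (lam i) x (Q' x α) = lam i x * fderiv 𝕜 (lam i) x (Q x α) := by
  classical
  let m := algebraMapCLM 𝕜 𝕂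
  let F : E → 𝕂 := fun y => m (bivecMatrix b (Q y)).det
  have hdQ := hasFDerivAt_det_bivecMatrix b (hQ.differentiableAt hΩ hx)
  have hF : HasFDerivAt F (fderiv 𝕜 F x) x :=
    (m.hasFDerivAt.comp x hdQ).differentiableAt.hasFDerivAt
  let q : 𝕂 → E → 𝕂 := fun c y => ∏ i, (c - lam i y)
  have hq : ∀ c, HasFDerivAt (q c)
      (∑ i, (∏ j ∈ Finset.univ.erase i, (c - lam j x)) • (-fderiv 𝕜 (lam i) x)) x := fun c => by
    exact HasFDerivAt.finsetProd fun i _ => (hlam i).hasFDerivAt.const_sub c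
  -- The relation `hchar` differentiated along `(Q' - c Q) α`, with the left side given by the
  -- divergence formula for the pencil.
  have hmain : ∀ c : 𝕜, fderiv 𝕜 F x (Q' x α - c • Q x α) * q (m c) x ^ 2
      + F x * (2 * q (m c) x * ∑ i, (∏ j ∈ Finset.univ.erase i, (m c - lam j x)) *
        (-fderiv 𝕜 (lam i) x (Q' x α - c • Q x α)))
      = F x * q (m c) x ^ 2 * (m (divergence b (fderiv 𝕜 Q' x) α)
        - m c * m (divergence b (fderiv 𝕜 Q x) α)) := by
    intro c
    have h1 := hasFDerivAt_det_bivecMatrix b ((hc c).differentiableAt hΩ hx)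
    have h2 := m.hasFDerivAt.comp x h1.differentiableAt.hasFDerivAt
    have h3 : HasFDerivAt (fun y => F y * q (m c) y ^ 2) _ x := hF.mul ((hq (m c)).pow 2)
    have h4 := h2.unique (h3.congr_of_eventuallyEq (by
      filter_upwards [hΩ.mem_nhds hx] with y hy using hchar y hy c))
    have h5 := congrArg (fun T : E →L[𝕜] 𝕂 => T (Q' x α - c • Q x α)) h4
    have h6 := (hc c).fderiv_det b hΩ hx α
    have h7 : divergence b (fderiv 𝕜 (fun y => Q' y - c • Q y) x) α
        = divergence b (fderiv 𝕜 Q' x) α - c * divergence b (fderiv 𝕜 Q x) α := by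
      have : fderiv 𝕜 (fun y => Q' y - c • Q y) x = fderiv 𝕜 Q' x - c • fderiv 𝕜 Q x :=
        ((hQ'.differentiableAt hΩ hx).hasFDerivAt.sub
          ((hQ.differentiableAt hΩ hx).hasFDerivAt.fun_const_smul c)).fderiv
      simp only [this, divergence, sub_apply, smul_apply, map_sub, map_smul, smul_eq_mul,
        Finset.mul_sum, ← Finset.sum_sub_distrib]
      exact Finset.sum_congr rfl fun k _ => by ring
    have h8 : m (bivecMatrix b (Q' x - c • Q x)).det = F x * q (m c) x ^ 2 := hchar x hx c
    simp only [sub_apply, smul_apply] at h6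
    simp only [ContinuousLinearMap.comp_apply, h6, h7] at h5
    have h9 : m ((bivecMatrix b (Q' x - c • Q x)).det * (divergence b (fderiv 𝕜 Q' x) α
        - c * divergence b (fderiv 𝕜 Q x) α)) = F x * q (m c) x ^ 2 *
        (m (divergence b (fderiv 𝕜 Q' x) α) - m c * m (divergence b (fderiv 𝕜 Q x) α)) := by
      rw [← h8]
      simp [m]
    rw [← h9, h5]
    simp only [add_apply, smul_apply, sum_apply, neg_apply, smul_eq_mul, nsmul_eq_mul]
    push_cast
    ring
  set v' := fderiv 𝕜 F x (Q' x α)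
  set v := fderiv 𝕜 F x (Q x α)
  let qX : Polynomial 𝕂 := ∏ i, (Polynomial.X - Polynomial.C (lam i x))
  let qi : Fin n → Polynomial 𝕂 := fun i =>
    ∏ j ∈ Finset.univ.erase i, (Polynomial.X - Polynomial.C (lam j x))
  -- This is `hmain` as a polynomial in `c` with one factor `q` cancelled; without the cancellation
  -- its value at an eigenvalue would be trivially zero.
  let G : Polynomial 𝕂 := (Polynomial.C v' - Polynomial.X * Polynomial.C v) * qX
    - 2 * Polynomial.C (F x) * (∑ r, qi r * (Polynomial.C (fderiv 𝕜 (lam r) x (Q' x α))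
      - Polynomial.X * Polynomial.C (fderiv 𝕜 (lam r) x (Q x α))))
    - Polynomial.C (F x) * qX * (Polynomial.C (m (divergence b (fderiv 𝕜 Q' x) α))
      - Polynomial.X * Polynomial.C (m (divergence b (fderiv 𝕜 Q x) α)))
  have hqX : ∀ t, qX.eval t = ∏ i, (t - lam i x) := fun t => by simp [qX, Polynomial.eval_prod]
  have hqi : ∀ i t, (qi i).eval t = ∏ j ∈ Finset.univ.erase i, (t - lam j x) := fun i t => by
    simp [qi, Polynomial.eval_prod]
  have hG : G = 0 := by
    refine Polynomial.eq_zero_of_eval_algebraMap (F := 𝕜) (Finset.univ.image fun i => lam i x)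
      fun c hcs => ?_
    have hq0 : q (m c) x ≠ 0 := Finset.prod_ne_zero_iff.mpr fun i _ =>
      sub_ne_zero.mpr fun h => hcs (Finset.mem_image.mpr ⟨i, Finset.mem_univ i, h.symm⟩)
    have hqm : q (m c) x = ∏ i, (algebraMap 𝕜 𝕂 c - lam i x) := rfl
    have hm := hmain c
    simp only [map_sub, map_smul, Algebra.smul_def] at hm
    apply mul_left_cancel₀ hq0
    simp only [G, Polynomial.eval_sub, Polynomial.eval_mul, Polynomial.eval_finsetSum, hqX, hqi,
      Polynomial.eval_C, Polynomial.eval_X, Polynomial.eval_ofNat, ← hqm]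
    simp only [neg_sub, mul_sub, Finset.sum_sub_distrib] at hm ⊢
    have hmc : m c = algebraMap 𝕜 𝕂 c := rfl
    rw [hmc] at hm ⊢
    linear_combination hm
  -- At `c = lam i x` only the summand with index `i` survives.
  have h1 := congrArg (Polynomial.eval (lam i x)) hG
  have h2 : ∏ j, (lam i x - lam j x) = 0 :=
    Finset.prod_eq_zero (Finset.mem_univ i) (sub_self _)
  have h3 : ∏ j ∈ Finset.univ.erase i, (lam i x - lam j x) ≠ 0 :=
    Finset.prod_ne_zero_iff.mpr fun j hj =>
      sub_ne_zero.mpr (hinj.ne (Finset.ne_of_mem_erase hj).symm)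
  have h4 : F x ≠ 0 := by
    simpa [F, m] using hdet
  simp only [G, Polynomial.eval_sub, Polynomial.eval_mul, Polynomial.eval_finsetSum, hqX, hqi,
    Polynomial.eval_C, Polynomial.eval_X, Polynomial.eval_ofNat, h2, mul_zero, zero_mul, sub_zero,
    zero_sub, Polynomial.eval_zero] at h1
  rw [Finset.sum_eq_single i (fun r _ hr => by
    rw [Finset.prod_eq_zero (i := i) (by simp [hr.symm]) (sub_self _), zero_mul]) (by simp)] at h1
  have h5 := (mul_eq_zero.mp (neg_eq_zero.mp h1)).resolve_left (mul_ne_zero two_ne_zero h4)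
  exact sub_eq_zero.mp ((mul_eq_zero.mp h5).resolve_left h3)

end Local

/-! ### Functions conjugate to the eigenvalues, on a vector space. -/

section Darboux
set_option maxSynthPendingDepth 3
variable {𝕜 : Type*} [RCLike 𝕜] {E : Type*} [NormedAddCommGroup E] [NormedSpace 𝕜 E]
  [FiniteDimensional 𝕜 E]

theorem LinearIndependent.exists_dual_vectors_clm {n : ℕ} {ξ : Fin n → E →L[𝕜] 𝕜}
    (h : LinearIndependent 𝕜 ξ) : ∃ v : Fin n → E, ∀ i j, ξ i (v j) = if i = j then 1 else 0 := by
  have h1 := h.map' (LinearMap.toContinuousLinearMap (E := E) (F' := 𝕜) (𝕜 := 𝕜)).symm.toLinearMap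
    (LinearEquiv.ker _)
  exact h1.exists_dual_vectors

omit [FiniteDimensional 𝕜 E] in
-- Antisymmetry of `Q'` and of `Q` lets either eigenvalue be taken out of the `Q'`-pairing, so `(a -
-- b) α (Q β) = 0`.
theorem eigencovector_orthogonal {Q Q' : (E →L[𝕜] 𝕜) →L[𝕜] E}
    (hQ : ∀ α β : E →L[𝕜] 𝕜, α (Q β) = -β (Q α)) (hQ' : ∀ α β : E →L[𝕜] 𝕜, α (Q' β) = -β (Q' α))
    {α β : E →L[𝕜] 𝕜} {a b : 𝕜} (hα : Q' α = a • Q α) (hβ : Q' β = b • Q β) (hab : a ≠ b) :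
    α (Q β) = 0 := by
  have h1 := hQ' α β
  rw [hα, hβ, map_smul, map_smul, hQ β α, smul_eq_mul, smul_eq_mul] at h1
  have h2 : (a - b) * α (Q β) = 0 := by linear_combination -h1
  exact (mul_eq_zero.mp h2).resolve_left (sub_ne_zero.mpr hab)

omit [FiniteDimensional 𝕜 E] in
theorem apply_self_eq_zero {Q : (E →L[𝕜] 𝕜) →L[𝕜] E}
    (hQ : ∀ α β : E →L[𝕜] 𝕜, α (Q β) = -β (Q α)) (α : E →L[𝕜] 𝕜) : α (Q α) = 0 :=
  self_eq_neg.mp (hQ α α)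

/-- Half of a canonical basis of eigencovectors can be completed to a canonical basis of
eigencovectors. -/
theorem exists_dual_eigencovectors {n : ℕ} (hdim : Module.finrank 𝕜 E = 2 * n)
    {Q Q' : (E →L[𝕜] 𝕜) →L[𝕜] E} (hb : Function.Bijective Q)
    (hQ : ∀ α β : E →L[𝕜] 𝕜, α (Q β) = -β (Q α)) (hQ' : ∀ α β : E →L[𝕜] 𝕜, α (Q' β) = -β (Q' α))
    {ξ : Fin n → E →L[𝕜] 𝕜} (hξ : LinearIndependent 𝕜 ξ) {lam : Fin n → 𝕜}
    (hlam : Function.Injective lam) (heig : ∀ i, Q' (ξ i) = lam i • Q (ξ i)) :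
    ∃ α : Fin n → E →L[𝕜] 𝕜, (∀ i j, ξ i (Q (α j)) = if i = j then 1 else 0) ∧
      (∀ i, Q' (α i) = lam i • Q (α i)) ∧ (∀ i j, α i (Q (α j)) = 0) ∧
      ∀ u, u = ∑ i, (ξ i u • Q (α i) - α i u • Q (ξ i)) := by
  classical
  have hξξ : ∀ i j, ξ i (Q (ξ j)) = 0 := fun i j => by
    by_cases hij : i = j
    · rw [hij]; exact apply_self_eq_zero hQ _
    · exact eigencovector_orthogonal hQ hQ' (heig i) (heig j) (hlam.ne hij)
  -- The vectors `Q (β i)` and `Q (ξ i)` are independent and `2 n` in number, hence a basis; the `ξ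
  -- j` read off the first half of the coordinates.
  have hspan : ∀ β : Fin n → E →L[𝕜] 𝕜, (∀ i j, ξ i (Q (β j)) = if i = j then 1 else 0) →
      ∀ u, ∃ a : Fin n → 𝕜, u = ∑ i, ξ i u • Q (β i) + ∑ i, a i • Q (ξ i) := by
    intro β hβ u
    let f : Fin n ⊕ Fin n → E := Sum.elim (fun i => Q (β i)) fun i => Q (ξ i)
    have hf : LinearIndependent 𝕜 f := by
      rw [Fintype.linearIndependent_iff]
      intro g hg
      rw [Fintype.sum_sum_type] at hg
      simp only [f, Sum.elim_inl, Sum.elim_inr] at hg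
      have hl : ∀ j, g (Sum.inl j) = 0 := fun j => by
        have := congrArg (ξ j) hg
        simpa [hβ, hξξ] using this
      have hr : ∑ i, g (Sum.inr i) • ξ i = 0 := by
        apply hb.1
        simpa [hl] using hg
      rintro (i | i)
      · exact hl i
      · exact Fintype.linearIndependent_iff.mp hξ _ hr i
    have htop := hf.span_eq_top_of_card_eq_finrank' (by simp [hdim, two_mul])
    have hu : u ∈ Submodule.span 𝕜 (Set.range f) := htop ▸ Submodule.mem_top
    obtain ⟨g, hg⟩ := (Submodule.mem_span_range_iff_exists_fun 𝕜).mp hu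
    rw [Fintype.sum_sum_type] at hg
    simp only [f, Sum.elim_inl, Sum.elim_inr] at hg
    have hl : ∀ j, g (Sum.inl j) = ξ j u := fun j => by
      have := congrArg (ξ j) hg
      simpa [hβ, hξξ] using this
    exact ⟨fun i => g (Sum.inr i), by simp only [hl] at hg; exact hg.symm⟩
  obtain ⟨v, hv⟩ := hξ.exists_dual_vectors_clm
  choose β hβv using fun i => hb.2 (v i)
  have hβ : ∀ i j, ξ i (Q (β j)) = if i = j then 1 else 0 := fun i j => by rw [hβv, hv]
  have hβ' : ∀ i j, β i (Q (ξ j)) = if i = j then -1 else 0 := fun i j => by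
    rw [hQ, hβ]; simp [eq_comm, apply_ite]
  -- The eigencovectors `ξ j` see in `Q' (β i)` only `lam i • Q (β i)`; what remains is a
  -- combination of the `Q (ξ k)`.
  have hexp : ∀ i, ∃ a : Fin n → 𝕜, Q' (β i) = lam i • Q (β i) + ∑ k, a k • Q (ξ k) := by
    intro i
    obtain ⟨a, ha⟩ := hspan β hβ (Q' (β i))
    refine ⟨a, ?_⟩
    rw [ha]
    congr 1
    rw [Finset.sum_eq_single i]
    · rw [hQ', heig, map_smul, hβ']; simp
    · intro j _ hj
      rw [hQ', heig, map_smul, hβ']; simp [hj.symm]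
    · simp
  choose a ha using hexp
  -- Antisymmetry excludes a Jordan block: pairing with `β i` isolates this coefficient.
  have haii : ∀ i, a i i = 0 := fun i => by
    have := congrArg (β i) (ha i)
    simpa [apply_self_eq_zero hQ, apply_self_eq_zero hQ', hβ'] using this
  -- The correction removes the components `a i k`. For `k = i` the quotient is `0 / 0 = 0`.
  let α : Fin n → E →L[𝕜] 𝕜 := fun i => β i + ∑ k, (a i k / (lam i - lam k)) • ξ k
  have hαξ : ∀ i j, ξ i (Q (α j)) = if i = j then 1 else 0 := fun i j => by
    simp [α, hβ, hξξ]
  have hα' : ∀ i, Q' (α i) = lam i • Q (α i) := fun i => by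
    simp only [α, map_add, map_sum, map_smul, ha, heig, smul_add, Finset.smul_sum, smul_smul,
      add_assoc, ← Finset.sum_add_distrib, ← add_smul]
    congr 1
    refine Finset.sum_congr rfl fun k _ => ?_
    congr 1
    by_cases hik : i = k
    · subst hik; simp [haii]
    · have := sub_ne_zero.mpr (hlam.ne hik)
      field_simp
      ring
  have hαα : ∀ i j, α i (Q (α j)) = 0 := fun i j => by
    by_cases hij : i = j
    · rw [hij]; exact apply_self_eq_zero hQ _
    · exact eigencovector_orthogonal hQ hQ' (hα' i) (hα' j) (hlam.ne hij)
  refine ⟨α, hαξ, hα', hαα, fun u => ?_⟩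
  obtain ⟨c, hc⟩ := hspan α hαξ u
  have hcα : ∀ j, α j u = -c j := fun j => by
    have h1 := congrArg (α j) hc
    simpa [hαα, hQ (α _) (ξ _), hαξ] using h1
  conv_lhs => rw [hc]
  simp [hcα, Finset.sum_add_distrib]

/-- The components of a symplectic form along the eigenspaces of a recursion tensor with
distinct eigenvalues are smooth. -/
theorem exists_eigencomponents {n : ℕ} {Ω : Set E} {Q Q' : E → (E →L[𝕜] 𝕜) →L[𝕜] E}
    (hΩ : IsOpen Ω) (hQ : ContDiffOn 𝕜 ∞ Q Ω) (hQ' : ContDiffOn 𝕜 ∞ Q' Ω)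
    (hb : ∀ x ∈ Ω, Function.Bijective (Q x)) {lam : Fin n → E → 𝕜}
    (hlam : ∀ i, ContDiffOn 𝕜 ∞ (lam i) Ω)
    (hinj : ∀ x ∈ Ω, Function.Injective fun i => lam i x) (i : Fin n) :
    ∃ Θ : E → E →L[𝕜] E →L[𝕜] 𝕜, ContDiffOn 𝕜 ∞ Θ Ω ∧ ∀ x ∈ Ω, ∀ (j : Fin n) (β : E →L[𝕜] 𝕜),
      Q' x β = lam j x • Q x β → Θ x (Q x β) = if j = i then β else 0 := by
  classical
  have hE : CompleteSpace E := FiniteDimensional.complete 𝕜 E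
  let W : E → E →L[𝕜] E →L[𝕜] 𝕜 := fun x => (Q x).inverse
  have hequiv : ∀ x ∈ Ω, ∃ e : (E →L[𝕜] 𝕜) ≃L[𝕜] E, (e : (E →L[𝕜] 𝕜) →L[𝕜] E) = Q x :=
    fun x hx => ⟨ContinuousLinearEquiv.ofBijective (Q x) (LinearMap.ker_eq_bot.mpr (hb x hx).1)
      (LinearMap.range_eq_top.mpr (hb x hx).2), by ext; rfl⟩
  have hWQ : ∀ x ∈ Ω, ∀ β, W x (Q x β) = β := fun x hx β => by
    obtain ⟨e, he⟩ := hequiv x hx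
    simp only [W]
    rw [← he, ContinuousLinearMap.inverse_equiv]
    exact e.symm_apply_apply β
  have hW : ContDiffOn 𝕜 ∞ W Ω := fun x hx => by
    obtain ⟨e, he⟩ := hequiv x hx
    have h1 : ContDiffAt 𝕜 ∞ ContinuousLinearMap.inverse (Q x) := he ▸ contDiffAt_map_inverse e
    exact (h1.comp x (hQ.contDiffAt (hΩ.mem_nhds hx))).contDiffWithinAt
  -- `R` is the product of the factors `N - lam k`, `k ∈ s`, with `N = Q' W`. For `s = univ.erase i`
  -- this is an unnormalized Lagrange projector, smooth without any choice of eigenvectors.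
  have hR : ∀ s : Finset (Fin n), ∃ R : E → E →L[𝕜] E, ContDiffOn 𝕜 ∞ R Ω ∧
      ∀ x ∈ Ω, ∀ (j : Fin n) (β : E →L[𝕜] 𝕜), Q' x β = lam j x • Q x β →
        R x (Q x β) = (∏ k ∈ s, (lam j x - lam k x)) • Q x β := by
    intro s
    induction s using Finset.induction_on with
    | empty => exact ⟨fun _ => ContinuousLinearMap.id 𝕜 E, contDiffOn_const, by simp⟩
    | insert k s hk ih =>
      obtain ⟨R, hR, hRe⟩ := ih
      refine ⟨fun x => (R x).comp ((Q' x).comp (W x) - lam k x • ContinuousLinearMap.id 𝕜 E),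
        hR.clm_comp ((hQ'.clm_comp hW).sub ((hlam k).smul contDiffOn_const)), ?_⟩
      intro x hx j β hβ
      simp only [ContinuousLinearMap.comp_apply, sub_apply, hWQ x hx, hβ, smul_apply,
        ContinuousLinearMap.id_apply, ← sub_smul, map_smul, hRe x hx j β hβ]
      rw [Finset.prod_insert hk, smul_smul]
  obtain ⟨R, hR, hRe⟩ := hR (Finset.univ.erase i)
  have hne : ∀ x ∈ Ω, ∏ k ∈ Finset.univ.erase i, (lam i x - lam k x) ≠ 0 := fun x hx =>
    Finset.prod_ne_zero_iff.mpr fun k hk =>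
      sub_ne_zero.mpr ((hinj x hx).ne (Finset.ne_of_mem_erase hk).symm)
  refine ⟨fun x => (∏ k ∈ Finset.univ.erase i, (lam i x - lam k x))⁻¹ • (W x).comp (R x), ?_, ?_⟩
  · refine ContDiffOn.smul (ContDiffOn.inv ?_ hne) (hW.clm_comp hR)
    exact contDiffOn_prod fun k _ => (hlam i).sub (hlam k)
  · intro x hx j β hβ
    simp only [smul_apply, ContinuousLinearMap.comp_apply, hRe x hx j β hβ, map_smul, hWQ x hx]
    by_cases hji : j = i
    · subst hji
      rw [if_pos rfl, smul_smul, inv_mul_cancel₀ (hne x hx), one_smul]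
    · have h0 : ∏ k ∈ Finset.univ.erase i, (lam j x - lam k x) = 0 :=
        Finset.prod_eq_zero (i := j) (by simp [hji]) (sub_self _)
      rw [if_neg hji, h0, zero_smul, smul_zero]

/-- Eigenvalues of the recursion tensor of a Poisson pencil which are independent linear functions
have conjugate functions whose differentials are eigencovectors. -/
theorem exists_conjugate_functions {n : ℕ} (hdim : Module.finrank 𝕜 E = 2 * n) {Ω : Set E}
    (hΩ : IsOpen Ω) {x₀ : E} (hx₀ : x₀ ∈ Ω) {Q Q' : E → (E →L[𝕜] 𝕜) →L[𝕜] E}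
    (hQ : IsLocalPoisson Ω Q) (hQ' : IsLocalPoisson Ω Q')
    (hc : ∀ c : 𝕜, IsLocalPoisson Ω fun y => Q' y - c • Q y)
    (hb : ∀ x ∈ Ω, Function.Bijective (Q x)) {ξ : Fin n → E →L[𝕜] 𝕜} (hξ : LinearIndependent 𝕜 ξ)
    (hinj : ∀ x ∈ Ω, Function.Injective fun i => ξ i x)
    (heig : ∀ x ∈ Ω, ∀ i, Q' x (ξ i) = ξ i x • Q x (ξ i)) :
    ∃ (U : Set E) (y : Fin n → E → 𝕜), IsOpen U ∧ x₀ ∈ U ∧ U ⊆ Ω ∧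
      (∀ i, ContDiffOn 𝕜 ∞ (y i) U) ∧ ∀ x ∈ U,
        (∀ i j, ξ i (Q x (fderiv 𝕜 (y j) x)) = if i = j then 1 else 0) ∧
        (∀ i j, ξ i (Q x (ξ j)) = 0) ∧
        (∀ i j, fderiv 𝕜 (y i) x (Q x (fderiv 𝕜 (y j) x)) = 0) ∧
        ∀ i, Q' x (fderiv 𝕜 (y i) x) = ξ i x • Q x (fderiv 𝕜 (y i) x) := by
  classical
  have hξd : ∀ i x, HasFDerivAt (fun x => ξ i x) (ξ i) x := fun i x => (ξ i).hasFDerivAt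
  have hpt : ∀ x ∈ Ω, ∃ α : Fin n → E →L[𝕜] 𝕜,
      (∀ i j, ξ i (Q x (α j)) = if i = j then 1 else 0) ∧
      (∀ i, Q' x (α i) = ξ i x • Q x (α i)) ∧ (∀ i j, α i (Q x (α j)) = 0) ∧
      ∀ u, u = ∑ i, (ξ i u • Q x (α i) - α i u • Q x (ξ i)) := fun x hx =>
    exists_dual_eigencovectors hdim (hb x hx) (hQ.antisymm x hx) (hQ'.antisymm x hx) hξ
      (hinj x hx) (heig x hx)
  choose! α hξα hα' hαα hdec using hpt
  choose Θ hΘ hΘe using exists_eigencomponents hΩ hQ.smooth hQ'.smooth hb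
    (lam := fun i x => ξ i x) (fun i => (ξ i).contDiff.contDiffOn) hinj
  have hΘd : ∀ i, ∀ x ∈ Ω, HasFDerivAt (Θ i) (fderiv 𝕜 (Θ i) x) x := fun i x hx =>
    (((hΘ i).contDiffAt (hΩ.mem_nhds hx)).differentiableAt (by simp)).hasFDerivAt
  -- Thus `Θ i = ξ i ∧ α i`; it is smooth, although `α` was chosen point by point.
  have hΘu : ∀ i, ∀ x ∈ Ω, ∀ u, Θ i x u = ξ i u • α x i - α x i u • ξ i := by
    intro i x hx u
    conv_lhs => rw [hdec x hx u]
    simp only [map_sum, map_sub, map_smul, hΘe i x hx _ _ (hα' x hx _),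
      hΘe i x hx _ _ (heig x hx _)]
    rw [Finset.sum_eq_single i (fun j _ hj => by simp [hj]) (by simp)]
    simp
  have hΘalt : ∀ i, ∀ x ∈ Ω, ∀ u v, Θ i x u v = -Θ i x v u := fun i x hx u v => by
    simp only [hΘu i x hx, sub_apply, smul_apply, smul_eq_mul]; ring
  have hD : ∀ i, ∀ x ∈ Ω, ∀ v w, HasFDerivAt (fun y => Θ i y v w)
      ((ContinuousLinearMap.apply 𝕜 𝕜 w).comp
        ((ContinuousLinearMap.apply 𝕜 (E →L[𝕜] 𝕜) v).comp (fderiv 𝕜 (Θ i) x))) x :=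
    fun i x hx v w => (ContinuousLinearMap.apply 𝕜 𝕜 w).hasFDerivAt.comp x
      ((ContinuousLinearMap.apply 𝕜 (E →L[𝕜] 𝕜) v).hasFDerivAt.comp x (hΘd i x hx))
  have hDalt : ∀ i, ∀ x ∈ Ω, ∀ u v w,
      fderiv 𝕜 (Θ i) x u v w = -fderiv 𝕜 (Θ i) x u w v := by
    intro i x hx u v w
    have h1 := (hD i x hx v w).unique (((hD i x hx w v).neg).congr_of_eventuallyEq (by
      filter_upwards [hΩ.mem_nhds hx] with y hy using hΘalt i y hy v w))
    exact congrArg (fun L : E →L[𝕜] 𝕜 => L u) h1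
  -- Here it matters that `ξ i` is a fixed linear form: its kernel does not vary with the point.
  have hDker : ∀ i, ∀ x ∈ Ω, ∀ u v w, ξ i v = 0 → ξ i w = 0 →
      fderiv 𝕜 (Θ i) x u v w = 0 := by
    intro i x hx u v w hv hw
    have h1 := (hD i x hx v w).unique ((hasFDerivAt_const (0 : 𝕜) x).congr_of_eventuallyEq (by
      filter_upwards [hΩ.mem_nhds hx] with y hy
      simp [hΘu i y hy, hv, hw]))
    exact congrArg (fun L : E →L[𝕜] 𝕜 => L u) h1
  have hclosed : ∀ x ∈ Ω, ∀ u v w, ∀ i, fderiv 𝕜 (Θ i) x u v w + fderiv 𝕜 (Θ i) x v w u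
      + fderiv 𝕜 (Θ i) x w u v = 0 := by
    intro x hx u v w
    refine fun i => congrFun (sum_mul_prod_erase_eq_zero (hinj x hx)
      (τ := fun i => fderiv 𝕜 (Θ i) x u v w + fderiv 𝕜 (Θ i) x v w u
        + fderiv 𝕜 (Θ i) x w u v) fun c hne => ?_) i
    -- `W` is the inverse of the pencil member `Q' - c Q` near `x`, hence a closed two-form.
    let W : E → E →L[𝕜] E →L[𝕜] 𝕜 := fun y => ∑ i, (ξ i y - c)⁻¹ • Θ i y
    have hWd : HasFDerivAt W (∑ i, ((ξ i x - c)⁻¹ • fderiv 𝕜 (Θ i) x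
        + (-((ξ i x - c) ^ 2)⁻¹ • ξ i).smulRight (Θ i x))) x := by
      refine HasFDerivAt.fun_sum fun i _ => ?_
      have h1 : HasFDerivAt (fun y => (ξ i y - c)⁻¹) (-((ξ i x - c) ^ 2)⁻¹ • ξ i) x := by
        have h2 := (hasDerivAt_inv (sub_ne_zero.mpr (hne i))).comp_hasFDerivAt x
          ((hξd i x).sub_const c)
        exact h2
      exact h1.smul (hΘd i x hx)
    have hev : ∀ᶠ y in 𝓝 x, ∀ v, (Q' y - c • Q y) (W y v) = v := by
      have h1 : ∀ᶠ y in 𝓝 x, ∀ i, ξ i y ≠ c := Filter.eventually_all.mpr fun i =>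
        (ξ i).continuous.continuousAt.eventually_ne (hne i)
      filter_upwards [hΩ.mem_nhds hx, h1] with y hy hyc v
      conv_rhs => rw [hdec y hy v]
      simp only [W, sum_apply, smul_apply, hΘu _ y hy, map_sum, map_smul, map_sub, sub_apply,
        hα' y hy, heig y hy, ← sub_smul]
      refine Finset.sum_congr rfl fun i _ => ?_
      have h2 := sub_ne_zero.mpr (hyc i)
      rw [smul_comm (ξ i v), smul_comm (α y i v), ← smul_sub, smul_smul, inv_mul_cancel₀ h2,
        one_smul]
    have hcl := (hc c).closed_of_rightInverse hΩ hx hWd.differentiableAt hev u v w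
    rw [hWd.fderiv] at hcl
    simp only [sum_apply, add_apply, smul_apply, ContinuousLinearMap.smulRight_apply,
      hΘu _ x hx, sub_apply, smul_eq_mul] at hcl
    rw [← Finset.sum_add_distrib, ← Finset.sum_add_distrib] at hcl
    -- The derivatives of the coefficients contribute multiples of `ξ i ∧ Θ i`, which vanishes
    -- because `Θ i = ξ i ∧ α i`.
    rw [← hcl]
    exact Finset.sum_congr rfl fun i _ => by ring
  obtain ⟨e, he⟩ := hξ.exists_dual_vectors_clm
  have hprim : ∀ i, ∃ (U : Set E) (y : E → 𝕜), IsOpen U ∧ x₀ ∈ U ∧ U ⊆ Ω ∧ ContDiffOn 𝕜 ∞ y U ∧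
      ∀ x ∈ U, ∀ v, ξ i v = 0 → fderiv 𝕜 y x v = Θ i x (e i) v := by
    intro i
    -- The one-form `Θ i (e i)` agrees with `α i` on `ker ξ i`, and it is closed there because `Θ i`
    -- is closed.
    refine exists_primitive_along_ker hΩ hx₀ ((hΘ i).clm_apply contDiffOn_const) (ξ i)
      (e := e i) (by simp [he]) fun x hx u v hu hv => ?_
    have h1 : fderiv 𝕜 (fun y => Θ i y (e i)) x = (fderiv 𝕜 (Θ i) x).flip (e i) := by
      rw [((hΘd i x hx).clm_apply (hasFDerivAt_const (e i) x)).fderiv]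
      simp
    rw [h1, ContinuousLinearMap.flip_apply, ContinuousLinearMap.flip_apply]
    have h2 := hclosed x hx u (e i) v i
    rw [hDker i x hx (e i) v u hv hu, hDalt i x hx v u (e i)] at h2
    linear_combination h2
  choose U y hU hxU hUΩ hy hdy using hprim
  refine ⟨Ω ∩ ⋂ i, U i, y, hΩ.inter (isOpen_iInter_of_finite hU), ⟨hx₀, Set.mem_iInter.mpr hxU⟩,
    Set.inter_subset_left, fun i => (hy i).mono fun x hx => Set.mem_iInter.mp hx.2 i, ?_⟩
  rintro x ⟨hx, hxU'⟩
  have hxU : ∀ i, x ∈ U i := Set.mem_iInter.mp hxU'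
  -- Covectors that agree on `ker ξ i` differ by a multiple of `ξ i`, which affects neither the
  -- eigenvalue nor the pairing with the `ξ j`.
  have hform : ∀ i, ∃ s : 𝕜, fderiv 𝕜 (y i) x = α x i + s • ξ i := by
    intro i
    refine ⟨fderiv 𝕜 (y i) x (e i) - α x i (e i), ?_⟩
    ext v
    have hv0 : ξ i (v - ξ i v • e i) = 0 := by simp [he]
    have h1 := hdy i x (hxU i) _ hv0
    rw [hΘu i x hx] at h1
    simp only [he, if_true, one_smul, sub_apply, smul_apply, map_sub,
      map_smul, smul_eq_mul] at h1
    simp only [add_apply, smul_apply, smul_eq_mul]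
    linear_combination h1
  choose s hs using hform
  have hξξ : ∀ i j, ξ i (Q x (ξ j)) = 0 := fun i j => by
    by_cases hij : i = j
    · rw [hij]; exact apply_self_eq_zero (hQ.antisymm x hx) _
    · exact eigencovector_orthogonal (hQ.antisymm x hx) (hQ'.antisymm x hx) (heig x hx i)
        (heig x hx j) ((hinj x hx).ne hij)
  have hy' : ∀ i, Q' x (fderiv 𝕜 (y i) x) = ξ i x • Q x (fderiv 𝕜 (y i) x) := fun i => by
    rw [hs, map_add, map_smul, map_add, map_smul, hα' x hx, heig x hx, smul_add, smul_comm]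
  refine ⟨fun i j => ?_, hξξ, fun i j => ?_, hy'⟩
  · rw [hs, map_add, map_smul, map_add, map_smul, hξξ, hξα x hx]; simp
  · by_cases hij : i = j
    · rw [hij]; exact apply_self_eq_zero (hQ.antisymm x hx) _
    · exact eigencovector_orthogonal (hQ.antisymm x hx) (hQ'.antisymm x hx) (hy' i) (hy' j)
        ((hinj x hx).ne hij)

end Darboux

/-! ### Transport of tensors to a chart -/

theorem OpenPartialHomeomorph.eventuallyEq_comp_symm_comp {X Y α : Type*} [TopologicalSpace X]
    [TopologicalSpace Y] (φ : OpenPartialHomeomorph X Y) {m : X} (hm : m ∈ φ.source) (f : X → α) :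
    f =ᶠ[𝓝 m] (f ∘ φ.symm) ∘ φ := by
  filter_upwards [φ.open_source.mem_nhds hm] with p hp
  simp [φ.left_inv hp]

section Chart
set_option maxSynthPendingDepth 3
variable {𝕜 : Type*} [RCLike 𝕜] {n : ℕ} {M : Type*} [TopologicalSpace M]
  [ChartedSpace (Model 𝕜 n) M] {φ : OpenPartialHomeomorph M (Model 𝕜 n)}

/-- The differential of a chart. -/
def chartDeriv (φ : OpenPartialHomeomorph M (Model 𝕜 n)) (m : M) : Tan 𝕜 n m →ₗ[𝕜] Model 𝕜 n :=
  (mfderiv (Mdl 𝕜 n) (Mdl 𝕜 n) φ m : Tan 𝕜 n m →L[𝕜] Model 𝕜 n).toLinearMap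

/-- The expression of a field of maps `T*M → TM` in a chart. -/
def pushTensor (P : CotangentToTangent 𝕜 n M) (φ : OpenPartialHomeomorph M (Model 𝕜 n))
    (x : Model 𝕜 n) : (Model 𝕜 n →L[𝕜] 𝕜) →L[𝕜] Model 𝕜 n :=
  LinearMap.toContinuousLinearMap
    { toFun := fun β => chartDeriv φ (φ.symm x)
        (P (φ.symm x) (β.toLinearMap ∘ₗ chartDeriv φ (φ.symm x)))
      map_add' := fun β γ => by
        rw [← map_add, ← map_add, ← LinearMap.add_comp]; rfl
      map_smul' := fun c β => by
        rw [← map_smul, ← map_smul, ← LinearMap.smul_comp]; rfl }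

theorem pushTensor_apply (P : CotangentToTangent 𝕜 n M) {m : M} (hm : m ∈ φ.source)
    (β : Model 𝕜 n →L[𝕜] 𝕜) :
    pushTensor P φ (φ m) β = chartDeriv φ m (P m (β.toLinearMap ∘ₗ chartDeriv φ m)) := by
  change chartDeriv φ (φ.symm (φ m)) (P (φ.symm (φ m))
    (β.toLinearMap ∘ₗ chartDeriv φ (φ.symm (φ m)))) = _
  rw [φ.left_inv hm]

theorem pushTensor_sub_smul (P P' : CotangentToTangent 𝕜 n M) (c : 𝕜) (x : Model 𝕜 n) :
    pushTensor (fun m => P' m - c • P m) φ x = pushTensor P' φ x - c • pushTensor P φ x := by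
  ext1 β
  change chartDeriv φ (φ.symm x) ((P' (φ.symm x) - c • P (φ.symm x)) _) = chartDeriv φ (φ.symm x) _
    - c • chartDeriv φ (φ.symm x) _
  rw [LinearMap.sub_apply, LinearMap.smul_apply, map_sub, map_smul]

theorem mdifferentiable_of_mem_maximalAtlas (hφ : φ ∈ IsManifold.maximalAtlas (Mdl 𝕜 n) ∞ M) :
    φ.MDifferentiable (Mdl 𝕜 n) (Mdl 𝕜 n) :=
  ⟨(contMDiffOn_of_mem_maximalAtlas hφ).mdifferentiableOn (by simp),
    (contMDiffOn_symm_of_mem_maximalAtlas hφ).mdifferentiableOn (by simp)⟩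

/-- The differential of a chart as a linear equivalence. -/
def chartEquiv (hφ : φ ∈ IsManifold.maximalAtlas (Mdl 𝕜 n) ∞ M) {m : M} (hm : m ∈ φ.source) :
    Tan 𝕜 n m ≃ₗ[𝕜] Model 𝕜 n :=
  LinearEquiv.ofBijective (chartDeriv φ m)
    ((mdifferentiable_of_mem_maximalAtlas hφ).mfderiv_bijective hm)

theorem chartEquiv_apply (hφ : φ ∈ IsManifold.maximalAtlas (Mdl 𝕜 n) ∞ M) {m : M}
    (hm : m ∈ φ.source) (v : Tan 𝕜 n m) : chartEquiv hφ hm v = chartDeriv φ m v := rfl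

section Functions
variable {𝕂 : Type*} [RCLike 𝕂] [NormedAlgebra 𝕜 𝕂]

theorem dAt_eq_of_eventuallyEq (hφ : φ ∈ IsManifold.maximalAtlas (Mdl 𝕜 n) ∞ M) {m : M}
    (hm : m ∈ φ.source) {f : M → 𝕂} {g : Model 𝕜 n → 𝕂} (hg : DifferentiableAt 𝕜 g (φ m))
    (hfg : f =ᶠ[𝓝 m] g ∘ φ) :
    dAt 𝕜 n f m = (fderiv 𝕜 g (φ m)).toLinearMap ∘ₗ chartDeriv φ m := by
  have h1 : mfderiv (Mdl 𝕜 n) 𝓘(𝕜, 𝕂) f m = mfderiv (Mdl 𝕜 n) 𝓘(𝕜, 𝕂) (g ∘ φ) m :=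
    hfg.mfderiv_eq
  have h2 : mfderiv (Mdl 𝕜 n) 𝓘(𝕜, 𝕂) (g ∘ φ) m = (mfderiv (Mdl 𝕜 n) 𝓘(𝕜, 𝕂) g (φ m)).comp
      (mfderiv (Mdl 𝕜 n) (Mdl 𝕜 n) φ m) :=
    mfderiv_comp m hg.mdifferentiableAt
      ((mdifferentiable_of_mem_maximalAtlas hφ).mdifferentiableAt hm)
  unfold dAt
  rw [h1, h2, mfderiv_eq_fderiv]
  rfl

theorem ContMDiffOn.contDiffOn_comp_chart_symm
    (hφ : φ ∈ IsManifold.maximalAtlas (Mdl 𝕜 n) ∞ M) {V : Set M} {f : M → 𝕂}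
    (hf : ContMDiffOn (Mdl 𝕜 n) 𝓘(𝕜, 𝕂) ∞ f V) :
    ContDiffOn 𝕜 ∞ (f ∘ φ.symm) (φ.target ∩ φ.symm ⁻¹' V) := by
  rw [← contMDiffOn_iff_contDiffOn]
  exact hf.comp ((contMDiffOn_symm_of_mem_maximalAtlas hφ).mono Set.inter_subset_left)
    Set.inter_subset_right

theorem ContDiffOn.contMDiffOn_comp_chart
    (hφ : φ ∈ IsManifold.maximalAtlas (Mdl 𝕜 n) ∞ M) {Ω : Set (Model 𝕜 n)} {g : Model 𝕜 n → 𝕂}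
    (hg : ContDiffOn 𝕜 ∞ g Ω) :
    ContMDiffOn (Mdl 𝕜 n) 𝓘(𝕜, 𝕂) ∞ (g ∘ φ) (φ.source ∩ φ ⁻¹' Ω) :=
  hg.contMDiffOn.comp ((contMDiffOn_of_mem_maximalAtlas hφ).mono Set.inter_subset_left)
    Set.inter_subset_right

theorem differentiableAt_comp_chart_symm (hφ : φ ∈ IsManifold.maximalAtlas (Mdl 𝕜 n) ∞ M)
    {V : Set M} (hV : IsOpen V) {f : M → 𝕂} (hf : ContMDiffOn (Mdl 𝕜 n) 𝓘(𝕜, 𝕂) ∞ f V) {m : M}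
    (hm : m ∈ φ.source) (hmV : m ∈ V) : DifferentiableAt 𝕜 (f ∘ φ.symm) (φ m) :=
  ((hf.contDiffOn_comp_chart_symm hφ).contDiffAt ((φ.isOpen_inter_preimage_symm hV).mem_nhds
    ⟨φ.map_source hm, by simpa [φ.left_inv hm] using hmV⟩)).differentiableAt (by simp)

theorem dAt_eq_of_contMDiffOn (hφ : φ ∈ IsManifold.maximalAtlas (Mdl 𝕜 n) ∞ M)
    {V : Set M} (hV : IsOpen V) {f : M → 𝕂} (hf : ContMDiffOn (Mdl 𝕜 n) 𝓘(𝕜, 𝕂) ∞ f V) {m : M}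
    (hm : m ∈ φ.source) (hmV : m ∈ V) :
    dAt 𝕜 n f m = (fderiv 𝕜 (f ∘ φ.symm) (φ m)).toLinearMap ∘ₗ chartDeriv φ m :=
  dAt_eq_of_eventuallyEq hφ hm (differentiableAt_comp_chart_symm hφ hV hf hm hmV)
    (φ.eventuallyEq_comp_symm_comp hm f)

end Functions

theorem bracket_eq_of_eventuallyEq (P : CotangentToTangent 𝕜 n M)
    (hφ : φ ∈ IsManifold.maximalAtlas (Mdl 𝕜 n) ∞ M) {m : M}
    (hm : m ∈ φ.source) {f f' : M → 𝕜} {g g' : Model 𝕜 n → 𝕜} (hg : DifferentiableAt 𝕜 g (φ m))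
    (hfg : f =ᶠ[𝓝 m] g ∘ φ) (hg' : DifferentiableAt 𝕜 g' (φ m)) (hfg' : f' =ᶠ[𝓝 m] g' ∘ φ) :
    bracket P f f' m = fderiv 𝕜 g (φ m) (pushTensor P φ (φ m) (fderiv 𝕜 g' (φ m))) := by
  rw [bracket, dAt_eq_of_eventuallyEq hφ hm hg hfg, dAt_eq_of_eventuallyEq hφ hm hg' hfg',
    pushTensor_apply P hm]
  rfl

theorem bracket_clm_comp_chart (P : CotangentToTangent 𝕜 n M)
    (hφ : φ ∈ IsManifold.maximalAtlas (Mdl 𝕜 n) ∞ M) {m : M} (hm : m ∈ φ.source)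
    (β γ : Model 𝕜 n →L[𝕜] 𝕜) :
    bracket P (β ∘ φ) (γ ∘ φ) m = β (pushTensor P φ (φ m) γ) := by
  rw [bracket_eq_of_eventuallyEq P hφ hm β.differentiableAt .rfl γ.differentiableAt .rfl,
    β.fderiv, γ.fderiv]

theorem contMDiffOn_clm_comp_chart (hφ : φ ∈ IsManifold.maximalAtlas (Mdl 𝕜 n) ∞ M)
    (β : Model 𝕜 n →L[𝕜] 𝕜) : ContMDiffOn (Mdl 𝕜 n) 𝓘(𝕜, 𝕜) ∞ (β ∘ φ) φ.source := by
  simpa using (β.contDiff.contDiffOn (s := Set.univ) (n := ∞)).contMDiffOn_comp_chart hφ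

/-- The expression of a Poisson tensor in a chart is a Poisson tensor. -/
theorem IsPoissonTensor.isLocalPoisson {P : CotangentToTangent 𝕜 n M} (hP : IsPoissonTensor P)
    (hφ : φ ∈ IsManifold.maximalAtlas (Mdl 𝕜 n) ∞ M) :
    IsLocalPoisson φ.target (pushTensor P φ) := by
  have hsmooth : ContDiffOn 𝕜 ∞ (pushTensor P φ) φ.target := by
    rw [contDiffOn_clm_apply]
    intro β
    rw [contDiffOn_euclidean]
    intro i
    have h := (hP.smooth φ.source φ.open_source _ _
      (contMDiffOn_clm_comp_chart hφ (EuclideanSpace.proj i))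
      (contMDiffOn_clm_comp_chart hφ β)).contDiffOn_comp_chart_symm hφ
    refine (h.mono fun x hx => ⟨hx, φ.map_target hx⟩).congr fun x hx => ?_
    rw [Function.comp_apply, bracket_clm_comp_chart P hφ (φ.map_target hx), φ.right_inv hx]
    rfl
  refine ⟨hsmooth, fun x hx α β => ?_, fun x hx α β γ => ?_⟩
  · obtain ⟨m, hm, rfl⟩ : ∃ m ∈ φ.source, φ m = x := ⟨φ.symm x, φ.map_target hx, φ.right_inv hx⟩
    rw [pushTensor_apply P hm, pushTensor_apply P hm]
    exact hP.antisymm m (α.toLinearMap ∘ₗ chartDeriv φ m) (β.toLinearMap ∘ₗ chartDeriv φ m)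
  · obtain ⟨m, hm, rfl⟩ : ∃ m ∈ φ.source, φ m = x := ⟨φ.symm x, φ.map_target hx, φ.right_inv hx⟩
    have hd : DifferentiableAt 𝕜 (pushTensor P φ) (φ m) :=
      (hsmooth.contDiffAt (φ.open_target.mem_nhds hx)).differentiableAt (by simp)
    have hanti : ∀ α β : Model 𝕜 n →L[𝕜] 𝕜,
        α (pushTensor P φ (φ m) β) = -β (pushTensor P φ (φ m) α) := by
      intro α β
      rw [pushTensor_apply P hm, pushTensor_apply P hm]
      exact hP.antisymm m (α.toLinearMap ∘ₗ chartDeriv φ m) (β.toLinearMap ∘ₗ chartDeriv φ m)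
    -- Functions linear in the chart have constant differentials, so their double bracket involves
    -- only the derivative of the tensor.
    have hb : ∀ α β γ : Model 𝕜 n →L[𝕜] 𝕜, bracket P (α ∘ φ) (bracket P (β ∘ φ) (γ ∘ φ)) m
        = -β (fderiv 𝕜 (pushTensor P φ) (φ m) (pushTensor P φ (φ m) α) γ) := by
      intro α β γ
      have h1 : HasFDerivAt (fun x => β (pushTensor P φ x γ))
          (β.comp ((fderiv 𝕜 (pushTensor P φ) (φ m)).flip γ)) (φ m) := by
        refine (β.hasFDerivAt.comp (φ m)
          (hd.hasFDerivAt.clm_apply (hasFDerivAt_const γ (φ m)))).congr_fderiv ?_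
        ext v
        simp
      rw [bracket_eq_of_eventuallyEq P hφ hm α.differentiableAt .rfl h1.differentiableAt
        (f' := bracket P (β ∘ φ) (γ ∘ φ)), h1.fderiv, α.fderiv, hanti]
      · rfl
      · filter_upwards [φ.open_source.mem_nhds hm] with p hp
        exact bracket_clm_comp_chart P hφ hp β γ
    have hj := hP.jacobi φ.source φ.open_source _ _ _ (contMDiffOn_clm_comp_chart hφ α)
      (contMDiffOn_clm_comp_chart hφ β) (contMDiffOn_clm_comp_chart hφ γ) m hm
    rw [hb, hb, hb] at hj
    linear_combination -hj

theorem isLocalPoisson_sub_smul {P P' : CotangentToTangent 𝕜 n M} (h : IsBihamiltonian P P')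
    (hφ : φ ∈ IsManifold.maximalAtlas (Mdl 𝕜 n) ∞ M) (c : 𝕜) :
    IsLocalPoisson φ.target fun x => pushTensor P' φ x - c • pushTensor P φ x := by
  have := (h.compatible c).isLocalPoisson hφ
  rwa [show pushTensor (fun m => P' m - c • P m) φ
    = fun x => pushTensor P' φ x - c • pushTensor P φ x from
    funext fun x => pushTensor_sub_smul P P' c x] at this

theorem pushTensor_bijective {P : CotangentToTangent 𝕜 n M} (hP : ∀ m, Function.Bijective (P m))
    (hφ : φ ∈ IsManifold.maximalAtlas (Mdl 𝕜 n) ∞ M) {x : Model 𝕜 n} (hx : x ∈ φ.target) :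
    Function.Bijective (pushTensor P φ x) := by
  obtain ⟨m, hm, rfl⟩ : ∃ m ∈ φ.source, φ m = x := ⟨φ.symm x, φ.map_target hx, φ.right_inv hx⟩
  constructor
  · rw [injective_iff_map_eq_zero]
    intro β hβ
    rw [pushTensor_apply P hm, ← chartEquiv_apply hφ hm, map_eq_zero_iff _ (chartEquiv hφ hm).injective,
      map_eq_zero_iff _ (hP m).1] at hβ
    ext v
    have := LinearMap.congr_fun hβ ((chartEquiv hφ hm).symm v)
    rw [LinearMap.comp_apply, ← chartEquiv_apply hφ hm, LinearEquiv.apply_symm_apply] at this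
    exact this
  · intro v
    obtain ⟨α, hα⟩ := (hP m).2 ((chartEquiv hφ hm).symm v)
    refine ⟨LinearMap.toContinuousLinearMap (α ∘ₗ (chartEquiv hφ hm).symm.toLinearMap), ?_⟩
    rw [pushTensor_apply P hm]
    have : (LinearMap.toContinuousLinearMap (α ∘ₗ (chartEquiv hφ hm).symm.toLinearMap)).toLinearMap
        ∘ₗ chartDeriv φ m = α := by
      ext v
      change α ((chartEquiv hφ hm).symm (chartEquiv hφ hm v)) = α v
      rw [LinearEquiv.symm_apply_apply]
    rw [this, hα, ← chartEquiv_apply hφ hm, LinearEquiv.apply_symm_apply]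

/-- The expression of the Nijenhuis tensor in a chart. -/
def localNijenhuis (P P' : CotangentToTangent 𝕜 n M) (φ : OpenPartialHomeomorph M (Model 𝕜 n))
    (x : Model 𝕜 n) : Model 𝕜 n →L[𝕜] Model 𝕜 n :=
  (pushTensor P' φ x).comp (pushTensor P φ x).inverse

theorem localNijenhuis_apply {P : CotangentToTangent 𝕜 n M} (P' : CotangentToTangent 𝕜 n M)
    (hP : ∀ m, Function.Bijective (P m)) (hφ : φ ∈ IsManifold.maximalAtlas (Mdl 𝕜 n) ∞ M)
    {x : Model 𝕜 n} (hx : x ∈ φ.target) (β : Model 𝕜 n →L[𝕜] 𝕜) :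
    localNijenhuis P P' φ x (pushTensor P φ x β) = pushTensor P' φ x β := by
  let e := (LinearEquiv.ofBijective (pushTensor P φ x).toLinearMap
    (pushTensor_bijective hP hφ hx)).toContinuousLinearEquiv
  have he : pushTensor P φ x = e := by ext; rfl
  rw [localNijenhuis, ContinuousLinearMap.comp_apply, he, ContinuousLinearMap.inverse_equiv]
  exact congrArg _ (e.symm_apply_apply β)

theorem contDiffOn_localNijenhuis {P P' : CotangentToTangent 𝕜 n M} (h : IsBihamiltonian P P')
    (hP : ∀ m, Function.Bijective (P m)) (hφ : φ ∈ IsManifold.maximalAtlas (Mdl 𝕜 n) ∞ M) :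
    ContDiffOn 𝕜 ∞ (localNijenhuis P P' φ) φ.target := by
  refine (h.right.isLocalPoisson hφ).smooth.clm_comp fun x hx => ?_
  let e := (LinearEquiv.ofBijective (pushTensor P φ x).toLinearMap
    (pushTensor_bijective hP hφ hx)).toContinuousLinearEquiv
  have he : pushTensor P φ x = e := by ext; rfl
  have h1 := (h.left.isLocalPoisson hφ).smooth x hx
  have h2 : ContDiffAt 𝕜 ∞ ContinuousLinearMap.inverse (pushTensor P φ x) := by
    rw [he]; exact contDiffAt_map_inverse e
  exact h2.comp_contDiffWithinAt x h1

theorem localNijenhuis_conj {P P' : CotangentToTangent 𝕜 n M}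
    (hP : ∀ m, Function.Bijective (P m)) (hφ : φ ∈ IsManifold.maximalAtlas (Mdl 𝕜 n) ∞ M)
    {m : M} (hm : m ∈ φ.source) :
    (chartEquiv hφ hm).conj (nijenhuis P P' hP m) = (localNijenhuis P P' φ (φ m)).toLinearMap := by
  ext1 v
  obtain ⟨β, rfl⟩ := (pushTensor_bijective hP hφ (φ.map_source hm)).2 v
  change _ = localNijenhuis P P' φ (φ m) (pushTensor P φ (φ m) β)
  rw [localNijenhuis_apply P' hP hφ (φ.map_source hm), LinearEquiv.conj_apply_apply,
    pushTensor_apply P hm, ← chartEquiv_apply hφ hm, LinearEquiv.symm_apply_apply,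
    pushTensor_apply P' hm, ← chartEquiv_apply hφ hm]
  congr 1
  exact congrArg (P' m) (LinearEquiv.symm_apply_apply (LinearEquiv.ofBijective (P m) (hP m)) _)

theorem chartDeriv_nijenhuis {P P' : CotangentToTangent 𝕜 n M}
    (hP : ∀ m, Function.Bijective (P m)) (hφ : φ ∈ IsManifold.maximalAtlas (Mdl 𝕜 n) ∞ M)
    {m : M} (hm : m ∈ φ.source) (v : Tan 𝕜 n m) :
    chartDeriv φ m (nijenhuis P P' hP m v)
      = localNijenhuis P P' φ (φ m) (chartDeriv φ m v) := by
  have := LinearMap.congr_fun (localNijenhuis_conj (P' := P') hP hφ hm) (chartEquiv hφ hm v)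
  rwa [LinearEquiv.conj_apply_apply, LinearEquiv.symm_apply_apply] at this

end Chart

/-! ### The invariants of the Nijenhuis tensor in a chart -/

theorem IsLocalPoisson.mono {𝕜 : Type*} [RCLike 𝕜] {E : Type*} [NormedAddCommGroup E]
    [NormedSpace 𝕜 E] {Ω Ω' : Set E} {Q : E → (E →L[𝕜] 𝕜) →L[𝕜] E} (h : IsLocalPoisson Ω Q)
    (hΩ : Ω' ⊆ Ω) : IsLocalPoisson Ω' Q :=
  ⟨h.smooth.mono hΩ, fun x hx => h.antisymm x (hΩ hx), fun x hx => h.jacobi x (hΩ hx)⟩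

section Invariants
set_option maxSynthPendingDepth 3
variable {𝕜 : Type*} [RCLike 𝕜] {n : ℕ} {M : Type*} [TopologicalSpace M]
  [ChartedSpace (Model 𝕜 n) M] {φ : OpenPartialHomeomorph M (Model 𝕜 n)}
  {P P' : CotangentToTangent 𝕜 n M}

/-- The standard basis of the model space. -/
def stdBasis (𝕜 : Type*) [RCLike 𝕜] (n : ℕ) : Module.Basis (Fin (2 * n)) 𝕜 (Model 𝕜 n) :=
  (EuclideanSpace.basisFun (Fin (2 * n)) 𝕜).toBasis

/-- The matrix of the Nijenhuis tensor in a chart. -/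
def nijMatrix (P P' : CotangentToTangent 𝕜 n M) (φ : OpenPartialHomeomorph M (Model 𝕜 n))
    (x : Model 𝕜 n) : Matrix (Fin (2 * n)) (Fin (2 * n)) 𝕜 :=
  Matrix.of fun i j => covec (stdBasis 𝕜 n) i (localNijenhuis P P' φ x (stdBasis 𝕜 n j))

theorem nijMatrix_eq (x : Model 𝕜 n) : nijMatrix P P' φ x
    = LinearMap.toMatrix (stdBasis 𝕜 n) (stdBasis 𝕜 n) (localNijenhuis P P' φ x).toLinearMap := by
  ext i j
  rw [LinearMap.toMatrix_apply]
  rfl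

theorem contDiffOn_nijMatrix (h : IsBihamiltonian P P') (hP : ∀ m, Function.Bijective (P m))
    (hφ : φ ∈ IsManifold.maximalAtlas (Mdl 𝕜 n) ∞ M) (i j : Fin (2 * n)) :
    ContDiffOn 𝕜 ∞ (fun x => nijMatrix P P' φ x i j) φ.target :=
  (covec (stdBasis 𝕜 n) i).contDiff.comp_contDiffOn
    ((contDiffOn_localNijenhuis h hP hφ).clm_apply contDiffOn_const)

theorem charpoly_nijenhuis (hP : ∀ m, Function.Bijective (P m))
    (hφ : φ ∈ IsManifold.maximalAtlas (Mdl 𝕜 n) ∞ M) {m : M} (hm : m ∈ φ.source) :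
    (nijenhuis P P' hP m).charpoly = (nijMatrix P P' φ (φ m)).charpoly := by
  rw [nijMatrix_eq, LinearMap.charpoly_toMatrix, ← localNijenhuis_conj hP hφ hm,
    LinearEquiv.charpoly_conj]

theorem trace_nijenhuis_pow (hP : ∀ m, Function.Bijective (P m))
    (hφ : φ ∈ IsManifold.maximalAtlas (Mdl 𝕜 n) ∞ M) {m : M} (hm : m ∈ φ.source) (k : ℕ) :
    LinearMap.trace 𝕜 _ (nijenhuis P P' hP m ^ k) = (nijMatrix P P' φ (φ m) ^ k).trace := by
  rw [nijMatrix_eq, LinearMap.toMatrix_pow, ← LinearMap.trace_eq_matrix_trace,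
    ← localNijenhuis_conj hP hφ hm]
  have : ∀ k, (chartEquiv hφ hm).conj (nijenhuis P P' hP m) ^ k
      = (chartEquiv hφ hm).conj (nijenhuis P P' hP m ^ k) := by
    intro k
    induction k with
    | zero => exact (LinearEquiv.conj_id _).symm
    | succ k ih =>
      rw [pow_succ, ih, pow_succ]
      exact (LinearEquiv.conj_comp _ _ _).symm
  rw [this, LinearMap.trace_conj']

theorem nijMatrix_mul_bivecMatrix (hP : ∀ m, Function.Bijective (P m))
    (hφ : φ ∈ IsManifold.maximalAtlas (Mdl 𝕜 n) ∞ M) {x : Model 𝕜 n} (hx : x ∈ φ.target) :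
    nijMatrix P P' φ x * bivecMatrix (stdBasis 𝕜 n) (pushTensor P φ x)
      = bivecMatrix (stdBasis 𝕜 n) (pushTensor P' φ x) := by
  ext i j
  rw [Matrix.mul_apply]
  change _ = covec (stdBasis 𝕜 n) i (pushTensor P' φ x (covec (stdBasis 𝕜 n) j))
  rw [← localNijenhuis_apply P' hP hφ hx,
    ← sum_covec_smul (stdBasis 𝕜 n) (pushTensor P φ x (covec (stdBasis 𝕜 n) j)), map_sum, map_sum]
  refine Finset.sum_congr rfl fun k _ => ?_
  rw [map_smul, map_smul, smul_eq_mul]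
  exact mul_comm _ _

theorem bivecMatrix_sub_smul {d : ℕ} {E : Type*} [NormedAddCommGroup E] [NormedSpace 𝕜 E]
    [FiniteDimensional 𝕜 E] (b : Module.Basis (Fin d) 𝕜 E) (Q Q' : (E →L[𝕜] 𝕜) →L[𝕜] E) (c : 𝕜) :
    bivecMatrix b (Q' - c • Q) = bivecMatrix b Q' - c • bivecMatrix b Q := by
  ext i j
  simp [bivecMatrix]

theorem transpose_bivecMatrix {Q : CotangentToTangent 𝕜 n M} (hQ : IsPoissonTensor Q)
    (hφ : φ ∈ IsManifold.maximalAtlas (Mdl 𝕜 n) ∞ M) {x : Model 𝕜 n} (hx : x ∈ φ.target) :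
    (bivecMatrix (stdBasis 𝕜 n) (pushTensor Q φ x)).transpose
      = -bivecMatrix (stdBasis 𝕜 n) (pushTensor Q φ x) := by
  ext i j
  exact (hQ.isLocalPoisson hφ).antisymm x hx (covec (stdBasis 𝕜 n) j) (covec (stdBasis 𝕜 n) i)

theorem det_bivecMatrix_ne_zero (hP : ∀ m, Function.Bijective (P m))
    (hφ : φ ∈ IsManifold.maximalAtlas (Mdl 𝕜 n) ∞ M) {x : Model 𝕜 n} (hx : x ∈ φ.target) :
    (bivecMatrix (stdBasis 𝕜 n) (pushTensor P φ x)).det ≠ 0 := by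
  intro h
  obtain ⟨v, hv, h0⟩ := Matrix.exists_mulVec_eq_zero_iff.2 h
  apply hv
  have h1 : pushTensor P φ x (∑ j, v j • covec (stdBasis 𝕜 n) j) = 0 := by
    apply (stdBasis 𝕜 n).ext_elem
    intro i
    have h2 := congrFun h0 i
    rw [map_zero]
    change covec (stdBasis 𝕜 n) i (pushTensor P φ x _) = 0
    rw [map_sum, map_sum]
    simp only [map_smul, smul_eq_mul]
    rw [← show _ = (0 : 𝕜) from h2]
    exact Finset.sum_congr rfl fun j _ => mul_comm _ _
  have h3 := (map_eq_zero_iff _ (pushTensor_bijective hP hφ hx).1).1 h1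
  ext i
  have h4 := congrArg (fun β : Model 𝕜 n →L[𝕜] 𝕜 => β (stdBasis 𝕜 n i)) h3
  simpa [sum_apply, covec, Finsupp.single_apply] using h4

theorem exists_charpoly_nijMatrix_eq_sq (h : IsBihamiltonian P P')
    (hP : ∀ m, Function.Bijective (P m))
    (hφ : φ ∈ IsManifold.maximalAtlas (Mdl 𝕜 n) ∞ M) {x : Model 𝕜 n} (hx : x ∈ φ.target) :
    ∃ q : Polynomial 𝕜, q.Monic ∧ (nijMatrix P P' φ x).charpoly = q ^ 2 :=
  Matrix.exists_charpoly_eq_sq (nijMatrix_mul_bivecMatrix hP hφ hx)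
    (transpose_bivecMatrix h.right hφ hx) (transpose_bivecMatrix h.left hφ hx)
    (det_bivecMatrix_ne_zero hP hφ hx)

/-- In matrices `P' - cP = -(c - N) P`, and the sign disappears because the dimension `2 n` is even.
-/
theorem det_bivecMatrix_sub_smul (hP : ∀ m, Function.Bijective (P m))
    (hφ : φ ∈ IsManifold.maximalAtlas (Mdl 𝕜 n) ∞ M) {x : Model 𝕜 n} (hx : x ∈ φ.target) (c : 𝕜) :
    (bivecMatrix (stdBasis 𝕜 n) (pushTensor P' φ x - c • pushTensor P φ x)).det
      = (bivecMatrix (stdBasis 𝕜 n) (pushTensor P φ x)).det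
        * (nijMatrix P P' φ x).charpoly.eval c := by
  rw [bivecMatrix_sub_smul, ← nijMatrix_mul_bivecMatrix hP hφ hx, Matrix.eval_charpoly,
    show nijMatrix P P' φ x * bivecMatrix (stdBasis 𝕜 n) (pushTensor P φ x)
      - c • bivecMatrix (stdBasis 𝕜 n) (pushTensor P φ x)
      = -(Matrix.scalar _ c - nijMatrix P P' φ x) * bivecMatrix (stdBasis 𝕜 n) (pushTensor P φ x) by
      rw [neg_sub, sub_mul, Matrix.scalar_apply, ← Matrix.smul_eq_diagonal_mul],
    Matrix.det_mul, Matrix.det_neg, Fintype.card_fin, (even_two_mul n).neg_one_pow, one_mul,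
    mul_comm]

/-- The normalized traces in a chart. -/
def localTrace (P P' : CotangentToTangent 𝕜 n M) (φ : OpenPartialHomeomorph M (Model 𝕜 n))
    (k : ℕ) (x : Model 𝕜 n) : 𝕜 :=
  1 / (2 * (k : 𝕜)) * (nijMatrix P P' φ x ^ k).trace

theorem contDiffOn_localTrace (h : IsBihamiltonian P P') (hP : ∀ m, Function.Bijective (P m))
    (hφ : φ ∈ IsManifold.maximalAtlas (Mdl 𝕜 n) ∞ M) (k : ℕ) :
    ContDiffOn 𝕜 ∞ (localTrace P P' φ k) φ.target := by
  have hpow : ∀ (k : ℕ) (i j : Fin (2 * n)),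
      ContDiffOn 𝕜 ∞ (fun x => (nijMatrix P P' φ x ^ k) i j) φ.target := by
    intro k
    induction k with
    | zero => intro i j; simp only [pow_zero]; exact contDiffOn_const
    | succ k ih =>
      intro i j
      simp only [pow_succ, Matrix.mul_apply]
      exact ContDiffOn.sum fun l _ => (ih i l).mul (contDiffOn_nijMatrix h hP hφ l j)
  exact contDiffOn_const.mul (ContDiffOn.sum fun i _ => hpow k i i)

theorem normTrace_eventuallyEq (hP : ∀ m, Function.Bijective (P m))
    (hφ : φ ∈ IsManifold.maximalAtlas (Mdl 𝕜 n) ∞ M) {m : M} (hm : m ∈ φ.source) (k : ℕ) :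
    normTrace (nijenhuis P P' hP) k =ᶠ[𝓝 m] localTrace P P' φ k ∘ φ := by
  filter_upwards [φ.open_source.mem_nhds hm] with p hp
  rw [normTrace, trace_nijenhuis_pow hP hφ hp]
  rfl

theorem dAt_normTrace (h : IsBihamiltonian P P') (hP : ∀ m, Function.Bijective (P m))
    (hφ : φ ∈ IsManifold.maximalAtlas (Mdl 𝕜 n) ∞ M) {m : M} (hm : m ∈ φ.source) (k : ℕ) :
    dAt 𝕜 n (normTrace (nijenhuis P P' hP) k) m
      = (fderiv 𝕜 (localTrace P P' φ k) (φ m)).toLinearMap ∘ₗ chartDeriv φ m :=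
  dAt_eq_of_eventuallyEq hφ hm (((contDiffOn_localTrace h hP hφ k).contDiffAt
    (φ.open_target.mem_nhds (φ.map_source hm))).differentiableAt (by simp))
    (normTrace_eventuallyEq hP hφ hm k)

theorem linearIndependent_comp_chartDeriv_iff (hφ : φ ∈ IsManifold.maximalAtlas (Mdl 𝕜 n) ∞ M)
    {m : M} (hm : m ∈ φ.source) {ι : Type*} (ξ : ι → Model 𝕜 n →L[𝕜] 𝕜) :
    (LinearIndependent 𝕜 fun i => ((ξ i).toLinearMap ∘ₗ chartDeriv φ m : Module.Dual 𝕜 (Tan 𝕜 n m)))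
      ↔ LinearIndependent 𝕜 ξ := by
  let f : (Model 𝕜 n →L[𝕜] 𝕜) →ₗ[𝕜] Module.Dual 𝕜 (Tan 𝕜 n m) :=
    (chartEquiv hφ hm).dualMap.toLinearMap ∘ₗ ContinuousLinearMap.coeLM 𝕜
  refine LinearMap.linearIndependent_iff f (LinearMap.ker_eq_bot.2 ?_)
  exact (chartEquiv hφ hm).dualMap.injective.comp ContinuousLinearMap.coe_injective

theorem mem_independenceLocus_iff (h : IsBihamiltonian P P') (hP : ∀ m, Function.Bijective (P m))
    (hφ : φ ∈ IsManifold.maximalAtlas (Mdl 𝕜 n) ∞ M) {m : M} (hm : m ∈ φ.source) :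
    m ∈ independenceLocus (nijenhuis P P' hP)
      ↔ LinearIndependent 𝕜 fun i : Fin n => fderiv 𝕜 (localTrace P P' φ (i + 1)) (φ m) := by
  change exteriorPower.ιMulti 𝕜 n _ ≠ 0 ↔ _
  rw [exteriorPower.ιMulti_ne_zero_iff, ← linearIndependent_comp_chartDeriv_iff hφ hm]
  simp only [dAt_normTrace h hP hφ hm]

/-- Linear independence of a finite family is an open condition, and the differentials of the traces
are continuous in a chart. -/
theorem isOpen_independenceLocus [IsManifold (Mdl 𝕜 n) ∞ M] (h : IsBihamiltonian P P')
    (hP : ∀ m, Function.Bijective (P m)) : IsOpen (independenceLocus (nijenhuis P P' hP)) := by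
  rw [isOpen_iff_mem_nhds]
  intro m hm
  have hφ := IsManifold.chart_mem_maximalAtlas (I := Mdl 𝕜 n) (n := ∞) m
  set φ := chartAt (Model 𝕜 n) m
  have hmφ : m ∈ φ.source := mem_chart_source _ m
  have hc : ContinuousOn (fun x => fun i : Fin n => fderiv 𝕜 (localTrace P P' φ (i + 1)) x)
      φ.target :=
    continuousOn_pi.2 fun i =>
      (contDiffOn_localTrace h hP hφ (i + 1)).continuousOn_fderiv_of_isOpen φ.open_target (by simp)
  have hG := hc.isOpen_inter_preimage φ.open_target
    (isOpen_setOfPred_linearIndependent (𝕜 := 𝕜) (E := Model 𝕜 n →L[𝕜] 𝕜) (ι := Fin n))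
  filter_upwards [(φ.isOpen_inter_preimage hG).mem_nhds ⟨hmφ, φ.map_source hmφ,
    (mem_independenceLocus_iff h hP hφ hmφ).1 hm⟩] with p hp
  exact (mem_independenceLocus_iff h hP hφ hp.1).2 hp.2.2

theorem exists_isEigenvalueSystem [IsManifold (Mdl 𝕜 n) ∞ M] (h : IsBihamiltonian P P')
    (hP : ∀ m, Function.Bijective (P m)) {𝕂 : Type*} [RCLike 𝕂] [NormedAlgebra 𝕜 𝕂] {m : M}
    (hm : IsRegularAt 𝕂 (nijenhuis P P' hP) m) :
    ∃ (V : Set M) (lam : Fin n → M → 𝕂), IsOpen V ∧ m ∈ V ∧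
        IsEigenvalueSystem (nijenhuis P P' hP) V lam := by
  have hφ := IsManifold.chart_mem_maximalAtlas (I := Mdl 𝕜 n) (n := ∞) m
  set φ := chartAt (Model 𝕜 n) m
  have hmφ : m ∈ φ.source := mem_chart_source _ m
  have hsq : ∀ x : Model 𝕜 n, ∃ q : Polynomial 𝕜, x ∈ φ.target → q.Monic ∧
      (nijMatrix P P' φ x).charpoly = q ^ 2 := by
    intro x
    by_cases hx : x ∈ φ.target
    · obtain ⟨q, hq⟩ := exists_charpoly_nijMatrix_eq_sq h hP hφ hx
      exact ⟨q, fun _ => hq⟩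
    · exact ⟨0, fun h => absurd h hx⟩
  choose q hq using hsq
  have hdeg : ∀ x ∈ φ.target, (q x).natDegree = n := by
    intro x hx
    have h1 := congrArg Polynomial.natDegree (hq x hx).2
    rw [Matrix.charpoly_natDegree_eq_dim, Fintype.card_fin, Polynomial.natDegree_pow] at h1
    omega
  have hcoeff : ∀ k, ContDiffOn 𝕜 ∞ (fun x => (q x).coeff k) φ.target := by
    refine fun k => ContDiffOn.coeff_of_coeff_sq (fun x hx => (hq x hx).1) hdeg (fun k => ?_) k
    refine (ContDiffOn.charpoly_coeff (contDiffOn_nijMatrix h hP hφ) k).congr fun x hx => ?_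
    rw [← (hq x hx).2]
    rfl
  have hcard : Nat.card ((nijenhuis P P' hP m).charpoly.rootSet 𝕂) = n := hm
  let μ : Fin n ≃ (nijenhuis P P' hP m).charpoly.rootSet 𝕂 := by
    exact (Finite.equivFinOfCardEq hcard).symm
  -- `q` and its square have the same roots, so the `n` different eigenvalues are `n` different
  -- roots of `q`, which has degree `n`.
  have hμ : ∀ i, ((q (φ m)).map (algebraMap 𝕜 𝕂)).eval (μ i : 𝕂) = 0 := by
    intro i
    rw [Polynomial.eval_map_algebraMap, ← pow_eq_zero_iff two_ne_zero, ← map_pow,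
      ← (hq _ (φ.map_source hmφ)).2, ← charpoly_nijenhuis hP hφ hmφ]
    exact (Polynomial.mem_rootSet.1 (μ i).2).2
  obtain ⟨U, lam, hU, hmU, hUt, hlam, hprod⟩ := exists_contDiffOn_roots φ.open_target
    (fun x hx => (hq x hx).1) hdeg hcoeff (φ.map_source hmφ)
    (μ := fun i => (μ i : 𝕂)) (Subtype.val_injective.comp μ.injective) hμ
  refine ⟨φ.source ∩ φ ⁻¹' U, fun i => lam i ∘ φ, φ.isOpen_inter_preimage hU, ⟨hmφ, hmU⟩,
    fun i => (hlam i).contMDiffOn_comp_chart hφ, fun p hp => ?_⟩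
  rw [charpoly_nijenhuis hP hφ hp.1, (hq _ (φ.map_source hp.1)).2, Polynomial.map_pow,
    hprod _ hp.2, Finset.prod_pow]
  rfl

/-! ### Differentials of the eigenvalue functions. -/

section Eigenvalues
variable {𝕂 : Type*} [RCLike 𝕂] [NormedAlgebra 𝕜 𝕂]

/-- The factor `k + 1` from differentiating the power sum cancels the one on the left; the
normalization of the traces serves this purpose. -/
theorem fderiv_eq_sum_pow_mul_fderiv {E : Type*} [NormedAddCommGroup E] [NormedSpace 𝕜 E] {ι : Type*}
    [Fintype ι] {J : E → 𝕜} {l : ι → E → 𝕂} {x : E} (hJ : DifferentiableAt 𝕜 J x)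
    (hl : ∀ i, DifferentiableAt 𝕜 (l i) x) (k : ℕ)
    (h : ∀ᶠ y in 𝓝 x, ((k : 𝕂) + 1) * algebraMap 𝕜 𝕂 (J y) = ∑ i, l i y ^ (k + 1)) (v : E) :
    algebraMap 𝕜 𝕂 (fderiv 𝕜 J x v) = ∑ i, l i x ^ k * fderiv 𝕜 (l i) x v := by
  have h1 : HasFDerivAt (fun y => ((k : 𝕂) + 1) * algebraMap 𝕜 𝕂 (J y))
      (((k : 𝕂) + 1) • (Algebra.linearMap 𝕜 𝕂).toContinuousLinearMap.comp (fderiv 𝕜 J x)) x :=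
    ((Algebra.linearMap 𝕜 𝕂).toContinuousLinearMap.hasFDerivAt.comp x
      hJ.hasFDerivAt).const_mul _
  have h2 : HasFDerivAt (fun y => ∑ i, l i y ^ (k + 1))
      (∑ i, ((k + 1) • l i x ^ k) • fderiv 𝕜 (l i) x) x :=
    HasFDerivAt.fun_sum fun i _ => (hl i).hasFDerivAt.pow (k + 1)
  have h3 := congrArg (fun L : E →L[𝕜] 𝕂 => L v) ((h1.congr_of_eventuallyEq
    (h.mono fun y hy => hy.symm)).unique h2)
  simp only [sum_apply, smul_apply, ContinuousLinearMap.comp_apply, smul_eq_mul,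
    nsmul_eq_mul, Nat.cast_add, Nat.cast_one, mul_assoc] at h3
  rw [← Finset.mul_sum] at h3
  exact mul_left_cancel₀ (Nat.cast_add_one_ne_zero k) h3

/-- Dual vectors over `𝕜` still isolate the coefficients of a relation over `𝕂`. -/
theorem LinearIndependent.algebraMap_comp {V : Type*} [AddCommGroup V] [Module 𝕜 V]
    [Module.Finite 𝕜 V] {ι : Type*}
    [Fintype ι] [DecidableEq ι] {l : ι → Module.Dual 𝕜 V} (hl : LinearIndependent 𝕜 l) :
    LinearIndependent 𝕂 fun i => Algebra.linearMap 𝕜 𝕂 ∘ₗ l i := by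
  obtain ⟨v, hv⟩ := hl.exists_dual_vectors
  rw [Fintype.linearIndependent_iff]
  intro c hc j
  have := LinearMap.congr_fun hc (v j)
  simpa [LinearMap.sum_apply, hv, apply_ite (algebraMap 𝕜 𝕂)] using this

theorem localTrace_eq_sum_pow (hP : ∀ m, Function.Bijective (P m))
    (hφ : φ ∈ IsManifold.maximalAtlas (Mdl 𝕜 n) ∞ M) {V : Set M} {lam : Fin n → M → 𝕂}
    (hlam : IsEigenvalueSystem (nijenhuis P P' hP) V lam) {x : Model 𝕜 n}
    (hx : x ∈ φ.target ∩ φ.symm ⁻¹' V) (k : ℕ) :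
    ((k : 𝕂) + 1) * algebraMap 𝕜 𝕂 (localTrace P P' φ (k + 1) x)
      = ∑ i, (lam i ∘ φ.symm) x ^ (k + 1) := by
  have h1 := hlam.charpoly _ hx.2
  rw [charpoly_nijenhuis hP hφ (φ.map_target hx.1), φ.right_inv hx.1] at h1
  have h2 := Matrix.algebraMap_trace_pow _ _ h1 (k + 1)
  have hk : (k : 𝕂) + 1 ≠ 0 := Nat.cast_add_one_ne_zero k
  rw [localTrace, map_mul, h2]
  push_cast
  simp only [map_ofNat, Function.comp_apply]
  field_simp

theorem algebraMap_charpoly_eval (hP : ∀ m, Function.Bijective (P m))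
    (hφ : φ ∈ IsManifold.maximalAtlas (Mdl 𝕜 n) ∞ M) {V : Set M} {lam : Fin n → M → 𝕂}
    (hlam : IsEigenvalueSystem (nijenhuis P P' hP) V lam) {x : Model 𝕜 n}
    (hx : x ∈ φ.target ∩ φ.symm ⁻¹' V) (c : 𝕜) :
    algebraMap 𝕜 𝕂 ((nijMatrix P P' φ x).charpoly.eval c)
      = (∏ i, (algebraMap 𝕜 𝕂 c - (lam i ∘ φ.symm) x)) ^ 2 := by
  have h1 := hlam.charpoly _ hx.2
  rw [charpoly_nijenhuis hP hφ (φ.map_target hx.1), φ.right_inv hx.1] at h1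
  rw [← Polynomial.eval_map_apply, h1, Polynomial.eval_prod, ← Finset.prod_pow]
  simp

/-- The independent covectors `dI_{k+1} = ∑ lam i ^ k dλ_i`, extended to `𝕂`, are in the situation
of `LinearIndependent.of_power_sums`. -/
theorem IsEigenvalueSystem.injective_and_linearIndependent [IsManifold (Mdl 𝕜 n) ∞ M]
    (h : IsBihamiltonian P P') (hP : ∀ m, Function.Bijective (P m)) {V : Set M} (hV : IsOpen V)
    {lam : Fin n → M → 𝕂} (hlam : IsEigenvalueSystem (nijenhuis P P' hP) V lam) {m : M}
    (hmV : m ∈ V) (hm : m ∈ independenceLocus (nijenhuis P P' hP)) :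
    (Function.Injective fun i => lam i m) ∧ LinearIndependent 𝕂 fun i => dAt 𝕜 n (lam i) m := by
  have hφ := IsManifold.chart_mem_maximalAtlas (I := Mdl 𝕜 n) (n := ∞) m
  set φ := chartAt (Model 𝕜 n) m
  have hmφ : m ∈ φ.source := mem_chart_source _ m
  have hl : ∀ i, DifferentiableAt 𝕜 (lam i ∘ φ.symm) (φ m) := fun i =>
    differentiableAt_comp_chart_symm hφ hV (hlam.smooth i) hmφ hmV
  have hLI : LinearIndependent 𝕜 fun i : Fin n => (dAt 𝕜 n
      (normTrace (nijenhuis P P' hP) (i + 1)) m : Module.Dual 𝕜 (Tan 𝕜 n m)) :=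
    (exteriorPower.ιMulti_ne_zero_iff _).1 hm
  refine (hLI.algebraMap_comp (𝕂 := 𝕂)).of_power_sums fun k => ?_
  ext v
  rw [LinearMap.comp_apply, dAt_normTrace h hP hφ hmφ, LinearMap.sum_apply]
  simp only [LinearMap.smul_apply, dAt_eq_of_contMDiffOn hφ hV (hlam.smooth _) hmφ hmV]
  refine (fderiv_eq_sum_pow_mul_fderiv (((contDiffOn_localTrace h hP hφ _).contDiffAt
    (φ.open_target.mem_nhds (φ.map_source hmφ))).differentiableAt (by simp)) hl k ?_ _).trans ?_
  · filter_upwards [(φ.isOpen_inter_preimage_symm hV).mem_nhds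
      ⟨φ.map_source hmφ, by simpa [φ.left_inv hmφ] using hmV⟩] with y hy
    exact localTrace_eq_sum_pow hP hφ hlam hy k
  · simp only [Function.comp_apply, φ.left_inv hmφ]
    rfl

theorem IsEigenvalueSystem.fderiv_apply (h : IsBihamiltonian P P')
    (hP : ∀ m, Function.Bijective (P m)) (hφ : φ ∈ IsManifold.maximalAtlas (Mdl 𝕜 n) ∞ M)
    {V : Set M} (hV : IsOpen V)
    {lam : Fin n → M → 𝕂} (hlam : IsEigenvalueSystem (nijenhuis P P' hP) V lam) {m : M}
    (hmφ : m ∈ φ.source) (hmV : m ∈ V) (hinj : Function.Injective fun i => lam i m) (i : Fin n)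
    (α : Model 𝕜 n →L[𝕜] 𝕜) :
    fderiv 𝕜 (lam i ∘ φ.symm) (φ m) (pushTensor P' φ (φ m) α)
      = lam i m * fderiv 𝕜 (lam i ∘ φ.symm) (φ m) (pushTensor P φ (φ m) α) := by
  have hΩ := φ.isOpen_inter_preimage_symm hV
  have := fderiv_eigenvalue (stdBasis 𝕜 n) hΩ
    ((h.left.isLocalPoisson hφ).mono Set.inter_subset_left)
    ((h.right.isLocalPoisson hφ).mono Set.inter_subset_left)
    (fun c => (isLocalPoisson_sub_smul h hφ c).mono Set.inter_subset_left)
    (lam := fun i => lam i ∘ φ.symm) (x := φ m)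
    ⟨φ.map_source hmφ, by simpa [φ.left_inv hmφ] using hmV⟩
    (fun i => differentiableAt_comp_chart_symm hφ hV (hlam.smooth i) hmφ hmV)
    (by simpa [φ.left_inv hmφ] using hinj)
    (det_bivecMatrix_ne_zero hP hφ (φ.map_source hmφ))
    (fun y hy c => by
      rw [det_bivecMatrix_sub_smul hP hφ hy.1, map_mul, algebraMap_charpoly_eval hP hφ hlam hy])
    i α
  simpa only [Function.comp_apply, φ.left_inv hmφ] using this

theorem IsEigenvalueSystem.dAt_comp_nijenhuis [IsManifold (Mdl 𝕜 n) ∞ M]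
    (h : IsBihamiltonian P P') (hP : ∀ m, Function.Bijective (P m)) {V : Set M} (hV : IsOpen V)
    {lam : Fin n → M → 𝕂} (hlam : IsEigenvalueSystem (nijenhuis P P' hP) V lam) {m : M}
    (hmV : m ∈ V) (hinj : Function.Injective fun i => lam i m) (i : Fin n) :
    dAt 𝕜 n (lam i) m ∘ₗ nijenhuis P P' hP m = lam i m • dAt 𝕜 n (lam i) m := by
  have hφ := IsManifold.chart_mem_maximalAtlas (I := Mdl 𝕜 n) (n := ∞) m
  set φ := chartAt (Model 𝕜 n) m
  have hmφ : m ∈ φ.source := mem_chart_source _ m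
  ext v
  obtain ⟨α, hα⟩ := (pushTensor_bijective hP hφ (φ.map_source hmφ)).2 (chartDeriv φ m v)
  rw [LinearMap.comp_apply, LinearMap.smul_apply,
    dAt_eq_of_contMDiffOn hφ hV (hlam.smooth i) hmφ hmV, LinearMap.comp_apply,
    chartDeriv_nijenhuis hP hφ hmφ,
    LinearMap.comp_apply, ← hα, localNijenhuis_apply P' hP hφ (φ.map_source hmφ)]
  exact hlam.fderiv_apply h hP hφ hV hmφ hmV hinj i α

end Eigenvalues
end Invariants

/-! ### Darboux-Nijenhuis charts -/

section DarbouxNijenhuis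
set_option maxSynthPendingDepth 3
variable {𝕜 : Type*} [RCLike 𝕜] {n : ℕ} {M : Type*} [TopologicalSpace M]
  [ChartedSpace (Model 𝕜 n) M]

/-- Restriction to `Ω`, where the derivative of `F` is invertible everywhere, makes the local
inverse smooth on its whole domain. -/
theorem exists_chart_comp [IsManifold (Mdl 𝕜 n) ∞ M] {φ : OpenPartialHomeomorph M (Model 𝕜 n)}
    (hφ : φ ∈ IsManifold.maximalAtlas (Mdl 𝕜 n) ∞ M) {Ω : Set (Model 𝕜 n)} (hΩ : IsOpen Ω)
    {F : Model 𝕜 n → Model 𝕜 n} (hF : ContDiffOn 𝕜 ∞ F Ω)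
    (hF' : ∀ x ∈ Ω, ∃ L : Model 𝕜 n ≃L[𝕜] Model 𝕜 n,
      HasFDerivAt F (L : Model 𝕜 n →L[𝕜] Model 𝕜 n) x)
    {m : M} (hm : m ∈ φ.source) (hmΩ : φ m ∈ Ω) :
    ∃ Φ ∈ IsManifold.maximalAtlas (Mdl 𝕜 n) ∞ M, m ∈ Φ.source ∧ Φ.source ⊆ φ.source ∩ φ ⁻¹' Ω ∧
      ∀ p, Φ p = F (φ p) := by
  have hFat : ∀ x ∈ Ω, ContDiffAt 𝕜 ∞ F x := fun x hx => hF.contDiffAt (hΩ.mem_nhds hx)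
  obtain ⟨L, hL⟩ := hF' _ hmΩ
  let R := ((hFat _ hmΩ).toOpenPartialHomeomorph F hL (by simp)).restr Ω
  have hRs : R.source ⊆ Ω := by
    rw [OpenPartialHomeomorph.restr_source' _ _ hΩ]; exact Set.inter_subset_right
  have hRF : ∀ x, R x = F x := fun x => rfl
  have hmR : φ m ∈ R.source := by
    rw [OpenPartialHomeomorph.restr_source' _ _ hΩ]
    exact ⟨(hFat _ hmΩ).mem_toOpenPartialHomeomorph_source hL (by simp), hmΩ⟩
  have hsource : (φ.trans R).source ⊆ φ.source ∩ φ ⁻¹' Ω := by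
    rw [OpenPartialHomeomorph.trans_source]
    exact Set.inter_subset_inter_right _ (Set.preimage_mono hRs)
  refine ⟨φ.trans R, ?_, ?_, hsource, fun p => rfl⟩
  · refine (φ.trans R).mem_maximalAtlas_of_contMDiffOn ?_ ?_
    · exact (contMDiffOn_iff_contDiffOn.2 hF).comp
        ((contMDiffOn_of_mem_maximalAtlas hφ).mono (hsource.trans Set.inter_subset_left))
        (hsource.trans Set.inter_subset_right)
    · have hsymm : ContDiffOn 𝕜 ∞ R.symm R.target := fun y hy => by
        have hy' := hRs (R.map_target hy)
        obtain ⟨L', hL'⟩ := hF' _ hy'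
        exact (R.contDiffAt_symm hy hL' (hFat _ hy')).contDiffWithinAt
      rw [OpenPartialHomeomorph.trans_target]
      exact (contMDiffOn_symm_of_mem_maximalAtlas hφ).comp
        ((contMDiffOn_iff_contDiffOn.2 hsymm).mono Set.inter_subset_left) Set.inter_subset_right
  · rw [OpenPartialHomeomorph.trans_source]
    exact ⟨hm, hmR⟩

/-- Functions with independent differentials at a point are linear in a suitable chart. -/
theorem exists_chart_eq_linear [IsManifold (Mdl 𝕜 n) ∞ M] {V : Set M} (hV : IsOpen V)
    {f : Fin n → M → 𝕜} (hf : ∀ i, ContMDiffOn (Mdl 𝕜 n) 𝓘(𝕜, 𝕜) ∞ (f i) V) {m : M} (hm : m ∈ V)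
    (hLI : LinearIndependent 𝕜 fun i => (dAt 𝕜 n (f i) m : Module.Dual 𝕜 (Tan 𝕜 n m))) :
    ∃ Φ ∈ IsManifold.maximalAtlas (Mdl 𝕜 n) ∞ M, ∃ ξ : Fin n → Model 𝕜 n →L[𝕜] 𝕜,
      m ∈ Φ.source ∧ Φ.source ⊆ V ∧ LinearIndependent 𝕜 ξ ∧
      ∀ p ∈ Φ.source, ∀ i, f i p = ξ i (Φ p) := by
  have hφ := IsManifold.chart_mem_maximalAtlas (I := Mdl 𝕜 n) (n := ∞) m
  set φ := chartAt (Model 𝕜 n) m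
  have hmφ : m ∈ φ.source := mem_chart_source _ m
  let l : Fin n → Model 𝕜 n → 𝕜 := fun i => f i ∘ φ.symm
  let Ω := φ.target ∩ φ.symm ⁻¹' V
  have hΩ : IsOpen Ω := φ.isOpen_inter_preimage_symm hV
  have hmΩ : φ m ∈ Ω := ⟨φ.map_source hmφ, by simpa [φ.left_inv hmφ] using hm⟩
  have hl : ∀ i, ContDiffOn 𝕜 ∞ (l i) Ω := fun i => (hf i).contDiffOn_comp_chart_symm hφ
  let ξ : Fin n → Model 𝕜 n →L[𝕜] 𝕜 := fun i => fderiv 𝕜 (l i) (φ m)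
  have hξ : LinearIndependent 𝕜 ξ := by
    rw [← linearIndependent_comp_chartDeriv_iff hφ hmφ]
    simpa only [dAt_eq_of_contMDiffOn hφ hV (hf _) hmφ hm] using hLI
  obtain ⟨v, hv⟩ := hξ.exists_dual_vectors_clm
  -- Moving `x` by `l i x - ξ i x` in the dual directions `v i` gives `ξ i ∘ F = l i`, and the
  -- derivative at `φ m` is the identity.
  let F : Model 𝕜 n → Model 𝕜 n := fun x => x + ∑ i, (l i x - ξ i x) • v i
  let D : Model 𝕜 n → Model 𝕜 n →L[𝕜] Model 𝕜 n := fun x =>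
    ContinuousLinearMap.id 𝕜 _ + ∑ i, (fderiv 𝕜 (l i) x - ξ i).smulRight (v i)
  have hF : ContDiffOn 𝕜 ∞ F Ω := contDiffOn_id.add <| ContDiffOn.sum fun i _ =>
    ((hl i).sub (ξ i).contDiff.contDiffOn).smul contDiffOn_const
  have hD : ∀ x ∈ Ω, HasFDerivAt F (D x) x := fun x hx =>
    (hasFDerivAt_id x).add <| HasFDerivAt.fun_sum fun i _ =>
      ((((hl i).contDiffAt (hΩ.mem_nhds hx)).differentiableAt (by simp)).hasFDerivAt.sub
        (ξ i).hasFDerivAt).smul_const (v i)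
  have hDc : ContinuousOn D Ω := by
    refine continuousOn_const.add (continuousOn_finsetSum _ fun i _ => ?_)
    exact ((ContinuousLinearMap.smulRightL 𝕜 (Model 𝕜 n) (Model 𝕜 n)).flip
      (v i)).continuous.comp_continuousOn
      (((hl i).continuousOn_fderiv_of_isOpen hΩ (by simp)).sub continuousOn_const)
  have hD0 : D (φ m) = (ContinuousLinearEquiv.refl 𝕜 (Model 𝕜 n) :
      Model 𝕜 n →L[𝕜] Model 𝕜 n) := by
    ext1 u
    simp [D, ξ]
  have hFξ : ∀ x i, ξ i (F x) = l i x := by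
    intro x i
    simp [F, map_sum, hv]
  obtain ⟨Φ, hΦ, hmΦ, hsub, hΦF⟩ := exists_chart_comp hφ
    (hDc.isOpen_inter_preimage hΩ ContinuousLinearEquiv.isOpen) (hF.mono Set.inter_subset_left)
    (fun x hx => by
      obtain ⟨L, hL⟩ := hx.2
      exact ⟨L, hL ▸ hD x hx.1⟩) hmφ ⟨hmΩ, ⟨_, hD0.symm⟩⟩
  have hp : ∀ p ∈ Φ.source, φ.symm (φ p) = p := fun p hp => φ.left_inv (hsub hp).1
  refine ⟨Φ, hΦ, ξ, hmΦ, fun p hpΦ => ?_, hξ, fun p hpΦ i => ?_⟩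
  · have := (hsub hpΦ).2.1.2
    rwa [Set.mem_preimage, hp p hpΦ] at this
  · rw [hΦF, hFξ]
    simp [l, hp p hpΦ]

theorem eq_xIdx_or_eq_yIdx (k : Fin (2 * n)) : (∃ i : Fin n, k = xIdx i) ∨ ∃ i : Fin n, k = yIdx i := by
  rcases lt_or_ge (k : ℕ) n with h | h
  · exact .inl ⟨⟨k, h⟩, rfl⟩
  · exact .inr ⟨⟨k - n, by omega⟩, Fin.ext (by simp [yIdx]; omega)⟩

theorem sum_eq_sum_yIdx_add_xIdx {A : Type*} [AddCommMonoid A] (f : Fin (2 * n) → A) :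
    ∑ k, f k = ∑ i : Fin n, (f (yIdx i) + f (xIdx i)) := by
  rw [Finset.sum_add_distrib, add_comm, ← Fintype.sum_equiv (finCongr (two_mul n).symm)
    (fun k => f (finCongr (two_mul n).symm k)) f fun _ => rfl, Fin.sum_univ_add]
  rfl

/-- The map with components `f` and `g`. -/
def pairMap {X : Type*} (f g : Fin n → X → 𝕜) (x : X) : Model 𝕜 n :=
  WithLp.toLp 2 fun k => if h : (k : ℕ) < n then f ⟨k, h⟩ x else g ⟨k - n, by omega⟩ x

theorem pairMap_xIdx {X : Type*} (f g : Fin n → X → 𝕜) (x : X) (i : Fin n) :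
    pairMap f g x (xIdx i) = f i x := by
  simp [pairMap, xIdx]

theorem pairMap_yIdx {X : Type*} (f g : Fin n → X → 𝕜) (x : X) (i : Fin n) :
    pairMap f g x (yIdx i) = g i x := by
  simp [pairMap, yIdx]

theorem hasFDerivAt_pairMap {E : Type*} [NormedAddCommGroup E] [NormedSpace 𝕜 E]
    {f g : Fin n → E → 𝕜} {x : E} (hf : ∀ i, DifferentiableAt 𝕜 (f i) x)
    (hg : ∀ i, DifferentiableAt 𝕜 (g i) x) :
    ∃ L : E →L[𝕜] Model 𝕜 n, HasFDerivAt (pairMap f g) L x ∧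
      (∀ v i, L v (xIdx i) = fderiv 𝕜 (f i) x v) ∧ ∀ v i, L v (yIdx i) = fderiv 𝕜 (g i) x v := by
  have h : DifferentiableAt 𝕜 (pairMap f g) x := by
    rw [differentiableAt_euclidean]
    intro k
    obtain ⟨i, rfl⟩ | ⟨i, rfl⟩ := eq_xIdx_or_eq_yIdx k
    · simpa only [pairMap_xIdx] using hf i
    · simpa only [pairMap_yIdx] using hg i
  have h' : ∀ k, HasFDerivAt (fun x => pairMap f g x k)
      ((EuclideanSpace.proj k : Model 𝕜 n →L[𝕜] 𝕜).comp (fderiv 𝕜 (pairMap f g) x)) x := fun k =>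
    (EuclideanSpace.proj k : Model 𝕜 n →L[𝕜] 𝕜).hasFDerivAt.comp x h.hasFDerivAt
  refine ⟨_, h.hasFDerivAt, fun v i => ?_, fun v i => ?_⟩
  · have := (h' (xIdx i)).fderiv
    simp only [pairMap_xIdx] at this
    exact (congrArg (fun L : E →L[𝕜] 𝕜 => L v) this).symm
  · have := (h' (yIdx i)).fderiv
    simp only [pairMap_yIdx] at this
    exact (congrArg (fun L : E →L[𝕜] 𝕜 => L v) this).symm

theorem contDiffOn_pairMap {E : Type*} [NormedAddCommGroup E] [NormedSpace 𝕜 E]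
    {f g : Fin n → E → 𝕜} {s : Set E} (hf : ∀ i, ContDiffOn 𝕜 ∞ (f i) s)
    (hg : ∀ i, ContDiffOn 𝕜 ∞ (g i) s) : ContDiffOn 𝕜 ∞ (pairMap f g) s := by
  rw [contDiffOn_euclidean]
  intro k
  obtain ⟨i, rfl⟩ | ⟨i, rfl⟩ := eq_xIdx_or_eq_yIdx k
  · simpa only [pairMap_xIdx] using hf i
  · simpa only [pairMap_yIdx] using hg i

theorem dAt_coord {Φ : OpenPartialHomeomorph M (Model 𝕜 n)}
    (hΦ : Φ ∈ IsManifold.maximalAtlas (Mdl 𝕜 n) ∞ M) {m : M} (hm : m ∈ Φ.source)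
    (k : Fin (2 * n)) (v : Tan 𝕜 n m) : dAt 𝕜 n (coord Φ k) m v = chartDeriv Φ m v k := by
  rw [dAt_eq_of_eventuallyEq hΦ hm (f := coord Φ k)
    (g := (EuclideanSpace.proj k : Model 𝕜 n →L[𝕜] 𝕜))
    (EuclideanSpace.proj k : Model 𝕜 n →L[𝕜] 𝕜).differentiableAt .rfl, ContinuousLinearMap.fderiv]
  rfl

theorem sum_dAt_coord_smul_coordVec {Φ : OpenPartialHomeomorph M (Model 𝕜 n)}
    (hΦ : Φ ∈ IsManifold.maximalAtlas (Mdl 𝕜 n) ∞ M) {m : M} (hm : m ∈ Φ.source)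
    (v : Tan 𝕜 n m) : v = ∑ k, dAt 𝕜 n (coord Φ k) m v • coordVec Φ k m := by
  let e := (mdifferentiable_of_mem_maximalAtlas hΦ).mfderiv hm
  have he : mfderiv (Mdl 𝕜 n) (Mdl 𝕜 n) Φ m
      = (e : Tan 𝕜 n m →L[𝕜] TangentSpace (Mdl 𝕜 n) (Φ m)) := rfl
  have h1 : ∀ k, coordVec Φ k m = e.symm (EuclideanSpace.single k (1 : 𝕜) : Model 𝕜 n) := by
    intro k
    rw [coordVec, he, ContinuousLinearMap.inverse_equiv]
    rfl
  apply e.injective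
  rw [map_sum]
  simp only [map_smul, h1, dAt_coord hΦ hm]
  have h2 : ∀ k, e (e.symm (EuclideanSpace.single k (1 : 𝕜) : Model 𝕜 n))
      = (EuclideanSpace.single k (1 : 𝕜) : Model 𝕜 n) := fun k => e.apply_symm_apply _
  simp only [h2]
  change chartDeriv Φ m v = ∑ k, chartDeriv Φ m v k • (EuclideanSpace.single k (1 : 𝕜) : Model 𝕜 n)
  ext k
  simp [Pi.single_apply]

variable {P P' : CotangentToTangent 𝕜 n M}

/-- An eigencovector of the recursion tensor, in a chart. -/
theorem dAt_nijenhuis_of_eigencovector (h : IsBihamiltonian P P')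
    (hP : ∀ m, Function.Bijective (P m)) {φ : OpenPartialHomeomorph M (Model 𝕜 n)}
    (hφ : φ ∈ IsManifold.maximalAtlas (Mdl 𝕜 n) ∞ M) {m : M} (hm : m ∈ φ.source)
    {γ : Model 𝕜 n →L[𝕜] 𝕜} {c : 𝕜} (hγ : pushTensor P' φ (φ m) γ = c • pushTensor P φ (φ m) γ)
    (v : Tan 𝕜 n m) : γ (chartDeriv φ m (nijenhuis P P' hP m v)) = c * γ (chartDeriv φ m v) := by
  have hx := φ.map_source hm
  obtain ⟨α, hα⟩ := (pushTensor_bijective hP hφ hx).2 (chartDeriv φ m v)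
  rw [chartDeriv_nijenhuis hP hφ hm, ← hα, localNijenhuis_apply P' hP hφ hx,
    (h.right.isLocalPoisson hφ).antisymm _ hx, hγ, map_smul, smul_eq_mul,
    (h.left.isLocalPoisson hφ).antisymm _ hx γ]
  ring

/-- In a chart with linear `lam i` the conjugate functions supply the other half of the coordinates.
The bracket relations show that the combined map is a local diffeomorphism, and `N` is diagonal
because all coordinate differentials are eigencovectors. -/
theorem IsEigenvalueSystem.exists_isDarbouxNijenhuis [IsManifold (Mdl 𝕜 n) ∞ M]
    (h : IsBihamiltonian P P') (hP : ∀ m, Function.Bijective (P m)) {V : Set M} (hV : IsOpen V)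
    {lam : Fin n → M → 𝕜} (hlam : IsEigenvalueSystem (nijenhuis P P' hP) V lam) {m : M}
    (hmV : m ∈ V) (hm : m ∈ independenceLocus (nijenhuis P P' hP)) :
    ∃ Φ : OpenPartialHomeomorph M (Model 𝕜 n), m ∈ Φ.source ∧ Φ.source ⊆ V ∧
      (∀ p ∈ Φ.source, ∀ i, coord Φ (xIdx i) p = lam i p) ∧
      IsDarbouxNijenhuis P (nijenhuis P P' hP) lam Φ := by
  -- Inside the open independence locus the eigenvalues are distinct on the whole chart, as the
  -- pointwise diagonalization requires.
  have hV' := hV.inter (isOpen_independenceLocus h hP)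
  obtain ⟨φ, hφ, ξ, hmφ, hφV, hξ, hlamξ⟩ := exists_chart_eq_linear hV'
    (fun i => (hlam.smooth i).mono Set.inter_subset_left) ⟨hmV, hm⟩
    (hlam.injective_and_linearIndependent h hP hV hmV hm).2
  have hQ := h.left.isLocalPoisson hφ
  have hQ' := h.right.isLocalPoisson hφ
  have hlamev : ∀ p ∈ φ.source, ∀ i, lam i ∘ φ.symm =ᶠ[𝓝 (φ p)] ξ i := by
    intro p hp i
    filter_upwards [φ.open_target.mem_nhds (φ.map_source hp)] with x hx
    rw [Function.comp_apply, hlamξ _ (φ.map_target hx), φ.right_inv hx]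
  have hinjp : ∀ p ∈ φ.source, Function.Injective fun i => lam i p := fun p hp =>
    (hlam.injective_and_linearIndependent h hP hV (hφV hp).1 (hφV hp).2).1
  have hinj : ∀ x ∈ φ.target, Function.Injective fun i => ξ i x := by
    intro x hx
    have := hinjp _ (φ.map_target hx)
    simpa only [hlamξ _ (φ.map_target hx), φ.right_inv hx] using this
  have heig : ∀ x ∈ φ.target, ∀ i,
      pushTensor P' φ x (ξ i) = ξ i x • pushTensor P φ x (ξ i) := by
    intro x hx i
    obtain ⟨p, hp, rfl⟩ : ∃ p ∈ φ.source, φ p = x := ⟨φ.symm x, φ.map_target hx, φ.right_inv hx⟩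
    ext k
    -- Tested on coordinate covectors, the eigencovector relation becomes by antisymmetry an
    -- equality of vectors.
    have h1 := hlam.fderiv_apply h hP hφ hV hp (hφV hp).1 (hinjp p hp) i (EuclideanSpace.proj k)
    rw [(hlamev p hp i).fderiv_eq, ContinuousLinearMap.fderiv, hQ'.antisymm _ hx,
      hQ.antisymm _ hx, hlamξ p hp] at h1
    have h2 : pushTensor P' φ (φ p) (ξ i) k = ξ i (φ p) * pushTensor P φ (φ p) (ξ i) k := by
      rw [mul_neg] at h1
      exact neg_injective h1
    exact h2
  obtain ⟨U, y, hU, hmU, hUφ, hy, hUy⟩ := exists_conjugate_functions (by simp) φ.open_target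
    (φ.map_source hmφ) hQ hQ' (isLocalPoisson_sub_smul h hφ)
    (fun x hx => pushTensor_bijective hP hφ hx) hξ hinj heig
  have hyd : ∀ x ∈ U, ∀ i, DifferentiableAt 𝕜 (y i) x := fun x hx i =>
    ((hy i).contDiffAt (hU.mem_nhds hx)).differentiableAt (by simp)
  let F : Model 𝕜 n → Model 𝕜 n := pairMap (fun i => ξ i) y
  have hF : ContDiffOn 𝕜 ∞ F U := contDiffOn_pairMap (fun i => (ξ i).contDiff.contDiffOn) hy
  have hF' : ∀ x ∈ U, ∃ L : Model 𝕜 n ≃L[𝕜] Model 𝕜 n,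
      HasFDerivAt F (L : Model 𝕜 n →L[𝕜] Model 𝕜 n) x := by
    intro x hx
    obtain ⟨L, hL, hLx, hLy⟩ := hasFDerivAt_pairMap (f := fun i => ξ i) (g := y)
      (fun i => (ξ i).differentiableAt) (hyd x hx)
    obtain ⟨hxy, hxx, hyy, -⟩ := hUy x hx
    have hsurj : Function.Surjective L := by
      intro w
      -- By the bracket relations `L` maps the vectors `P dy_j` and `-P dx_j` to the standard basis.
      refine ⟨∑ j, (w (xIdx j) • pushTensor P φ x (fderiv 𝕜 (y j) x)
        - w (yIdx j) • pushTensor P φ x (ξ j)), ?_⟩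
      ext k
      obtain ⟨i, rfl⟩ | ⟨i, rfl⟩ := eq_xIdx_or_eq_yIdx k
      · rw [hLx, ContinuousLinearMap.fderiv]
        simp [map_sum, hxy, hxx]
      · rw [hLy]
        have hyx : ∀ j, fderiv 𝕜 (y i) x (pushTensor P φ x (ξ j)) = -if j = i then 1 else 0 :=
          fun j => by rw [hQ.antisymm x (hUφ hx), hxy]
        simp [map_sum, hyy, hyx]
    have hbij : Function.Bijective L.toLinearMap :=
      ⟨LinearMap.injective_iff_surjective.2 hsurj, hsurj⟩
    exact ⟨(LinearEquiv.ofBijective L.toLinearMap hbij).toContinuousLinearEquiv,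
      hL.congr_fderiv (by ext; rfl)⟩
  obtain ⟨Φ, hΦ, hmΦ, hsub, hΦF⟩ := exists_chart_comp hφ hU hF hF' hmφ hmU
  have hcx : ∀ i, coord Φ (xIdx i) = ξ i ∘ φ := fun i => funext fun p => by
    rw [coord, hΦF, pairMap_xIdx]; rfl
  have hcy : ∀ i, coord Φ (yIdx i) = y i ∘ φ := fun i => funext fun p => by
    rw [coord, hΦF, pairMap_yIdx]; rfl
  refine ⟨Φ, hmΦ, fun p hp => (hφV (hsub hp).1).1, fun p hp i => ?_, hΦ, fun p hp i j => ?_,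
    fun p hp i j => ?_, fun p hp i j => ?_, fun p hp v => ?_⟩
  · rw [hcx, hlamξ p (hsub hp).1]; rfl
  · rw [hcx, hcy, bracket_eq_of_eventuallyEq P hφ (hsub hp).1 (ξ i).differentiableAt .rfl
      (hyd _ (hsub hp).2 j) .rfl, ContinuousLinearMap.fderiv]
    exact (hUy _ (hsub hp).2).1 i j
  · rw [hcx, hcx, bracket_clm_comp_chart P hφ (hsub hp).1]
    exact (hUy _ (hsub hp).2).2.1 i j
  · rw [hcy, hcy, bracket_eq_of_eventuallyEq P hφ (hsub hp).1 (hyd _ (hsub hp).2 i) .rfl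
      (hyd _ (hsub hp).2 j) .rfl]
    exact (hUy _ (hsub hp).2).2.2.1 i j
  · have hx : ∀ i, dAt 𝕜 n (coord Φ (xIdx i)) p (nijenhuis P P' hP p v)
        = lam i p * dAt 𝕜 n (coord Φ (xIdx i)) p v := by
      intro i
      rw [hcx, dAt_eq_of_eventuallyEq hφ (hsub hp).1 (ξ i).differentiableAt .rfl,
        ContinuousLinearMap.fderiv, hlamξ p (hsub hp).1]
      exact dAt_nijenhuis_of_eigencovector h hP hφ (hsub hp).1 (heig _ (hUφ (hsub hp).2) i) v
    have hy' : ∀ i, dAt 𝕜 n (coord Φ (yIdx i)) p (nijenhuis P P' hP p v)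
        = lam i p * dAt 𝕜 n (coord Φ (yIdx i)) p v := by
      intro i
      rw [hcy, dAt_eq_of_eventuallyEq hφ (hsub hp).1 (hyd _ (hsub hp).2 i) .rfl,
        hlamξ p (hsub hp).1]
      exact dAt_nijenhuis_of_eigencovector h hP hφ (hsub hp).1 ((hUy _ (hsub hp).2).2.2.2 i) v
    refine (sum_dAt_coord_smul_coordVec hΦ hp _).trans ?_
    rw [sum_eq_sum_yIdx_add_xIdx]
    refine Finset.sum_congr rfl fun i _ => ?_
    rw [hx, hy', smul_add, smul_smul, smul_smul]

end DarbouxNijenhuis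

end

theorem proposition2p7 {𝕜 : Type*} [RCLike 𝕜] {n : ℕ} {M : Type*} [TopologicalSpace M]
    [ChartedSpace (Model 𝕜 n) M] [IsManifold (Mdl 𝕜 n) ∞ M]
    (P P' : CotangentToTangent 𝕜 n M) (hPP' : IsBihamiltonian P P')
    (hP : ∀ m, Function.Bijective (P m))
    {𝕂 : Type*} [RCLike 𝕂] [NormedAlgebra 𝕜 𝕂] :
    -- the set `U` where `dI₁ ∧ ⋯ ∧ dIₙ ≠ 0` is open
    IsOpen (independenceLocus (nijenhuis P P' hP)) ∧
    -- near a point where they are different, the `n` eigenvalues are smooth functions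
    (∀ m : M, IsRegularAt 𝕂 (nijenhuis P P' hP) m →
      ∃ (V : Set M) (lam : Fin n → M → 𝕂), IsOpen V ∧ m ∈ V ∧
        IsEigenvalueSystem (nijenhuis P P' hP) V lam) ∧
    -- on `U` eigenvalue functions are distinct, independent, and satisfy `N^* dλ = λ dλ`
    (∀ (V : Set M) (lam : Fin n → M → 𝕂), IsOpen V →
      IsEigenvalueSystem (nijenhuis P P' hP) V lam →
      ∀ m ∈ V, m ∈ independenceLocus (nijenhuis P P' hP) →
        (Function.Injective fun i => lam i m) ∧
        LinearIndependent 𝕂 (fun i => dAt 𝕜 n (lam i) m) ∧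
        ∀ i, dAt 𝕜 n (lam i) m ∘ₗ nijenhuis P P' hP m = lam i m • dAt 𝕜 n (lam i) m) ∧
    -- on `U` eigenvalue functions with values in `𝕜` are half of a set of DN coordinates
    (∀ (V : Set M) (lam : Fin n → M → 𝕜), IsOpen V →
      IsEigenvalueSystem (nijenhuis P P' hP) V lam →
      ∀ m ∈ V, m ∈ independenceLocus (nijenhuis P P' hP) →
        ∃ Φ : OpenPartialHomeomorph M (Model 𝕜 n), m ∈ Φ.source ∧ Φ.source ⊆ V ∧
          (∀ p ∈ Φ.source, ∀ i, coord Φ (xIdx i) p = lam i p) ∧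
          IsDarbouxNijenhuis P (nijenhuis P P' hP) lam Φ) := by
  refine ⟨isOpen_independenceLocus hPP' hP, fun m hm => exists_isEigenvalueSystem hPP' hP hm,
    fun V lam hV hlam m hmV hm => ?_, fun V lam hV hlam m hmV hm =>
      hlam.exists_isDarbouxNijenhuis hPP' hP hV hmV hm⟩
  have h := hlam.injective_and_linearIndependent hPP' hP hV hmV hm
  exact ⟨h.1, h.2, hlam.dAt_comp_nijenhuis hPP' hP hV hmV h.1⟩
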